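/- Conventions. Manifolds are smooth, finite-dimensional, Hausdorff, second countable and without boundary; vector bundles are smooth, real and of finite rank. Let $(W \to E; A \to M)$ be a double vector bundle, i.e. a commutative square of vector bundles $\tilde p: W\to E$, $\tilde q: W\to A$, $q: E \to M$, $p: A\to M$ such that the projection, addition, scalar multiplications and zero section of $W\to A$ are vector bundle maps (from the bundles over $E$) covering those of $E\to M$. For $\lambda\in\mathbb R$ let $h_\lambda$ be the multiplication by $\lambda$ in the fibres of $W\to A$ (covering multiplication by $\lambda$ on $E$); for $\lambda\neq 0$ put $h_\lambda^*w=h_\lambda^{-1}\circ w\circ h_\lambda$ for $w\in\Gamma(W,E)$ and $(h_\lambda^*c)(w_1,\dots,w_k)=h_\lambda^*\big(c(h_{\lambda^{-1}}^*w_1,\dots,h_{\lambda^{-1}}^*w_k)\big)$ for $c:\Gamma(W,E)^k\to\Gamma(W,E)$. For $k\ge 0$ let $\mathfrak D^k(W,E)$ be the space of skew-symmetric $\mathbb R$-multilinear maps $c:\Gamma(W,E)^k\to\Gamma(W,E)$ which, if $k\ge1$, admit a symbol: a bundle map $\sigma_c:\wedge^{k-1}W\to TE$ with $c(w_1,\dots,w_{k-1},fw_k)=\sigma_c(w_1,\dots,w_{k-1})(f)\,w_k+f\,c(w_1,\dots,w_k)$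 for $f\in C^\infty(E)$; so $\mathfrak D^0(W,E)=\Gamma(W,E)$. Call $c\in\mathfrak D^k(W,E)$ linear (resp. core) if $h_\lambda^*c=c$ (resp. $h_\lambda^*c=\lambda^{-1}c$) for all $\lambda>0$, and write $\mathfrak D^k_{\mathrm{lin}}(W,E)$, $\mathfrak D^k_{\mathrm{core}}(W,E)$ for the spaces of these. Let $(W\Rightarrow E;A\Rightarrow M)$ be a VB-algebroid: a Lie algebroid structure on $W\to E$ whose anchor $W \to TE$ is a vector bundle map from $W\to A$ to $TE\to TM$ covering a vector bundle map $A\to TM$, and whose bracket satisfies $[\Gamma_{\mathrm{lin}},\Gamma_{\mathrm{lin}}]\subset\Gamma_{\mathrm{lin}}$, $[\Gamma_{\mathrm{lin}},\Gamma_{\mathrm{core}}]\subset\Gamma_{\mathrm{core}}$, $[\Gamma_{\mathrm{core}},\Gamma_{\mathrm{core}}]=0$. Here $\Gamma_{\mathrm{lin}}$ is the space of sections of $W\to E$ that are vector bundle maps from $E \to M$ to $W \to A$ covering a section of $A\to M$, and $\Gamma_{\mathrm{core}}$ consists of the sections $e\mapsto 0_e+_A\chi_{q(e)}$, $\chi$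 a section of the core bundle $C\to M$ (the points of $W$ that project to the zero sections of both $E$ and $A$). Let $C^{k-1}_{\mathrm{def}}(W)=\mathfrak D^{k}(W,E)$ and $C^{k-1}_{\mathrm{def,lin}}(W)=\mathfrak D^{k}_{\mathrm{lin}}(W,E)$, $k\ge 0$, with $$\delta c(\alpha_0,\dots,\alpha_{k})=\sum_i(-1)^i[\alpha_i,c(\dots,\widehat{\alpha_i},\dots)]+\sum_{i<j}(-1)^{i+j}c([\alpha_i,\alpha_j],\dots,\widehat{\alpha_i},\dots,\widehat{\alpha_j},\dots),\qquad c\in\mathfrak D^k(W,E).$$ Theorem (Linearization of deformation cochains). $C_{\mathrm{def}}(W)$ is a cochain complex and $C_{\mathrm{def,lin}}(W)$ is a subcomplex. For every $c\in\mathfrak D^k(W,E)$ the limits (pointwise on sections and on points of $E$) $$c_{\mathrm{core}}=\lim_{\lambda\to0}\lambda\cdot h_\lambda^*c,\qquad c_{\mathrm{lin}}=\lim_{\lambda\to0}\big(h_\lambda^*c-\lambda^{-1}c_{\mathrm{core}}\big)$$ exist and define linear maps $\mathrm{core}:\mathfrak D^k(W,E)\to\mathfrak D^k_{\mathrm{core}}(W,E)$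 and $\mathrm{lin}:C_{\mathrm{def}}(W)\to C_{\mathrm{def,lin}}(W)$. The linearization map $\mathrm{lin}$ is a cochain map splitting the inclusion $C_{\mathrm{def,lin}}(W)\hookrightarrow C_{\mathrm{def}}(W)$. In particular there is a direct sum decomposition $C_{\mathrm{def}}(W)= C_{\mathrm{def,lin}}(W)\oplus\ker(\mathrm{lin})$ of cochain complexes, and the inclusion induces an injection $H_{\mathrm{def,lin}}(W)\hookrightarrow H_{\mathrm{def}}(W)$ in every degree. -/

import Mathlib

open Bundle Filter Function
open scoped Manifold ContDiff Topology

set_option linter.unusedSectionVars false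

noncomputable section

namespace VBDef

/-! ### Total spaces of vector bundles -/

section TotalSpace

variable {B : Type*} {F : Type*} {V : B → Type*} [∀ x, AddCommGroup (V x)] [∀ x, Module ℝ (V x)]

/-- Fibrewise scalar multiplication on the total space of a vector bundle
(its homogeneity structure `h_t`). -/
def scale (t : ℝ) (x : TotalSpace F V) : TotalSpace F V := ⟨x.proj, t • x.snd⟩

theorem scale_inv_scale (t : ℝˣ) (x : TotalSpace F V) :
    scale ((t⁻¹ : ℝˣ) : ℝ) (scale (t : ℝ) x) = x :=
  congrArg (TotalSpace.mk x.proj) (inv_smul_smul t x.snd)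

/-- `IsSum x y z`: the points `x`, `y` of the total space lie in the same fibre and
`z` is their sum in that fibre. -/
def IsSum (x y z : TotalSpace F V) : Prop :=
  ∃ (b : B) (u v : V b), x = ⟨b, u⟩ ∧ y = ⟨b, v⟩ ∧ z = ⟨b, u + v⟩

end TotalSpace

/-! ### Sections, multiderivations and Lie algebroids -/

section Bundles

variable {EB : Type*} [NormedAddCommGroup EB] [NormedSpace ℝ EB]
  {HB : Type*} [TopologicalSpace HB] (IB : ModelWithCorners ℝ EB HB)
  {B : Type*} [TopologicalSpace B] [ChartedSpace HB B] [IsManifold IB ∞ B]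
  (F : Type*) [NormedAddCommGroup F] [NormedSpace ℝ F]
  (V : B → Type*) [TopologicalSpace (TotalSpace F V)]
  [∀ x, AddCommGroup (V x)] [∀ x, Module ℝ (V x)] [∀ x, TopologicalSpace (V x)]
  [FiberBundle F V] [VectorBundle ℝ F V]

/-- The space `Γ(V)` of smooth sections. -/
abbrev Sec := Cₛ^∞⟮IB; F, V⟯

/-- Maps `Γ(V)^k → Γ(V)`, a priori without any further property. -/
abbrev Cochain (k : ℕ) := (Fin k → Sec IB F V) → Sec IB F V

variable {IB F V}

/-- The product of a smooth function and a smooth section. -/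
def fsmul (f : C^∞⟮IB, B; ℝ⟯) (s : Sec IB F V) : Sec IB F V :=
  ⟨fun x => f x • s x, f.contMDiff.smul_section s.contMDiff⟩

/-- The derivative `v(f)` of the function `f` along tangent vectors `v` at `x`. -/
def dirDeriv (f : C^∞⟮IB, B; ℝ⟯) (x : B) : TangentSpace IB x →L[ℝ] ℝ :=
  (NormedSpace.fromTangentSpace (𝕜 := ℝ) (f x)).toContinuousLinearMap ∘L mfderiv IB 𝓘(ℝ, ℝ) f x

/-- `σ` is a symbol of the `(k+1)`-ary map `c`: it is a smooth bundle map `∧^k V → TB`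
(a family of alternating maps on the fibres which takes smooth sections to smooth vector fields)
and the Leibniz rule holds in the last entry. -/
def IsSymbol {k : ℕ} (c : Cochain IB F V (k + 1))
    (σ : ∀ x : B, (V x) [⋀^Fin k]→ₗ[ℝ] TangentSpace IB x) : Prop :=
  (∀ w : Fin k → Sec IB F V, ContMDiff IB IB.tangent ∞
      (fun x => (⟨x, σ x (fun i => w i x)⟩ : TangentBundle IB B))) ∧
  ∀ (w : Fin k → Sec IB F V) (f : C^∞⟮IB, B; ℝ⟯) (s : Sec IB F V) (x : B),
    c (Fin.snoc w (fsmul f s)) x =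
      dirDeriv f x (σ x (fun i => w i x)) • s x + f x • c (Fin.snoc w s) x

/-- Existence of a symbol; no condition on maps without entries. -/
def HasSymbol : ∀ {k : ℕ}, Cochain IB F V k → Prop
  | 0, _ => True
  | _ + 1, c => ∃ σ, IsSymbol c σ

theorem hasSymbol_zero : ∀ {k : ℕ}, HasSymbol (0 : Cochain IB F V k)
  | 0 => trivial
  | k + 1 => by
      refine ⟨fun x => 0, fun w => ?_, fun w f s x => ?_⟩
      · exact contMDiff_zeroSection ℝ (TangentSpace IB : B → Type _)
      · simp

theorem HasSymbol.add : ∀ {k : ℕ} {c c' : Cochain IB F V k},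
    HasSymbol c → HasSymbol c' → HasSymbol (c + c')
  | 0, _, _, _, _ => trivial
  | k + 1, c, c', ⟨σ, h1, h2⟩, ⟨σ', h1', h2'⟩ => by
      refine ⟨fun x => σ x + σ' x, fun w => ?_, fun w f s x => ?_⟩
      · exact (h1 w).add_section (h1' w)
      · simp only [Pi.add_apply, ContMDiffSection.coe_add, h2, h2', AlternatingMap.add_apply,
          map_add, add_smul, smul_add]
        abel

theorem HasSymbol.smul (r : ℝ) : ∀ {k : ℕ} {c : Cochain IB F V k},
    HasSymbol c → HasSymbol (r • c)
  | 0, _, _ => trivial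
  | k + 1, c, ⟨σ, h1, h2⟩ => by
      refine ⟨fun x => r • σ x, fun w => ?_, fun w f s x => ?_⟩
      · exact (h1 w).const_smul_section
      · simp only [Pi.smul_apply, ContMDiffSection.coe_smul, h2, AlternatingMap.smul_apply,
          map_smul, smul_add, smul_smul, smul_eq_mul, mul_comm]

variable (IB F V) in
/-- The space `𝔇^k(V)` of multiderivations with `k` entries: skew-symmetric `ℝ`-multilinear maps
`Γ(V)^k → Γ(V)` that admit a symbol. For `k = 0` this is `Γ(V)`. -/
def multiDer (k : ℕ) : Submodule ℝ (Cochain IB F V k) where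
  carrier := {c | (∃ a : (Sec IB F V) [⋀^Fin k]→ₗ[ℝ] (Sec IB F V), ⇑a = c) ∧ HasSymbol c}
  zero_mem' := ⟨⟨0, rfl⟩, hasSymbol_zero⟩
  add_mem' := by
    rintro _ _ ⟨⟨a, rfl⟩, h⟩ ⟨⟨a', rfl⟩, h'⟩
    exact ⟨⟨a + a', rfl⟩, h.add h'⟩
  smul_mem' := by
    rintro r _ ⟨⟨a, rfl⟩, h⟩
    exact ⟨⟨r • a, rfl⟩, h.smul r⟩

variable (IB F V) in
/-- Lie algebroid structures on the vector bundle `V → B`. -/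
structure LieAlgebroid where
  /-- the anchor, a smooth bundle map `V → TB` -/
  anchor : ∀ x : B, V x →ₗ[ℝ] TangentSpace IB x
  contMDiff_anchor : ContMDiff (IB.prod 𝓘(ℝ, F)) IB.tangent ∞
    (fun v : TotalSpace F V => (⟨v.proj, anchor v.proj v.snd⟩ : TangentBundle IB B))
  /-- the Lie bracket on sections -/
  bracket : Sec IB F V →ₗ[ℝ] Sec IB F V →ₗ[ℝ] Sec IB F V
  bracket_self : ∀ a, bracket a a = 0
  jacobi : ∀ a b c,
    bracket a (bracket b c) + bracket b (bracket c a) + bracket c (bracket a b) = 0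
  leibniz : ∀ (a : Sec IB F V) (f : C^∞⟮IB, B; ℝ⟯) (b : Sec IB F V) (x : B),
    bracket a (fsmul f b) x = dirDeriv f x (anchor x (a x)) • b x + f x • bracket a b x

namespace LieAlgebroid

variable (L : LieAlgebroid IB F V)

/-- The anchor as a map of total spaces. -/
def anchorMap (v : TotalSpace F V) : TangentBundle IB B := ⟨v.proj, L.anchor v.proj v.snd⟩

/-- The deformation differential of a map with `k` entries (a cochain of degree `k - 1`):
`(δc)(α₀,…,α_k) = ∑ᵢ (-1)^i [αᵢ, c(…,α̂ᵢ,…)] + ∑_{i<j} (-1)^(i+j) c([αᵢ,αⱼ],…,α̂ᵢ,…,α̂ⱼ,…)`.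
In the double sum the pair `i < j` of indices is written `i.castSucc < j.succ` with `i ≤ j`. -/
def diffFun : ∀ {k : ℕ}, Cochain IB F V k → Cochain IB F V (k + 1)
  | 0, c => fun α => L.bracket (α 0) (c (Fin.removeNth 0 α))
  | k + 1, c => fun α =>
      ∑ i : Fin (k + 2), (-1 : ℝ) ^ (i : ℕ) • L.bracket (α i) (c (i.removeNth α)) +
      ∑ j : Fin (k + 1), ∑ i ∈ Finset.Iic j, (-1 : ℝ) ^ ((i : ℕ) + ((j : ℕ) + 1)) •
        c (Fin.cons (L.bracket (α i.castSucc) (α j.succ)) (i.removeNth (j.succ.removeNth α)))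

/-- The deformation differential `δ` as a linear map. -/
def diff (k : ℕ) : Cochain IB F V k →ₗ[ℝ] Cochain IB F V (k + 1) where
  toFun := L.diffFun
  map_add' c c' := by
    cases k with
    | zero => funext α; simp [diffFun]
    | succ k =>
      funext α
      simp only [diffFun, Pi.add_apply, map_add, smul_add, Finset.sum_add_distrib]
      abel
  map_smul' r c := by
    cases k with
    | zero => funext α; simp [diffFun]
    | succ k =>
      funext α
      simp only [diffFun, Pi.smul_apply, map_smul, RingHom.id_apply, smul_add, Finset.smul_sum,
        smul_comm r]

/-! Cohomology of a graded subspace `D` of the cochains with respect to `δ`. -/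

/-- Cocycles in `D` with `k` entries. -/
def cocycles (D : ∀ k, Submodule ℝ (Cochain IB F V k)) (k : ℕ) :
    Submodule ℝ (Cochain IB F V k) := D k ⊓ LinearMap.ker (L.diff k)

/-- Coboundaries of elements of `D`, with `k` entries. -/
def coboundaries (D : ∀ k, Submodule ℝ (Cochain IB F V k)) :
    ∀ k, Submodule ℝ (Cochain IB F V k)
  | 0 => ⊥
  | k + 1 => (D k).map (L.diff k)

/-- The cohomology of `D` at the place with `k` entries (cohomological degree `k - 1`). -/
abbrev cohomology (D : ∀ k, Submodule ℝ (Cochain IB F V k)) (k : ℕ) :=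
  ↥(L.cocycles D k) ⧸ (L.coboundaries D k).submoduleOf (L.cocycles D k)

theorem coboundaries_mono {D D' : ∀ k, Submodule ℝ (Cochain IB F V k)} (h : ∀ k, D k ≤ D' k) :
    ∀ k, L.coboundaries D k ≤ L.coboundaries D' k
  | 0 => le_rfl
  | k + 1 => Submodule.map_mono (h k)

/-- The map in cohomology induced by an inclusion `D ⊆ D'`. -/
def cohomologyMap {D D' : ∀ k, Submodule ℝ (Cochain IB F V k)} (h : ∀ k, D k ≤ D' k) (k : ℕ) :
    L.cohomology D k →ₗ[ℝ] L.cohomology D' k :=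
  Submodule.mapQ _ _ (Submodule.inclusion (inf_le_inf_right _ (h k)))
    (fun _ hc => L.coboundaries_mono h k hc)

end LieAlgebroid

end Bundles

/-! ### Double vector bundles -/

section scaleSmooth

variable {EB : Type*} [NormedAddCommGroup EB] [NormedSpace ℝ EB]
  {HB : Type*} [TopologicalSpace HB] (IB : ModelWithCorners ℝ EB HB)
  {B : Type*} [TopologicalSpace B] [ChartedSpace HB B]
  {F : Type*} [NormedAddCommGroup F] [NormedSpace ℝ F]
  {V : B → Type*} [TopologicalSpace (TotalSpace F V)]
  [∀ x, AddCommGroup (V x)] [∀ x, Module ℝ (V x)] [∀ x, TopologicalSpace (V x)]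
  [FiberBundle F V] [VectorBundle ℝ F V]

theorem contMDiff_scale (t : ℝ) : ContMDiff (IB.prod 𝓘(ℝ, F)) (IB.prod 𝓘(ℝ, F)) ∞
    (scale t : TotalSpace F V → TotalSpace F V) := by
  intro x₀
  rw [contMDiffAt_totalSpace]
  have h := (contMDiffAt_totalSpace (IB := IB) (n := ∞) (f := (id : TotalSpace F V → _))
    (x₀ := x₀)).1 contMDiffAt_id
  refine ⟨h.1, ?_⟩
  have hc : ContMDiffAt (IB.prod 𝓘(ℝ, F)) 𝓘(ℝ, ℝ) ∞ (fun _ : TotalSpace F V => t) x₀ :=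
    contMDiffAt_const
  refine (hc.smul h.2).congr_of_eventuallyEq ?_
  have ho := (trivializationAt F V x₀.proj).open_baseSet.preimage
    (FiberBundle.continuous_proj F V)
  filter_upwards [ho.mem_nhds (mem_baseSet_trivializationAt F V x₀.proj)] with x hx
  exact ((trivializationAt F V x₀.proj).linear ℝ hx).2 t x.snd

/-- The section with given values in the total space. -/
def secOfMap (f : B → TotalSpace F V) (hf : ContMDiff IB (IB.prod 𝓘(ℝ, F)) ∞ f)
    (hp : ∀ x, (f x).proj = x) : Sec IB F V where
  toFun x := hp x ▸ (f x).snd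
  contMDiff_toFun := by
    convert hf using 1
    funext x
    exact TotalSpace.ext (hp x).symm (by simp)

theorem mk_secOfMap (f : B → TotalSpace F V) (hf : ContMDiff IB (IB.prod 𝓘(ℝ, F)) ∞ f)
    (hp : ∀ x, (f x).proj = x) (x : B) :
    (⟨x, secOfMap IB f hf hp x⟩ : TotalSpace F V) = f x :=
  TotalSpace.ext (hp x).symm (by simp [secOfMap, DFunLike.coe])

theorem isSum_mk_iff {x : B} {u v z : V x} :
    IsSum (⟨x, u⟩ : TotalSpace F V) ⟨x, v⟩ ⟨x, z⟩ ↔ z = u + v := by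
  constructor
  · rintro ⟨b, u', v', h1, h2, h3⟩
    cases h1
    cases h2
    cases h3
    rfl
  · rintro rfl
    exact ⟨x, u, v, rfl, rfl, rfl⟩

end scaleSmooth

section Double

variable {EM : Type*} [NormedAddCommGroup EM] [NormedSpace ℝ EM]
  {HM : Type*} [TopologicalSpace HM] (IM : ModelWithCorners ℝ EM HM)
  {M : Type*} [TopologicalSpace M] [ChartedSpace HM M] [IsManifold IM ∞ M]
  (FE : Type*) [NormedAddCommGroup FE] [NormedSpace ℝ FE]
  (VE : M → Type*) [TopologicalSpace (TotalSpace FE VE)]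
  [∀ x, AddCommGroup (VE x)] [∀ x, Module ℝ (VE x)] [∀ x, TopologicalSpace (VE x)]
  [FiberBundle FE VE] [VectorBundle ℝ FE VE] [ContMDiffVectorBundle ∞ FE VE IM]
  (FA : Type*) [NormedAddCommGroup FA] [NormedSpace ℝ FA]
  (VA : M → Type*) [TopologicalSpace (TotalSpace FA VA)]
  [∀ x, AddCommGroup (VA x)] [∀ x, Module ℝ (VA x)] [∀ x, TopologicalSpace (VA x)]
  [FiberBundle FA VA] [VectorBundle ℝ FA VA] [ContMDiffVectorBundle ∞ FA VA IM]
  (FW : Type*) [NormedAddCommGroup FW] [NormedSpace ℝ FW]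
  (VW : TotalSpace FE VE → Type*) [TopologicalSpace (TotalSpace FW VW)]
  [∀ x, AddCommGroup (VW x)] [∀ x, Module ℝ (VW x)] [∀ x, TopologicalSpace (VW x)]
  [FiberBundle FW VW] [VectorBundle ℝ FW VW]
  [ContMDiffVectorBundle ∞ FW VW (IM.prod 𝓘(ℝ, FE))]
  (FU : Type*) [NormedAddCommGroup FU] [NormedSpace ℝ FU]
  (VU : TotalSpace FA VA → Type*) [TopologicalSpace (TotalSpace FU VU)]
  [∀ x, AddCommGroup (VU x)] [∀ x, Module ℝ (VU x)] [∀ x, TopologicalSpace (VU x)]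
  [FiberBundle FU VU] [VectorBundle ℝ FU VU]
  [ContMDiffVectorBundle ∞ FU VU (IM.prod 𝓘(ℝ, FA))]

/-- A double vector bundle `(W → E; A → M)`. The total space `W` is presented as the total space
of the vector bundle `VW` over `E`; its second vector bundle structure, over `A`, is that of the
vector bundle `VU` over `A`, carried over by the diffeomorphism `Φ` of total spaces. The fields
say that the projection `W → A`, the addition, the scalar multiplications and the zero section of
`W → A` are vector bundle maps over the corresponding structure maps of `E → M`. -/
structure DoubleVectorBundle where
  /-- the identification of the two presentations of `W` -/
  Φ : TotalSpace FW VW ≃ₘ^∞⟮(IM.prod 𝓘(ℝ, FE)).prod 𝓘(ℝ, FW),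
    (IM.prod 𝓘(ℝ, FA)).prod 𝓘(ℝ, FU)⟯ TotalSpace FU VU
  /-- the projection `W → A` covers the projection `E → M` -/
  proj_comm : ∀ w : TotalSpace FW VW, (Φ w).proj.proj = w.proj.proj
  /-- the projection `W → A` is fibrewise linear -/
  proj_add : ∀ w w' s : TotalSpace FW VW, IsSum w w' s →
    IsSum (Φ w).proj (Φ w').proj (Φ s).proj
  proj_smul : ∀ (r : ℝ) (w : TotalSpace FW VW), (Φ (scale r w)).proj = scale r (Φ w).proj
  /-- the addition of `W → A` covers the addition of `E → M` -/
  add_cover : ∀ w₁ w₂ w₃ : TotalSpace FW VW, IsSum (Φ w₁) (Φ w₂) (Φ w₃) →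
    IsSum w₁.proj w₂.proj w₃.proj
  /-- the addition of `W → A` is fibrewise linear -/
  add_add : ∀ w₁ w₂ w₃ w₁' w₂' w₃' s₁ s₂ s₃ : TotalSpace FW VW,
    IsSum (Φ w₁) (Φ w₂) (Φ w₃) → IsSum (Φ w₁') (Φ w₂') (Φ w₃') →
    IsSum w₁ w₁' s₁ → IsSum w₂ w₂' s₂ → IsSum w₃ w₃' s₃ → IsSum (Φ s₁) (Φ s₂) (Φ s₃)
  add_smul : ∀ (r : ℝ) (w₁ w₂ w₃ : TotalSpace FW VW), IsSum (Φ w₁) (Φ w₂) (Φ w₃) →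
    IsSum (Φ (scale r w₁)) (Φ (scale r w₂)) (Φ (scale r w₃))
  /-- scalar multiplication of `W → A` covers scalar multiplication of `E → M` -/
  smul_cover : ∀ (t : ℝ) (w : TotalSpace FW VW), (Φ.symm (scale t (Φ w))).proj = scale t w.proj
  /-- scalar multiplication of `W → A` is fibrewise linear -/
  smul_add : ∀ (t : ℝ) (w w' s : TotalSpace FW VW), IsSum w w' s →
    IsSum (Φ.symm (scale t (Φ w))) (Φ.symm (scale t (Φ w'))) (Φ.symm (scale t (Φ s)))
  smul_smul : ∀ (t r : ℝ) (w : TotalSpace FW VW),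
    Φ.symm (scale t (Φ (scale r w))) = scale r (Φ.symm (scale t (Φ w)))
  /-- the zero section of `W → A` covers the zero section of `E → M` -/
  zero_cover : ∀ a : TotalSpace FA VA, (Φ.symm ⟨a, 0⟩).proj = ⟨a.proj, 0⟩
  /-- the zero section of `W → A` is fibrewise linear -/
  zero_add : ∀ a a' s : TotalSpace FA VA, IsSum a a' s →
    IsSum (Φ.symm ⟨a, 0⟩) (Φ.symm ⟨a', 0⟩) (Φ.symm ⟨s, 0⟩)
  zero_smul : ∀ (r : ℝ) (a : TotalSpace FA VA), Φ.symm ⟨scale r a, 0⟩ = scale r (Φ.symm ⟨a, 0⟩)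

variable {IM FE VE FA VA FW VW FU VU}

namespace DoubleVectorBundle

variable (D : DoubleVectorBundle IM FE VE FA VA FW VW FU VU)

/-- The homogeneity structure `h_t` of the vector bundle `W → A`. -/
def h (t : ℝ) (w : TotalSpace FW VW) : TotalSpace FW VW := D.Φ.symm (scale t (D.Φ w))

theorem contMDiff_h (t : ℝ) : ContMDiff ((IM.prod 𝓘(ℝ, FE)).prod 𝓘(ℝ, FW))
    ((IM.prod 𝓘(ℝ, FE)).prod 𝓘(ℝ, FW)) ∞ (D.h t) :=
  D.Φ.symm.contMDiff.comp ((contMDiff_scale (IM.prod 𝓘(ℝ, FA)) t).comp D.Φ.contMDiff)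

/-- The pull-back `h_t^* w = h_t⁻¹ ∘ w ∘ h_t` of a section `w` of `W → E`, for `t ≠ 0`. -/
def pullSec (t : ℝˣ) (w : Sec (IM.prod 𝓘(ℝ, FE)) FW VW) : Sec (IM.prod 𝓘(ℝ, FE)) FW VW :=
  secOfMap (IM.prod 𝓘(ℝ, FE))
    (fun e => D.h ((t⁻¹ : ℝˣ) : ℝ) ⟨scale (t : ℝ) e, w (scale (t : ℝ) e)⟩)
    ((D.contMDiff_h _).comp (w.contMDiff.comp (contMDiff_scale IM _)))
    (fun e => (D.smul_cover _ _).trans (scale_inv_scale t e))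

theorem mk_pullSec (t : ℝˣ) (w : Sec (IM.prod 𝓘(ℝ, FE)) FW VW) (e : TotalSpace FE VE) :
    (⟨e, D.pullSec t w e⟩ : TotalSpace FW VW) =
      D.h ((t⁻¹ : ℝˣ) : ℝ) ⟨scale (t : ℝ) e, w (scale (t : ℝ) e)⟩ :=
  mk_secOfMap _ _ _ _ _

theorem pullSec_add (t : ℝˣ) (w w' : Sec (IM.prod 𝓘(ℝ, FE)) FW VW) :
    D.pullSec t (w + w') = D.pullSec t w + D.pullSec t w' := by
  ext e
  have := D.smul_add ((t⁻¹ : ℝˣ) : ℝ) ⟨scale (t : ℝ) e, w (scale (t : ℝ) e)⟩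
    ⟨scale (t : ℝ) e, w' (scale (t : ℝ) e)⟩ ⟨scale (t : ℝ) e, (w + w') (scale (t : ℝ) e)⟩
    (isSum_mk_iff.2 rfl)
  rw [ContMDiffSection.coe_add, Pi.add_apply, ← isSum_mk_iff (F := FW), mk_pullSec, mk_pullSec,
    mk_pullSec]
  exact this

theorem pullSec_smul (t : ℝˣ) (r : ℝ) (w : Sec (IM.prod 𝓘(ℝ, FE)) FW VW) :
    D.pullSec t (r • w) = r • D.pullSec t w := by
  ext e
  have := D.smul_smul ((t⁻¹ : ℝˣ) : ℝ) r ⟨scale (t : ℝ) e, w (scale (t : ℝ) e)⟩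
  have h2 : (⟨e, D.pullSec t (r • w) e⟩ : TotalSpace FW VW) = ⟨e, r • D.pullSec t w e⟩ := by
    have h3 := congrArg (scale r) (D.mk_pullSec t w e)
    exact (D.mk_pullSec t (r • w) e).trans (this.trans h3.symm)
  exact TotalSpace.mk_inj.1 h2

/-- The pull-back of a map `c : Γ(W,E)^k → Γ(W,E)`:
`(h_t^* c)(w₁,…,w_k) = h_t^*(c((h_t⁻¹)^* w₁,…,(h_t⁻¹)^* w_k))`. -/
def pull {k : ℕ} (t : ℝˣ) (c : Cochain (IM.prod 𝓘(ℝ, FE)) FW VW k) :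
    Cochain (IM.prod 𝓘(ℝ, FE)) FW VW k :=
  fun w => D.pullSec t (c (fun i => D.pullSec t⁻¹ (w i)))

/-- The space `𝔇^k_q(W,E)` of multiderivations with `k` entries of weight `q`:
`h_t^* c = t^q c` for all `t > 0`. -/
def multiDerWeight (q : ℤ) (k : ℕ) : Submodule ℝ (Cochain (IM.prod 𝓘(ℝ, FE)) FW VW k) where
  carrier := {c | c ∈ multiDer (IM.prod 𝓘(ℝ, FE)) FW VW k ∧
    ∀ t : ℝˣ, 0 < (t : ℝ) → D.pull t c = (t : ℝ) ^ q • c}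
  zero_mem' := by
    refine ⟨zero_mem _, fun t _ => funext fun w => ?_⟩
    simpa [pull] using D.pullSec_smul t 0 0
  add_mem' := by
    rintro c c' ⟨h1, h2⟩ ⟨h1', h2'⟩
    refine ⟨add_mem h1 h1', fun t ht => funext fun w => ?_⟩
    have e := congrFun (h2 t ht) w
    have e' := congrFun (h2' t ht) w
    simp only [pull, Pi.smul_apply] at e e'
    simp [pull, pullSec_add, e, e']
  smul_mem' := by
    rintro r c ⟨h1, h2⟩
    refine ⟨Submodule.smul_mem _ r h1, fun t ht => funext fun w => ?_⟩
    have e := congrFun (h2 t ht) w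
    simp only [pull, Pi.smul_apply] at e
    simp only [pull, Pi.smul_apply, pullSec_smul, e, smul_comm r]

/-- Linear multiderivations: those of weight `0`. -/
abbrev multiDerLin (k : ℕ) := D.multiDerWeight 0 k

/-- Core multiderivations: those of weight `-1`. -/
abbrev multiDerCore (k : ℕ) := D.multiDerWeight (-1) k

theorem multiDerLin_le (k : ℕ) :
    D.multiDerLin k ≤ multiDer (IM.prod 𝓘(ℝ, FE)) FW VW k := fun _ hc => hc.1

/-- A section of `W → E` is linear if it is a vector bundle map from `E → M` to `W → A` covering
a section of `A → M`. -/
def IsLinearSec (w : Sec (IM.prod 𝓘(ℝ, FE)) FW VW) : Prop :=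
  ∃ α : Sec IM FA VA, ∀ m : M, ∃ l : VE m →ₗ[ℝ] VU ⟨m, α m⟩,
    ∀ v : VE m, D.Φ ⟨⟨m, v⟩, w ⟨m, v⟩⟩ = ⟨⟨m, α m⟩, l v⟩

/-- A section of `W → E` is a core section if it is of the form `e ↦ 0_e +_A χ(q(e))` for a
section `χ` of the core `C → M`, the set of points of `W` that project to the zero sections of
both `E` and `A`. -/
def IsCoreSec (w : Sec (IM.prod 𝓘(ℝ, FE)) FW VW) : Prop :=
  ∃ χ : M → TotalSpace FW VW, ContMDiff IM ((IM.prod 𝓘(ℝ, FE)).prod 𝓘(ℝ, FW)) ∞ χ ∧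
    (∀ m, (χ m).proj = ⟨m, 0⟩ ∧ (D.Φ (χ m)).proj = ⟨m, 0⟩) ∧
    ∀ e : TotalSpace FE VE, IsSum (D.Φ ⟨e, 0⟩) (D.Φ (χ e.proj)) (D.Φ ⟨e, w e⟩)

end DoubleVectorBundle

variable (IM) in
/-- Addition in the fibres of the tangent prolongation `TE → TM` of `E → M`, i.e. the tangent map
of the addition `E ×_M E → E`: `v₃` is the sum of `v₁` and `v₂` if they are the velocities of
curves with `γ₃ = γ₁ + γ₂`. -/
def IsTangentSum (v₁ v₂ v₃ : TangentBundle (IM.prod 𝓘(ℝ, FE)) (TotalSpace FE VE)) : Prop :=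
  ∃ γ₁ γ₂ γ₃ : ℝ → TotalSpace FE VE,
    ContMDiff 𝓘(ℝ, ℝ) (IM.prod 𝓘(ℝ, FE)) ∞ γ₁ ∧ ContMDiff 𝓘(ℝ, ℝ) (IM.prod 𝓘(ℝ, FE)) ∞ γ₂ ∧
    (∀ s, IsSum (γ₁ s) (γ₂ s) (γ₃ s)) ∧
    tangentMap 𝓘(ℝ, ℝ) (IM.prod 𝓘(ℝ, FE)) γ₁ ⟨0, (1 : ℝ)⟩ = v₁ ∧
    tangentMap 𝓘(ℝ, ℝ) (IM.prod 𝓘(ℝ, FE)) γ₂ ⟨0, (1 : ℝ)⟩ = v₂ ∧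
    tangentMap 𝓘(ℝ, ℝ) (IM.prod 𝓘(ℝ, FE)) γ₃ ⟨0, (1 : ℝ)⟩ = v₃

/-- A VB-algebroid structure on a double vector bundle `(W → E; A → M)`: a Lie algebroid
structure on `W → E` whose anchor is a vector bundle map from `W → A` to `TE → TM` covering a
vector bundle map `A → TM`, and whose bracket respects linear and core sections. -/
structure VBAlgebroid (D : DoubleVectorBundle IM FE VE FA VA FW VW FU VU) extends
    LieAlgebroid (IM.prod 𝓘(ℝ, FE)) FW VW where
  /-- the bundle map `A → TM` covered by the anchor -/
  anchorA : ∀ m : M, VA m →ₗ[ℝ] TangentSpace IM m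
  contMDiff_anchorA : ContMDiff (IM.prod 𝓘(ℝ, FA)) IM.tangent ∞
    (fun a : TotalSpace FA VA => (⟨a.proj, anchorA a.proj a.snd⟩ : TangentBundle IM M))
  anchor_cover : ∀ w : TotalSpace FW VW,
    tangentMap (IM.prod 𝓘(ℝ, FE)) IM (TotalSpace.proj : TotalSpace FE VE → M)
      (toLieAlgebroid.anchorMap w) = ⟨(D.Φ w).proj.proj, anchorA _ (D.Φ w).proj.snd⟩
  anchor_add : ∀ w₁ w₂ w₃ : TotalSpace FW VW, IsSum (D.Φ w₁) (D.Φ w₂) (D.Φ w₃) →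
    IsTangentSum IM (toLieAlgebroid.anchorMap w₁) (toLieAlgebroid.anchorMap w₂)
      (toLieAlgebroid.anchorMap w₃)
  anchor_smul : ∀ (t : ℝ) (w : TotalSpace FW VW), toLieAlgebroid.anchorMap (D.h t w) =
    tangentMap (IM.prod 𝓘(ℝ, FE)) (IM.prod 𝓘(ℝ, FE)) (scale t) (toLieAlgebroid.anchorMap w)
  bracket_lin_lin : ∀ a b, D.IsLinearSec a → D.IsLinearSec b → D.IsLinearSec (bracket a b)
  bracket_lin_core : ∀ a b, D.IsLinearSec a → D.IsCoreSec b → D.IsCoreSec (bracket a b)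
  bracket_core_core : ∀ a b, D.IsCoreSec a → D.IsCoreSec b → bracket a b = 0

/-- Pointwise convergence, as `t → 0`, of a curve of maps `Γ(V)^k → Γ(V)` defined for `t ≠ 0`. -/
def TendstoZero {EB : Type*} [NormedAddCommGroup EB] [NormedSpace ℝ EB]
    {HB : Type*} [TopologicalSpace HB] {IB : ModelWithCorners ℝ EB HB}
    {B : Type*} [TopologicalSpace B] [ChartedSpace HB B]
    {F : Type*} [NormedAddCommGroup F] [NormedSpace ℝ F]
    {V : B → Type*} [TopologicalSpace (TotalSpace F V)]
    [∀ x, AddCommGroup (V x)] [∀ x, Module ℝ (V x)] [∀ x, TopologicalSpace (V x)]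
    [FiberBundle F V] [VectorBundle ℝ F V] {k : ℕ}
    (c : ℝˣ → Cochain IB F V k) (c₀ : Cochain IB F V k) : Prop :=
  ∀ (w : Fin k → Sec IB F V) (x : B),
    Tendsto (fun t => c t w x) (comap ((↑) : ℝˣ → ℝ) (𝓝 0)) (𝓝 (c₀ w x))

end Double

end VBDef

end

/-! Everything is read off from the behaviour of h_t^* c as t tends to 0. Over the preimage in E of
a small open subset of M, the bundle W → E has a frame of linear sections, which h_t^* fixes, and
core sections, which h_t^* multiplies by t⁻¹ (`exists_hom_frame`). Coefficients f become f(te),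
which has a Taylor expansion in t, so the pull-back of a section has the form t⁻¹ A + B + o(1)
(`exists_hasExp_pullSec`). The same argument in coordinates that are constant or linear along the
fibres treats vector fields (`exists_hasExp_pullVF`). The arguments of a multiderivation are pulled
back by the inverse of h_t, so homogeneous arguments contribute only non-negative powers of t;
general arguments are reached through the Leibniz rule, once the symbol has been expanded
(`exists_hasExp_pullSym`, `exists_hasExp_pullAlt`). Since h_s^* h_t^* = h_{st}^*, the coefficient of
t⁻¹ has weight -1 and the constant one has weight 0 (`pull_coeff`): these are c_core and c_lin. A
linear c has constant expansion along positive t, so lin c = c.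

For the cochain property, h_t^* preserves the bracket (`bracket_pullSec`) and therefore commutes
with δ. The limit has to be taken inside brackets [α, c_t(...)], which differentiate, so pointwise
convergence is too weak. Expansions (`HasExp`) are therefore tested by all functionals that are
differential operators of order one with scalar symbol (`IsFirstOrder`). This class contains point
evaluations and brackets and is stable under multiplication by functions, so δ can be expanded term
by term (`LieAlgebroid.exp0_diffFun`), and uniqueness of expansions gives lin δ = δ lin. The direct
sum and the injectivity in cohomology are then formal.

That δ acts on multiderivations and squares to zero holds for every Lie algebroid. Both facts use
Cartan's formula i_a δ = L_a - δ i_a (`ceFun_cons`) and induction on the number of entries. In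
positive rank symbols are unique, hence automatically multilinear and alternating (`exists_algSym`);
only linearity over functions in one entry of the symbol of δc needs a computation
(`exists_algSym_ceFun`). -/

noncomputable section

namespace VBDef

/-! ### The Chevalley–Eilenberg differential with adjoint coefficients -/

section ChevalleyEilenberg

variable {G N : Type*} [AddCommGroup G] [Module ℝ G] [AddCommGroup N] [Module ℝ N]

/-- A map which is linear in the first and alternating in the other entries, and which vanishes
when the first two entries agree, is alternating. -/
theorem exists_alternatingMap_of_curry {n : ℕ} (f : G →ₗ[ℝ] G [⋀^Fin n]→ₗ[ℝ] N)
    (hf : ∀ (v : Fin (n + 1) → G) (j : Fin n), v 0 = v j.succ → f (v 0) (Fin.tail v) = 0) :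
    ∃ d : G [⋀^Fin (n + 1)]→ₗ[ℝ] N, ∀ v, d v = f (v 0) (Fin.tail v) := by
  let m : MultilinearMap ℝ (fun _ : Fin (n + 1) => G) N :=
    LinearMap.uncurryLeft (AlternatingMap.toMultilinearMapLM (S := ℝ) ∘ₗ f)
  have hm : ∀ v, m v = f (v 0) (Fin.tail v) := fun v => rfl
  refine ⟨{ m with map_eq_zero_of_eq' := ?_ }, fun v => rfl⟩
  -- For i < j, either i = 0, which is the hypothesis, or both indices lie in the tail, where `f (v
  -- 0)` is alternating.
  have key : ∀ (v : Fin (n + 1) → G) (i j : Fin (n + 1)), v i = v j → i < j → m v = 0 := by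
    intro v i j hv hij
    obtain ⟨j, rfl⟩ := Fin.exists_succ_eq.2 (Fin.ne_zero_of_lt hij)
    rcases Fin.eq_zero_or_eq_succ i with rfl | ⟨i, rfl⟩
    · exact hf v j hv
    · rw [hm]
      exact (f (v 0)).map_eq_zero_of_eq _ (i := i) (j := j) hv
        (fun h => absurd hij (by simp [h]))
  intro v i j hv hij
  rcases lt_or_gt_of_ne hij with h | h
  · exact key v i j hv h
  · exact key v j i hv.symm h

/-- If a map is alternating in the last `n + 1` entries, it is alternating as soon as it vanishes
for equal first two entries. -/
theorem eq_zero_of_cons_cons {n : ℕ} (f : G [⋀^Fin (n + 1)]→ₗ[ℝ] N) (a : G)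
    (h : ∀ w : Fin n → G, f (Fin.cons a w) = 0) (w : Fin (n + 1) → G) (j : Fin (n + 1))
    (hj : w j = a) : f w = 0 := by
  have e : w = j.insertNth a (j.removeNth w) := by
    rw [← hj, Fin.insertNth_self_removeNth]
  rw [e, AlternatingMap.map_insertNth]
  exact (congrArg _ (h _)).trans (smul_zero _)

/-- The sum of the alternating maps obtained by applying the linear map `T` in one entry. -/
def substSum {k : ℕ} (c : G [⋀^Fin k]→ₗ[ℝ] N) (T : G →ₗ[ℝ] G) : G [⋀^Fin k]→ₗ[ℝ] N where
  toMultilinearMap := ∑ i, c.toMultilinearMap.compLinearMap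
    (fun j => if j = i then T else LinearMap.id)
  map_eq_zero_of_eq' := by
    intro v i j hv hij
    have e : ∀ r, (fun l => (if l = r then T else LinearMap.id : G →ₗ[ℝ] G) (v l)) =
        update v r (T (v r)) := by
      intro r
      funext l
      by_cases h : l = r
      · subst h; simp
      · simp [h]
    simp only [sum_apply, MultilinearMap.compLinearMap_apply, e,
      AlternatingMap.coe_multilinearMap, MultilinearMap.toFun_eq_coe]
    -- Only the terms with T in one of the two equal entries survive; they differ by a transposition
    -- and cancel.
    rw [Fintype.sum_eq_add i j hij]
    · have h : update v j (T (v j)) = update v i (T (v i)) ∘ Equiv.swap i j := by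
        funext l
        by_cases hi : l = i
        · subst hi
          simp [hij, hij.symm, hv]
        · by_cases hj : l = j
          · subst hj; simp [hv]
          · simp [hi, hj, Equiv.swap_apply_of_ne_of_ne]
      rw [h, c.map_swap _ hij, add_neg_cancel]
    · rintro r ⟨hri, hrj⟩
      exact c.map_eq_zero_of_eq _ (i := i) (j := j)
        (by simp [update_of_ne hri.symm, update_of_ne hrj.symm, hv]) hij

theorem substSum_apply {k : ℕ} (c : G [⋀^Fin k]→ₗ[ℝ] N) (T : G →ₗ[ℝ] G) (w : Fin k → G) :
    substSum c T w = ∑ i, c (update w i (T (w i))) := by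
  have e : ∀ r, (fun l => (if l = r then T else LinearMap.id : G →ₗ[ℝ] G) (w l)) =
      update w r (T (w r)) := by
    intro r
    funext l
    by_cases h : l = r
    · subst h; simp
    · simp [h]
  change (∑ i, c.toMultilinearMap.compLinearMap
    (fun j => if j = i then T else LinearMap.id)) w = _
  simp [MultilinearMap.compLinearMap_apply, e]

theorem coe_alt_add {k : ℕ} (c c' : G [⋀^Fin k]→ₗ[ℝ] N) : ⇑(c + c') = ⇑c + ⇑c' := rfl

theorem coe_alt_sub {k : ℕ} (c c' : G [⋀^Fin k]→ₗ[ℝ] N) : ⇑(c - c') = ⇑c - ⇑c' := rfl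

theorem coe_alt_smul {k : ℕ} (r : ℝ) (c : G [⋀^Fin k]→ₗ[ℝ] N) : ⇑(r • c) = r • ⇑c := rfl

/-! ### Adjoint differential, Lie derivative and Cartan's formula -/

variable (br : G →ₗ[ℝ] G →ₗ[ℝ] G)

/-- The Chevalley–Eilenberg differential with adjoint coefficients of a bilinear bracket. -/
def ceFun : ∀ {k : ℕ}, ((Fin k → G) → G) → (Fin (k + 1) → G) → G
  | 0, c => fun α => br (α 0) (c (Fin.removeNth 0 α))
  | k + 1, c => fun α =>
      ∑ i : Fin (k + 2), (-1 : ℝ) ^ (i : ℕ) • br (α i) (c (i.removeNth α)) +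
      ∑ j : Fin (k + 1), ∑ i ∈ Finset.Iic j, (-1 : ℝ) ^ ((i : ℕ) + ((j : ℕ) + 1)) •
        c (Fin.cons (br (α i.castSucc) (α j.succ)) (i.removeNth (j.succ.removeNth α)))

/-- The Lie derivative of an alternating map. -/
def lieD {k : ℕ} (a : G) (c : G [⋀^Fin k]→ₗ[ℝ] G) : G [⋀^Fin k]→ₗ[ℝ] G :=
  (br a).compAlternatingMap c - substSum c (br a)

theorem lieD_apply {k : ℕ} (a : G) (c : G [⋀^Fin k]→ₗ[ℝ] G) (w : Fin k → G) :
    lieD br a c w = br a (c w) - ∑ i, c (update w i (br a (w i))) := by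
  simp [lieD, substSum_apply]

theorem removeNth_succ_cons {X : Type*} {k : ℕ} (a : X) (w : Fin (k + 1) → X) (i : Fin (k + 1)) :
    i.succ.removeNth (Fin.cons a w : Fin (k + 2) → X) = Fin.cons a (i.removeNth w) := by
  funext l
  refine Fin.cases ?_ (fun l => ?_) l
  · simp [Fin.removeNth]
  · simp [Fin.removeNth]

/-- Moving entry j to the front passes j other entries. This converts between the `update` form of
the Lie derivative and the `Fin.cons` form of the bracket terms in `ceFun`. -/
theorem map_update_eq {k : ℕ} (c : G [⋀^Fin (k + 1)]→ₗ[ℝ] N) (w : Fin (k + 1) → G)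
    (j : Fin (k + 1)) (x : G) :
    c (update w j x) = (-1 : ℝ) ^ (j : ℕ) • c (Fin.cons x (j.removeNth w)) := by
  have e : update w j x = j.insertNth x (j.removeNth w) := by
    rw [Fin.insertNth_removeNth]
  rw [e, AlternatingMap.map_insertNth]
  change (-1 : ℤ) ^ (j : ℕ) • c (Fin.cons x (j.removeNth w)) = _
  rcases Nat.even_or_odd (j : ℕ) with h | h <;> simp [h.neg_one_pow]

/-- Splits the double sum of `ceFun`: the pairs with first index 0 belong to the Lie derivative, the
others to the differential of the contraction. -/
theorem sum_Iic_succ {k : ℕ} {X : Type*} [AddCommMonoid X] (j : Fin k) (f : Fin (k + 1) → X) :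
    ∑ i ∈ Finset.Iic j.succ, f i = f 0 + ∑ i ∈ Finset.Iic j, f i.succ := by
  have h1 : ∀ (n : ℕ) (j : Fin n) (f : Fin n → X),
      ∑ i ∈ Finset.Iic j, f i = ∑ i, if i ≤ j then f i else 0 := by
    intro n j f
    rw [← Finset.sum_filter]
    congr 1
    ext
    simp
  rw [h1, h1, Fin.sum_univ_succ]
  simp

theorem map_cons_cons_swap {k : ℕ} (c : G [⋀^Fin (k + 2)]→ₗ[ℝ] N) (a b : G) (w : Fin k → G) :
    c (Fin.cons a (Fin.cons b w)) = -c (Fin.cons b (Fin.cons a w)) := by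
  rw [← c.map_swap (Fin.cons b (Fin.cons a w)) (i := 0) (j := 1) (by simp)]
  congr 1
  funext l
  refine Fin.cases (by simp) (fun l => Fin.cases (by simp) (fun l => ?_) l) l
  rw [comp_apply, Equiv.swap_apply_of_ne_of_ne]
  · rfl
  · exact Fin.succ_ne_zero _
  · intro h
    exact Fin.succ_ne_zero l (Fin.succ_injective _ (h : l.succ.succ = Fin.succ 0))

/-- Cartan's formula for the differential. -/
theorem ceFun_cons {k : ℕ} (c : G [⋀^Fin (k + 1)]→ₗ[ℝ] G) (a : G) (w : Fin (k + 1) → G) :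
    ceFun br c (Fin.cons a w) = lieD br a c w - ceFun br (c.curryLeft a) w := by
  have hcurry : ∀ (n : ℕ) (c : G [⋀^Fin (n + 1)]→ₗ[ℝ] G) (v : Fin n → G),
      c.curryLeft a v = c (Fin.cons a v) := fun n c v => rfl
  -- The pair (0, j + 1) brackets a with `w j`. Its sign (-1)^(j+1) and the sign for moving the
  -- bracket back to place j combine to -1.
  have h0 : ∀ j : Fin (k + 1), (-1 : ℝ) ^ (((0 : Fin (k + 1)) : ℕ) + ((j : ℕ) + 1)) •
      c (Fin.cons (br ((Fin.cons a w : Fin (k + 2) → G) (Fin.castSucc 0))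
        ((Fin.cons a w : Fin (k + 2) → G) j.succ))
        (Fin.removeNth 0 (j.succ.removeNth (Fin.cons a w : Fin (k + 2) → G)))) =
      -c (update w j (br a (w j))) := by
    intro j
    rw [map_update_eq, removeNth_succ_cons]
    have : Fin.removeNth 0 (Fin.cons a (j.removeNth w) : Fin (k + 1) → G) = j.removeNth w := by
      funext l; simp [Fin.removeNth]
    rw [this]
    simp [pow_succ]
  -- `ceFun` has a separate clause, without double sum, for maps with no entries; `c.curryLeft a`
  -- falls under it when `k = 0`.
  cases k with
  | zero =>
    rw [lieD_apply]
    have e : Finset.Iic (0 : Fin (0 + 1)) = {0} := by decide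
    have s1 : ∀ f : Fin (0 + 1) → G, ∑ j, f j = f 0 := fun f => by simp
    simp only [ceFun]
    rw [Fin.sum_univ_succ]
    simp only [s1]
    rw [e, Finset.sum_singleton, h0, hcurry, removeNth_succ_cons]
    have e2 : Fin.removeNth 0 (Fin.cons a w : Fin 2 → G) = w := by
      funext l; simp [Fin.removeNth]
    rw [e2]
    simp
    abel
  | succ k =>
    rw [lieD_apply]
    simp only [ceFun]
    rw [Fin.sum_univ_succ (n := k + 2), Fin.sum_univ_succ (n := k + 1)
      (f := fun j => ∑ i ∈ Finset.Iic j, _)]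
    have e : Finset.Iic (0 : Fin (k + 2)) = {0} := by ext; simp
    rw [e, Finset.sum_singleton, h0]
    simp only [sum_Iic_succ]
    simp only [h0, Finset.sum_add_distrib]
    have e2 : Fin.removeNth 0 (Fin.cons a w : Fin (k + 3) → G) = w := by
      funext l; simp [Fin.removeNth]
    rw [e2, Fin.sum_univ_succ (f := fun i => c (update w i (br a (w i))))]
    simp only [removeNth_succ_cons, Fin.cons_zero, Fin.cons_succ, hcurry, Fin.val_zero, pow_zero,
      one_smul, Fin.castSucc_succ, Fin.val_succ]
    -- In the remaining pairs a stands behind the bracket; exchanging the two gives the minus sign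
    -- in front of the differential of the contraction.
    have e3 : ∀ (x : G) (v : Fin k → G), c (Fin.cons x (Fin.cons a v)) =
        -c (Fin.cons a (Fin.cons x v)) := fun x v => map_cons_cons_swap c x a v
    simp only [e3, pow_succ, pow_add, mul_neg, mul_one, neg_mul, neg_neg, neg_smul, smul_neg,
      Finset.sum_neg_distrib]
    abel

theorem ceFun_cons_zero (c : G [⋀^Fin 0]→ₗ[ℝ] G) (a : G) (w : Fin 0 → G) :
    ceFun br c (Fin.cons a w) = lieD br a c w := by
  rw [lieD_apply]
  simp only [ceFun, Fin.cons_zero, Finset.univ_eq_empty, Finset.sum_empty, sub_zero]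
  congr 2

theorem ceFun_add {k : ℕ} (c c' : (Fin k → G) → G) :
    ceFun br (c + c') = ceFun br c + ceFun br c' := by
  cases k with
  | zero => funext α; simp [ceFun]
  | succ k =>
    funext α
    simp only [ceFun, Pi.add_apply, map_add, smul_add, Finset.sum_add_distrib]
    abel

theorem ceFun_smul {k : ℕ} (r : ℝ) (c : (Fin k → G) → G) :
    ceFun br (r • c) = r • ceFun br c := by
  cases k with
  | zero => funext α; simp [ceFun]
  | succ k =>
    funext α
    simp only [ceFun, Pi.smul_apply, map_smul, smul_add, Finset.smul_sum, smul_comm r]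

theorem ceFun_neg {k : ℕ} (c : (Fin k → G) → G) : ceFun br (-c) = -ceFun br c := by
  have := ceFun_smul br (-1) c
  simpa using this

theorem ceFun_sub {k : ℕ} (c c' : (Fin k → G) → G) :
    ceFun br (c - c') = ceFun br c - ceFun br c' := by
  rw [sub_eq_add_neg, ceFun_add, ceFun_neg, sub_eq_add_neg]

/-! ### Commutation rules, and the square of the differential -/

variable {br}

theorem br_skew (hself : ∀ a, br a a = 0) (a b : G) : br a b = -br b a := by
  have := hself (a + b)
  simp only [map_add, LinearMap.add_apply, hself, zero_add, add_zero] at this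
  exact eq_neg_of_add_eq_zero_right this

/-- In the sum that defines `lieD`, the term bracketing the first entry is the contraction with [a,
b], and the rest is the Lie derivative of the contraction. This rule drives the inductions on the
number of entries below. -/
theorem curryLeft_lieD {k : ℕ} (a b : G) (c : G [⋀^Fin (k + 1)]→ₗ[ℝ] G) :
    (lieD br a c).curryLeft b =
      lieD br a (c.curryLeft b) - c.curryLeft (br a b) := by
  ext w
  have hcurry : ∀ (x : G) (c : G [⋀^Fin (k + 1)]→ₗ[ℝ] G) (v : Fin k → G),
      c.curryLeft x v = c (Fin.cons x v) := fun x c v => rfl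
  rw [AlternatingMap.sub_apply, hcurry, lieD_apply, lieD_apply, Fin.sum_univ_succ, hcurry, hcurry]
  simp only [Fin.cons_zero, Fin.update_cons_zero, Fin.cons_succ, ← Fin.cons_update, hcurry]
  abel

theorem lieD_add_left {k : ℕ} (a b : G) (c : G [⋀^Fin k]→ₗ[ℝ] G) :
    lieD br (a + b) c = lieD br a c + lieD br b c := by
  ext w
  simp only [AlternatingMap.add_apply, lieD_apply, map_add, LinearMap.add_apply,
    AlternatingMap.map_update_add, Finset.sum_add_distrib]
  abel

theorem lieD_smul_left {k : ℕ} (r : ℝ) (a : G) (c : G [⋀^Fin k]→ₗ[ℝ] G) :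
    lieD br (r • a) c = r • lieD br a c := by
  ext w
  simp only [AlternatingMap.smul_apply, lieD_apply, map_smul, LinearMap.smul_apply,
    AlternatingMap.map_update_smul, smul_sub, Finset.smul_sum]

theorem lieD_sub {k : ℕ} (a : G) (c c' : G [⋀^Fin k]→ₗ[ℝ] G) :
    lieD br a (c - c') = lieD br a c - lieD br a c' := by
  ext w
  simp only [AlternatingMap.sub_apply, lieD_apply, map_sub, Finset.sum_sub_distrib]
  abel

/-- The differential of an alternating map is alternating. -/
theorem exists_ceFun_alternating (hself : ∀ a, br a a = 0) : ∀ {k : ℕ} (c : G [⋀^Fin k]→ₗ[ℝ] G),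
    ∃ d : G [⋀^Fin (k + 1)]→ₗ[ℝ] G, ⇑d = ceFun br c
  | 0, c => by
    let f : G →ₗ[ℝ] G [⋀^Fin 0]→ₗ[ℝ] G :=
      { toFun := fun a => lieD br a c
        map_add' := fun a b => lieD_add_left a b c
        map_smul' := fun r a => lieD_smul_left r a c }
    obtain ⟨d, hd⟩ := exists_alternatingMap_of_curry f (fun v j => j.elim0)
    refine ⟨d, funext fun v => ?_⟩
    rw [hd]
    conv_rhs => rw [← Fin.cons_self_tail v]
    exact (ceFun_cons_zero br c _ _).symm
  | k + 1, c => by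
    choose D hD using fun a => exists_ceFun_alternating hself (c.curryLeft a)
    -- By Cartan's formula this is the differential contracted with a; by induction it is
    -- alternating in the remaining entries.
    let f : G →ₗ[ℝ] G [⋀^Fin (k + 1)]→ₗ[ℝ] G :=
      { toFun := fun a => lieD br a c - D a
        map_add' := fun a b => by
          have : D (a + b) = D a + D b := by
            apply DFunLike.coe_injective
            rw [coe_alt_add, hD, hD, hD, ← ceFun_add, map_add, coe_alt_add]
          rw [this, lieD_add_left]
          abel
        map_smul' := fun r a => by
          have : D (r • a) = r • D a := by
            apply DFunLike.coe_injective
            rw [coe_alt_smul, hD, hD, ← ceFun_smul, map_smul, coe_alt_smul]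
          rw [this, lieD_smul_left, RingHom.id_apply, smul_sub] }
    have hfa : ∀ a w, f a w = ceFun br c (Fin.cons a w) := fun a w => by
      rw [ceFun_cons, ← hD a]; rfl
    -- With a in the first two places Cartan's formula leaves i_a L_a c - L_a i_a c + δ(i_a i_a c).
    -- This vanishes because [a, a] = 0 and c is alternating.
    obtain ⟨d, hd⟩ := exists_alternatingMap_of_curry f (fun v j hv => by
      refine eq_zero_of_cons_cons (f (v 0)) (v 0) (fun w => ?_) _ j hv.symm
      change (lieD br (v 0) c).curryLeft (v 0) w - D (v 0) (Fin.cons (v 0) w) = 0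
      rw [curryLeft_lieD, hself, map_zero, sub_zero, hD]
      cases k with
      | zero => rw [ceFun_cons_zero, sub_self]
      | succ k =>
        rw [ceFun_cons]
        have h2 : (c.curryLeft (v 0)).curryLeft (v 0) = 0 := by
          ext u
          exact c.map_eq_zero_of_eq _ (i := 0) (j := 1) rfl (by simp)
        have h3 := ceFun_smul br 0 (⇑((c.curryLeft (v 0)).curryLeft (v 0)))
        rw [h2] at h3 ⊢
        rw [zero_smul, zero_smul] at h3
        change _ - (_ - ceFun br 0 w) = 0
        rw [h3]
        simp)
    refine ⟨d, funext fun v => ?_⟩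
    rw [hd, hfa, Fin.cons_self_tail]

theorem br_br (hself : ∀ a, br a a = 0)
    (hjac : ∀ a b c, br a (br b c) + br b (br c a) + br c (br a b) = 0)
    (a b x : G) : br a (br b x) - br b (br a x) = br (br a b) x := by
  have h := hjac a b x
  rw [br_skew hself x (br a b), br_skew hself x a, map_neg] at h
  rw [← sub_eq_zero, ← h]
  abel

/-- Contraction with the first entry lowers the number of entries; the correction terms from
`curryLeft_lieD` are contractions with iterated brackets and match by Jacobi. Without entries the
claim is Jacobi itself. -/
theorem lieD_lieD (hself : ∀ a, br a a = 0)
    (hjac : ∀ a b c, br a (br b c) + br b (br c a) + br c (br a b) = 0)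
    {k : ℕ} (a b : G) (c : G [⋀^Fin k]→ₗ[ℝ] G) :
    lieD br a (lieD br b c) - lieD br b (lieD br a c) = lieD br (br a b) c := by
  induction k with
  | zero =>
    ext w
    simp only [AlternatingMap.sub_apply, lieD_apply, Finset.univ_eq_empty, Finset.sum_empty,
      sub_zero]
    exact br_br hself hjac a b _
  | succ k ih =>
    ext w
    rw [← Fin.cons_self_tail w]
    generalize w 0 = x
    generalize Fin.tail w = v
    have h : ∀ e : G [⋀^Fin (k + 1)]→ₗ[ℝ] G, e (Fin.cons x v) = e.curryLeft x v := fun e => rfl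
    rw [h, h]
    congr 1
    have hs : ∀ e e' : G [⋀^Fin (k + 1)]→ₗ[ℝ] G,
        (e - e').curryLeft x = e.curryLeft x - e'.curryLeft x := fun e e' => rfl
    simp only [hs, curryLeft_lieD, lieD_sub]
    rw [← ih, ← br_br hself hjac, map_sub]
    abel

/-- The differential commutes with the Lie derivative. -/
theorem ceFun_lieD (hself : ∀ a, br a a = 0)
    (hjac : ∀ a b c, br a (br b c) + br b (br c a) + br c (br a b) = 0) :
    ∀ {k : ℕ} (a : G) (c : G [⋀^Fin k]→ₗ[ℝ] G) (d : G [⋀^Fin (k + 1)]→ₗ[ℝ] G),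
    ⇑d = ceFun br c → ceFun br (lieD br a c) = lieD br a d
  | 0, a, c, d, hd => by
    funext w
    rw [← Fin.cons_self_tail w]
    generalize w 0 = x
    generalize Fin.tail w = v
    have hx : d.curryLeft x = lieD br x c := by
      ext u
      change d (Fin.cons x u) = _
      rw [hd, ceFun_cons_zero]
    have hx' : d.curryLeft (br a x) = lieD br (br a x) c := by
      ext u
      change d (Fin.cons _ u) = _
      rw [hd, ceFun_cons_zero]
    change _ = (lieD br a d).curryLeft x v
    rw [ceFun_cons_zero, curryLeft_lieD, hx, hx', ← lieD_lieD hself hjac]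
    simp
  | k + 1, a, c, d, hd => by
    funext w
    rw [← Fin.cons_self_tail w]
    generalize w 0 = x
    generalize Fin.tail w = v
    choose D hD using fun a => exists_ceFun_alternating hself (c.curryLeft a)
    have hx : ∀ x, d.curryLeft x = lieD br x c - D x := by
      intro x
      ext u
      change d (Fin.cons x u) = _
      rw [hd, ceFun_cons, ← hD]
      rfl
    change _ = (lieD br a d).curryLeft x v
    -- After contraction with x, the case of `c.curryLeft x` and the commutator of two Lie
    -- derivatives account for all terms.
    rw [ceFun_cons, curryLeft_lieD (c := d), hx, hx, curryLeft_lieD, coe_alt_sub, ceFun_sub,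
      ceFun_lieD hself hjac a _ (D x) (hD x), ← hD, ← lieD_lieD hself hjac, lieD_sub]
    simp only [AlternatingMap.sub_apply, Pi.sub_apply]
    abel

/-- The differential squares to zero on alternating maps. -/
theorem ceFun_ceFun (hself : ∀ a, br a a = 0)
    (hjac : ∀ a b c, br a (br b c) + br b (br c a) + br c (br a b) = 0) :
    ∀ {k : ℕ} (c : G [⋀^Fin k]→ₗ[ℝ] G), ceFun br (ceFun br c) = 0
  | 0, c => by
    obtain ⟨d, hd⟩ := exists_ceFun_alternating hself c
    funext w
    rw [← Fin.cons_self_tail w, ← hd, ceFun_cons]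
    have hx : d.curryLeft (w 0) = lieD br (w 0) c := by
      ext u
      change d (Fin.cons _ u) = _
      rw [hd, ceFun_cons_zero]
    rw [hx, ceFun_lieD hself hjac _ c d hd, sub_self]
    rfl
  | k + 1, c => by
    obtain ⟨d, hd⟩ := exists_ceFun_alternating hself c
    funext w
    obtain ⟨d', hd'⟩ := exists_ceFun_alternating hself (c.curryLeft (w 0))
    rw [← Fin.cons_self_tail w, ← hd, ceFun_cons]
    have hx : d.curryLeft (w 0) = lieD br (w 0) c - d' := by
      ext u
      change d (Fin.cons _ u) = _
      rw [hd, ceFun_cons, ← hd']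
      rfl
    -- i_a δδc = L_a δc - δ(L_a c) + δδ(i_a c) for a = `w 0`: the first two terms cancel and the
    -- last vanishes by induction.
    rw [hx, coe_alt_sub, ceFun_sub, ceFun_lieD hself hjac _ c d hd, hd',
      ceFun_ceFun hself hjac (c.curryLeft (w 0))]
    simp

end ChevalleyEilenberg

/-! ### Sections, functions and frames -/

section Tools

variable {EB : Type*} [NormedAddCommGroup EB] [NormedSpace ℝ EB]
  {HB : Type*} [TopologicalSpace HB] {IB : ModelWithCorners ℝ EB HB}
  {B : Type*} [TopologicalSpace B] [ChartedSpace HB B] [IsManifold IB ∞ B]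
  {F : Type*} [NormedAddCommGroup F] [NormedSpace ℝ F]
  {V : B → Type*} [TopologicalSpace (TotalSpace F V)]
  [∀ x, AddCommGroup (V x)] [∀ x, Module ℝ (V x)] [∀ x, TopologicalSpace (V x)]
  [FiberBundle F V] [VectorBundle ℝ F V]

@[simp] theorem fsmul_apply (f : C^∞⟮IB, B; ℝ⟯) (s : Sec IB F V) (x : B) :
    fsmul f s x = f x • s x := rfl

theorem fsmul_add (f : C^∞⟮IB, B; ℝ⟯) (s s' : Sec IB F V) :
    fsmul f (s + s') = fsmul f s + fsmul f s' := by
  ext x; simp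

theorem fsmul_smul (f : C^∞⟮IB, B; ℝ⟯) (r : ℝ) (s : Sec IB F V) :
    fsmul f (r • s) = r • fsmul f s := by
  ext x; exact smul_comm (f x) r (s x)

theorem fsmul_fsmul (f g : C^∞⟮IB, B; ℝ⟯) (s : Sec IB F V) :
    fsmul f (fsmul g s) = fsmul (f * g) s := by
  ext x; simp [smul_smul]

theorem sec_sum_apply {ι : Type*} (t : Finset ι) (s : ι → Sec IB F V) (x : B) :
    (∑ i ∈ t, s i) x = ∑ i ∈ t, s i x := by
  have := map_sum (ContMDiffSection.coeAddHom IB F ∞ V) s t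
  exact (congrFun this x).trans (by rw [Finset.sum_apply]; rfl)

/-- Evaluation of sections at a point. -/
def evalAt (x : B) : Sec IB F V →ₗ[ℝ] V x where
  toFun s := s x
  map_add' _ _ := rfl
  map_smul' _ _ := rfl

@[simp] theorem evalAt_apply (x : B) (s : Sec IB F V) : evalAt x s = s x := rfl

/-! Linear functionals on the fibres detect equality and convergence. -/

theorem eq_of_forall_dual [FiniteDimensional ℝ F] {x : B} {v v' : V x}
    (h : ∀ l : V x →ₗ[ℝ] ℝ, l v = l v') : v = v' := by
  have : FiniteDimensional ℝ (V x) := VectorBundle.finiteDimensional ℝ F V x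
  rw [← sub_eq_zero, ← Module.forall_dual_apply_eq_zero_iff ℝ]
  intro l
  rw [map_sub, h l, sub_self]

theorem continuous_dual [FiniteDimensional ℝ F] {x : B} (l : V x →ₗ[ℝ] ℝ) : Continuous l := by
  have h : Continuous (l ∘ₗ (VectorBundle.continuousLinearEquivAt ℝ F V x).symm.toLinearMap) :=
    LinearMap.continuous_of_finiteDimensional _
  have := h.comp (VectorBundle.continuousLinearEquivAt ℝ F V x).continuous
  refine this.congr fun v => ?_
  exact congrArg l ((VectorBundle.continuousLinearEquivAt ℝ F V x).symm_apply_apply v)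

theorem tendsto_fibre_iff [FiniteDimensional ℝ F] {x : B} {α : Type*} {φ : Filter α}
    {a : α → V x} {v : V x} :
    Tendsto a φ (𝓝 v) ↔ ∀ l : V x →ₗ[ℝ] ℝ, Tendsto (fun t => l (a t)) φ (𝓝 (l v)) := by
  constructor
  · intro h l
    exact ((continuous_dual (F := F) l).tendsto v).comp h
  · intro h
    -- The fibre is homeomorphic to F by a linear map, so finitely many coordinates detect
    -- convergence.
    let κ := VectorBundle.continuousLinearEquivAt ℝ F V x
    let b := Module.finBasis ℝ F
    have h1 : Tendsto (fun t => b.equivFunL (κ (a t))) φ (𝓝 (b.equivFunL (κ v))) := by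
      rw [tendsto_pi_nhds]
      intro i
      exact h ((LinearMap.proj i ∘ₗ b.equivFunL.toLinearEquiv.toLinearMap) ∘ₗ
        κ.toLinearEquiv.toLinearMap)
    have h2 := ((κ.trans b.equivFunL).symm.continuous.tendsto _).comp h1
    refine (h2.congr fun t => ?_).trans_eq ?_
    · exact (κ.trans b.equivFunL).symm_apply_apply (a t)
    · exact congrArg 𝓝 ((κ.trans b.equivFunL).symm_apply_apply v)

/-! Cut-off functions. -/

theorem exists_bump [FiniteDimensional ℝ EB] [T2Space B] (x : B) {u : Set B} (hu : u ∈ 𝓝 x) :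
    ∃ ψ : C^∞⟮IB, B; ℝ⟯, (∀ᶠ y in 𝓝 x, ψ y = 1) ∧ tsupport ψ ⊆ u := by
  obtain ⟨f, -, hf⟩ := (SmoothBumpFunction.nhds_basis_tsupport (I := IB) x).mem_iff.1 hu
  exact ⟨⟨f, f.contMDiff⟩, f.eventuallyEq_one, hf⟩

/-- The extension by zero of the product of a function supported in an open set and a section over
this set. -/
def cutSec (ψ : C^∞⟮IB, B; ℝ⟯) {u : Set B} (hu : IsOpen u) (hψ : tsupport ψ ⊆ u)
    (s : ∀ x, V x) (hs : ContMDiffOn IB (IB.prod 𝓘(ℝ, F)) ∞ (fun x => TotalSpace.mk' F x (s x)) u) :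
    Sec IB F V :=
  ⟨fun x => ψ x • s x, ContMDiffOn.smul_section_of_tsupport ψ.contMDiff.contMDiffOn hu hψ hs⟩

theorem contMDiff_mul_of_tsupport (ψ : C^∞⟮IB, B; ℝ⟯) {u : Set B} (hψ : tsupport ψ ⊆ u)
    {f : B → ℝ} (hf : ∀ x ∈ u, ContMDiffAt IB 𝓘(ℝ, ℝ) ∞ f x) :
    ContMDiff IB 𝓘(ℝ, ℝ) ∞ (fun x => ψ x * f x) :=
  contMDiff_of_tsupport fun x hx => (ψ.contMDiff x).mul
    (hf x (hψ (tsupport_mul_subset_left hx)))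

/-- Every vector in a fibre is the value of a smooth section. -/
theorem exists_sec_eq [FiniteDimensional ℝ EB] [T2Space B] [ContMDiffVectorBundle ∞ F V IB]
    (x : B) (v : V x) : ∃ s : Sec IB F V, s x = v := by
  obtain ⟨u, hu, hs⟩ := FiberBundle.exists_contMDiffOn_extend (k := ∞) IB F v
  obtain ⟨u', hu', ho, hx⟩ := mem_nhds_iff.1 hu
  obtain ⟨ψ, h1, h2⟩ := exists_bump (IB := IB) x (ho.mem_nhds hx)
  refine ⟨cutSec ψ ho h2 (FiberBundle.extend F v) (hs.mono hu'), ?_⟩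
  · change ψ x • FiberBundle.extend F v x = v
    rw [h1.self_of_nhds, one_smul, FiberBundle.extend_apply_self]

theorem evalAt_surjective [FiniteDimensional ℝ EB] [T2Space B] [ContMDiffVectorBundle ∞ F V IB]
    (x : B) : Surjective (evalAt x : Sec IB F V →ₗ[ℝ] V x) :=
  fun v => exists_sec_eq x v

/-! Frames. -/

section Frames

variable {κ : Type*} [Fintype κ]

/-- The linear combinations of the values of a finite family of sections at a point. -/
def comb (s : κ → Sec IB F V) (x : B) : (κ → ℝ) →ₗ[ℝ] V x :=
  Fintype.linearCombination ℝ (fun i => s i x)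

theorem comb_apply (s : κ → Sec IB F V) (x : B) (c : κ → ℝ) :
    comb s x c = ∑ i, c i • s i x := rfl

/-- The family `s` read in a trivialization. -/
def frameMap (e : Trivialization F (TotalSpace.proj : TotalSpace F V → B))
    (s : κ → Sec IB F V) (x : B) : (κ → ℝ) →L[ℝ] F :=
  ∑ i, (ContinuousLinearMap.proj i : (κ → ℝ) →L[ℝ] ℝ).smulRight (e ⟨x, s i x⟩).2

variable (e : Trivialization F (TotalSpace.proj : TotalSpace F V → B)) [MemTrivializationAtlas e]

theorem frameMap_apply (s : κ → Sec IB F V) {x : B} (hx : x ∈ e.baseSet) (c : κ → ℝ) :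
    frameMap e s x c = (e ⟨x, comb s x c⟩).2 := by
  have h : ∀ v : V x, (e ⟨x, v⟩).2 = e.linearEquivAt ℝ x hx v := fun v => rfl
  rw [h, comb_apply, map_sum, frameMap, sum_apply]
  refine Finset.sum_congr rfl fun i _ => ?_
  rw [map_smul, ← h]
  rfl

theorem contMDiffAt_frameMap [ContMDiffVectorBundle ∞ F V IB] (s : κ → Sec IB F V) {x : B}
    (hx : x ∈ e.baseSet) : ContMDiffAt IB 𝓘(ℝ, (κ → ℝ) →L[ℝ] F) ∞ (frameMap e s) x := by
  have h : ∀ i, ContMDiffAt IB 𝓘(ℝ, F) ∞ (fun y => (e ⟨y, s i y⟩).2) x := fun i =>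
    (e.contMDiffAt_section_iff hx).1 ((s i).contMDiff x)
  unfold frameMap
  refine contMDiffAt_finsetSum fun i _ => ?_
  exact (((ContinuousLinearMap.smulRightL ℝ (κ → ℝ) F)
    (ContinuousLinearMap.proj i)).contMDiff.contMDiffAt).comp x (h i)

/-- A basis of sections at a point, read in a trivialization. -/
def frameEquiv (s : κ → Sec IB F V) {x : B} (hx : x ∈ e.baseSet)
    (hs : Bijective (comb s x)) : (κ → ℝ) ≃L[ℝ] F :=
  have : FiniteDimensional ℝ F := Module.Finite.equiv
    ((LinearEquiv.ofBijective (comb s x) hs).trans (e.linearEquivAt ℝ x hx))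
  ((LinearEquiv.ofBijective (comb s x) hs).trans (e.linearEquivAt ℝ x hx)).toContinuousLinearEquiv

theorem coe_frameEquiv (s : κ → Sec IB F V) {x : B} (hx : x ∈ e.baseSet)
    (hs : Bijective (comb s x)) :
    (frameEquiv e s hx hs : (κ → ℝ) →L[ℝ] F) = frameMap e s x := by
  refine ContinuousLinearMap.ext fun c => ?_
  rw [frameMap_apply e s hx]
  rfl

/-- A family of sections that is a basis at a point is a basis at nearby points. -/
theorem eventually_bijective_comb [FiniteDimensional ℝ F] [ContMDiffVectorBundle ∞ F V IB]
    (s : κ → Sec IB F V) {x : B} (hs : Bijective (comb s x)) :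
    ∀ᶠ y in 𝓝 x, Bijective (comb s y) := by
  let e := trivializationAt F V x
  have hx : x ∈ e.baseSet := FiberBundle.mem_baseSet_trivializationAt F V x
  -- Invertible operators form a neighbourhood of each of their members.
  have h1 : ∀ᶠ y in 𝓝 x, frameMap e s y ∈
      Set.range ((↑) : ((κ → ℝ) ≃L[ℝ] F) → (κ → ℝ) →L[ℝ] F) := by
    have := ContinuousLinearEquiv.nhds (frameEquiv e s hx hs)
    rw [coe_frameEquiv] at this
    exact (contMDiffAt_frameMap e s hx).continuousAt this
  filter_upwards [h1, e.open_baseSet.mem_nhds hx] with y ⟨g, hg⟩ hy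
  have h2 : ∀ c, comb s y c = (e.linearEquivAt ℝ y hy).symm (g c) := by
    intro c
    rw [LinearEquiv.eq_symm_apply]
    change (e ⟨y, comb s y c⟩).2 = _
    rw [← frameMap_apply e s hy, ← hg]
    rfl
  have h3 : ⇑(comb s y) = (e.linearEquivAt ℝ y hy).symm ∘ g := funext h2
  rw [h3]
  exact (LinearEquiv.bijective _).comp g.bijective

/-- In a trivialization the coefficient vector is the inverse of `frameMap` applied to the section,
and inversion of operators is smooth at invertible ones. -/
theorem contMDiffAt_coeff [FiniteDimensional ℝ F] [ContMDiffVectorBundle ∞ F V IB]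
    (s : κ → Sec IB F V) (w : Sec IB F V) {x : B} (hs : Bijective (comb s x)) (i : κ) :
    ContMDiffAt IB 𝓘(ℝ, ℝ) ∞ (fun y => invFun (comb s y) (w y) i) x := by
  let e := trivializationAt F V x
  have hx : x ∈ e.baseSet := FiberBundle.mem_baseSet_trivializationAt F V x
  have h1 : ContMDiffAt IB 𝓘(ℝ, F →L[ℝ] (κ → ℝ)) ∞
      (fun y => ContinuousLinearMap.inverse (frameMap e s y)) x := by
    have h := contDiffAt_map_inverse (𝕜 := ℝ) (n := ∞) (frameEquiv e s hx hs)
    rw [coe_frameEquiv] at h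
    exact h.contMDiffAt.comp x (contMDiffAt_frameMap e s hx)
  have h2 : ContMDiffAt IB 𝓘(ℝ, F) ∞ (fun y => (e ⟨y, w y⟩).2) x :=
    (e.contMDiffAt_section_iff hx).1 (w.contMDiff x)
  have h3 := h1.clm_apply h2
  have h4 : ContMDiffAt IB 𝓘(ℝ, ℝ) ∞
      (fun y => (ContinuousLinearMap.inverse (frameMap e s y)) (e ⟨y, w y⟩).2 i) x :=
    ((ContinuousLinearMap.proj i : (κ → ℝ) →L[ℝ] ℝ).contMDiff.contMDiffAt).comp x h3
  refine h4.congr_of_eventuallyEq ?_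
  filter_upwards [eventually_bijective_comb s hs, e.open_baseSet.mem_nhds hx] with y hy hb
  have h5 := rightInverse_invFun hy.2 (w y)
  have h6 : (e ⟨y, w y⟩).2 = frameEquiv e s hb hy (invFun (comb s y) (w y)) := by
    change _ = (e ⟨y, comb s y _⟩).2
    rw [h5]
  rw [h6, ← coe_frameEquiv e s hb hy, ContinuousLinearMap.inverse_equiv]
  simp

/-- Sections supported where the family `s` is a basis are combinations of the family. -/
theorem exists_coeff [FiniteDimensional ℝ F] [ContMDiffVectorBundle ∞ F V IB]
    (s : κ → Sec IB F V) (ψ : C^∞⟮IB, B; ℝ⟯) {u : Set B} (hψ : tsupport ψ ⊆ u)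
    (hu : ∀ x ∈ u, Bijective (comb s x)) (w : Sec IB F V) :
    ∃ f : κ → C^∞⟮IB, B; ℝ⟯, fsmul ψ w = ∑ i, fsmul (f i) (s i) := by
  -- Where the family is not a basis `invFun` has no meaning, but ψ vanishes there.
  refine ⟨fun i => ⟨fun x => ψ x * invFun (comb s x) (w x) i,
    contMDiff_mul_of_tsupport ψ hψ fun x hx => contMDiffAt_coeff s w (hu x hx) i⟩, ?_⟩
  ext x
  rw [sec_sum_apply]
  change ψ x • w x = ∑ i, (ψ x * invFun (comb s x) (w x) i) • s i x
  simp only [mul_smul, ← Finset.smul_sum, ← comb_apply]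
  by_cases hx : x ∈ tsupport ψ
  · rw [rightInverse_invFun (hu x (hψ hx)).2]
  · rw [image_eq_zero_of_notMem_tsupport hx, zero_smul, zero_smul]

/-- There is a family of global sections that is a frame near a given point. -/
theorem exists_frame [FiniteDimensional ℝ EB] [T2Space B] [FiniteDimensional ℝ F]
    [ContMDiffVectorBundle ∞ F V IB] (x : B) :
    ∃ (n : ℕ) (s : Fin n → Sec IB F V), ∀ᶠ y in 𝓝 x, Bijective (comb s y) := by
  have : FiniteDimensional ℝ (V x) := VectorBundle.finiteDimensional ℝ F V x
  let b := Module.finBasis ℝ (V x)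
  choose s hs using fun i => exists_sec_eq (IB := IB) (F := F) x (b i)
  refine ⟨_, s, eventually_bijective_comb s ?_⟩
  have : comb s x = b.equivFun.symm.toLinearMap := by
    ext i
    simp [comb_apply, hs]
  rw [this]
  exact b.equivFun.symm.bijective

end Frames

end Tools

/-! ### Vector fields -/

section VectorFields

variable {EB : Type*} [NormedAddCommGroup EB] [NormedSpace ℝ EB]
  {HB : Type*} [TopologicalSpace HB] {IB : ModelWithCorners ℝ EB HB}
  {B : Type*} [TopologicalSpace B] [ChartedSpace HB B] [IsManifold IB ∞ B]

theorem dirDeriv_mul (f g : C^∞⟮IB, B; ℝ⟯) (x : B) (v : TangentSpace IB x) :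
    dirDeriv (f * g) x v = f x * dirDeriv g x v + g x * dirDeriv f x v := by
  have := mvfderiv_mul (f.mdifferentiableAt (x := x)) (g.mdifferentiableAt (x := x))
  exact congrArg (fun l => l v) this

theorem dirDeriv_add (f g : C^∞⟮IB, B; ℝ⟯) (x : B) (v : TangentSpace IB x) :
    dirDeriv (f + g) x v = dirDeriv f x v + dirDeriv g x v := by
  have := mvfderiv_add (f.mdifferentiableAt (x := x)) (g.mdifferentiableAt (x := x))
  exact congrArg (fun l => l v) this

theorem dirDeriv_const_smul (r : ℝ) (f : C^∞⟮IB, B; ℝ⟯) (x : B) (v : TangentSpace IB x) :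
    dirDeriv (r • f) x v = r * dirDeriv f x v := by
  have := mvfderiv_smul (x := x) (mdifferentiableAt_const (I := IB) (c := r))
    (f.mdifferentiableAt (x := x))
  have h2 := congrArg (fun l => l v) this
  rw [mvfderiv_const] at h2
  exact h2.trans (by simp [dirDeriv, mvfderiv])

theorem dirDeriv_congr {f g : C^∞⟮IB, B; ℝ⟯} {x : B} (h : ∀ᶠ y in 𝓝 x, f y = g y)
    (v : TangentSpace IB x) : dirDeriv f x v = dirDeriv g x v := by
  have h1 : mfderiv IB 𝓘(ℝ, ℝ) f x = mfderiv IB 𝓘(ℝ, ℝ) g x := EventuallyEq.mfderiv_eq h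
  exact congrArg (fun l : EB →L[ℝ] ℝ => l v) h1

theorem dirDeriv_of_eventually_eq_const {f : C^∞⟮IB, B; ℝ⟯} {x : B} {r : ℝ}
    (h : ∀ᶠ y in 𝓝 x, f y = r) (v : TangentSpace IB x) : dirDeriv f x v = 0 := by
  rw [dirDeriv_congr (g := (⟨fun _ => r, contMDiff_const⟩ : C^∞⟮IB, B; ℝ⟯)) h v]
  have : mfderiv IB 𝓘(ℝ, ℝ) (fun _ : B => r) x = 0 := mfderiv_const
  exact congrArg (fun l : EB →L[ℝ] ℝ => l v) this

/-- Cut-off linear functions of a chart separate tangent vectors, because the differential of the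
chart is injective. -/
theorem dirDeriv_ext [FiniteDimensional ℝ EB] [T2Space B] {x : B} {v v' : TangentSpace IB x}
    (h : ∀ f : C^∞⟮IB, B; ℝ⟯, dirDeriv f x v = dirDeriv f x v') : v = v' := by
  have hinv := isInvertible_mfderiv_extChartAt (I := IB) (mem_extChartAt_source (I := IB) x)
  apply hinv.injective
  have key : ∀ p q : EB, (∀ l : EB →ₗ[ℝ] ℝ, l p = l q) → p = q := by
    intro p q hpq
    rw [← sub_eq_zero, ← Module.forall_dual_apply_eq_zero_iff ℝ]
    intro l
    rw [map_sub, hpq l, sub_self]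
  refine key _ _ fun l => ?_
  obtain ⟨ψ, h1, h2⟩ := exists_bump (IB := IB) x (extChartAt_source_mem_nhds (I := IB) x)
  have hφ : ∀ y ∈ (extChartAt IB x).source,
      ContMDiffAt IB 𝓘(ℝ, ℝ) ∞ (fun y => l (extChartAt IB x y)) y := fun y hy =>
    ((LinearMap.toContinuousLinearMap l).contMDiff.contMDiffAt).comp y
      (contMDiffAt_extChartAt' (by rwa [extChartAt_source] at hy))
  have h3 := h ⟨_, contMDiff_mul_of_tsupport ψ h2 hφ⟩
  have h4 : ∀ u : TangentSpace IB x, dirDeriv ⟨_, contMDiff_mul_of_tsupport ψ h2 hφ⟩ x u =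
      l (mfderiv IB 𝓘(ℝ, EB) (extChartAt IB x) x u) := by
    intro u
    have h5 : mfderiv IB 𝓘(ℝ, ℝ) (fun y => ψ y * l (extChartAt IB x y)) x =
        mfderiv IB 𝓘(ℝ, ℝ) (LinearMap.toContinuousLinearMap l ∘ extChartAt IB x) x := by
      refine EventuallyEq.mfderiv_eq ?_
      filter_upwards [h1] with y hy
      simp [hy]
    rw [mfderiv_comp x (I' := 𝓘(ℝ, EB)) (LinearMap.toContinuousLinearMap l).mdifferentiableAt
      (mdifferentiableAt_extChartAt (mem_chart_source HB x)),
      ContinuousLinearMap.mfderiv_eq] at h5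
    exact congrArg (fun l : EB →L[ℝ] ℝ => l u) h5
  rw [h4, h4] at h3
  exact h3

variable (IB B) in
/-- Smooth vector fields. -/
abbrev VF := Sec IB EB (TangentSpace IB : B → Type _)

/-- The derivative of a function along a vector field. -/
def vfApp (X : VF IB B) (f : C^∞⟮IB, B; ℝ⟯) : C^∞⟮IB, B; ℝ⟯ :=
  ⟨fun x => dirDeriv f x (X x), by
    have h1 : ContMDiff IB.tangent 𝓘(ℝ, ℝ).tangent ∞ (tangentMap IB 𝓘(ℝ, ℝ) f) :=
      f.contMDiff.contMDiff_tangentMap le_rfl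
    exact (contMDiff_snd_tangentBundle_modelSpace ℝ 𝓘(ℝ, ℝ)).comp (h1.comp X.contMDiff)⟩

@[simp] theorem vfApp_apply (X : VF IB B) (f : C^∞⟮IB, B; ℝ⟯) (x : B) :
    vfApp X f x = dirDeriv f x (X x) := rfl

theorem VF.ext_fun [FiniteDimensional ℝ EB] [T2Space B] {X Y : VF IB B}
    (h : ∀ f, vfApp X f = vfApp Y f) : X = Y := by
  ext x
  refine dirDeriv_ext fun f => ?_
  exact congrArg (fun g : C^∞⟮IB, B; ℝ⟯ => g x) (h f)

theorem minSmoothness_three_le : minSmoothness ℝ 3 ≤ (∞ : WithTop ℕ∞) := by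
  rw [minSmoothness_of_isRCLikeNormedField]
  exact WithTop.coe_le_coe.2 (le_top (a := (3 : ℕ∞)))

theorem minSmoothness_two_le : minSmoothness ℝ 2 ≤ (∞ : WithTop ℕ∞) := by
  rw [minSmoothness_of_isRCLikeNormedField]
  exact WithTop.coe_le_coe.2 (le_top (a := (2 : ℕ∞)))

/-- The Lie bracket of vector fields. -/
def lieB [FiniteDimensional ℝ EB] (X Y : VF IB B) : VF IB B :=
  ⟨VectorField.mlieBracket IB X Y, by
    have : CompleteSpace EB := FiniteDimensional.complete ℝ EB
    have : IsManifold IB (minSmoothness ℝ 2) B :=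
      IsManifold.of_le (n := ∞) minSmoothness_two_le
    have : IsManifold IB (((⊤ : ℕ∞) : WithTop ℕ∞) + 1) B := inferInstanceAs (IsManifold IB ∞ B)
    refine ContDiff.mlieBracket_vectorField (m := ⊤) (n := ⊤) X.contMDiff Y.contMDiff ?_
    simp⟩

theorem lieB_fsmul [FiniteDimensional ℝ EB] (X Y : VF IB B) (f : C^∞⟮IB, B; ℝ⟯) :
    lieB X (fsmul f Y) = fsmul (vfApp X f) Y + fsmul f (lieB X Y) := by
  have : CompleteSpace EB := FiniteDimensional.complete ℝ EB
  ext x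
  exact VectorField.mlieBracket_smul_right (V := ⇑X) (W := ⇑Y) (f.mdifferentiableAt (x := x))
    Y.mdifferentiableAt

theorem lieB_add [FiniteDimensional ℝ EB] (X Y Z : VF IB B) :
    lieB X (Y + Z) = lieB X Y + lieB X Z := by
  have : CompleteSpace EB := FiniteDimensional.complete ℝ EB
  ext x
  exact VectorField.mlieBracket_add_right (V := ⇑X) Y.mdifferentiableAt Z.mdifferentiableAt

theorem lieB_jacobi [FiniteDimensional ℝ EB] (X Y Z : VF IB B) :
    lieB X (lieB Y Z) = lieB (lieB X Y) Z + lieB Y (lieB X Z) := by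
  have : CompleteSpace EB := FiniteDimensional.complete ℝ EB
  have : IsManifold IB (minSmoothness ℝ 3) B :=
    IsManifold.of_le (n := ∞) minSmoothness_three_le
  have hs := minSmoothness_two_le
  ext x
  exact VectorField.leibniz_identity_mlieBracket_apply (U := ⇑X) (V := ⇑Y) (W := ⇑Z)
    ((X.contMDiff x).of_le hs) ((Y.contMDiff x).of_le hs) ((Z.contMDiff x).of_le hs)

/-- The commutator formula is extracted from the Jacobi identity for X, Y and f Z: after expansion
by the Leibniz rule only multiples of Z remain. Comparing coefficients needs Z non-zero at x; if the
tangent space is zero, both sides vanish. -/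
theorem vfApp_lieB [FiniteDimensional ℝ EB] [T2Space B] (X Y : VF IB B) (f : C^∞⟮IB, B; ℝ⟯) :
    vfApp (lieB X Y) f = vfApp X (vfApp Y f) - vfApp Y (vfApp X f) := by
  ext x
  by_cases hx : ∃ v : TangentSpace IB x, v ≠ 0
  · obtain ⟨v, hv⟩ := hx
    obtain ⟨Z, rfl⟩ := exists_sec_eq (IB := IB) (F := EB) x v
    have h := lieB_jacobi X Y (fsmul f Z)
    have h0 := lieB_jacobi X Y Z
    simp only [lieB_fsmul, lieB_add, h0, fsmul_add] at h
    have hx := congrArg (fun s : VF IB B => s x) h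
    simp only [ContMDiffSection.coe_add, Pi.add_apply, fsmul_apply, vfApp_apply] at hx
    have h2 : (dirDeriv f x (lieB X Y x) - (dirDeriv (vfApp Y f) x (X x) -
        dirDeriv (vfApp X f) x (Y x))) • Z x = 0 := by
      rw [sub_smul, sub_smul]
      rw [← sub_eq_zero] at hx
      rw [← neg_eq_zero, ← hx]
      abel
    have h3 := (smul_eq_zero.1 h2).resolve_right hv
    exact sub_eq_zero.1 h3
  · push Not at hx
    change dirDeriv f x _ = dirDeriv _ x (X x) - dirDeriv _ x (Y x)
    rw [hx (X x), hx (Y x), hx (lieB X Y x)]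
    simp

end VectorFields

/-! ### Symbols of multiderivations -/

section Symbols

variable {EB : Type*} [NormedAddCommGroup EB] [NormedSpace ℝ EB]
  {HB : Type*} [TopologicalSpace HB] {IB : ModelWithCorners ℝ EB HB}
  {B : Type*} [TopologicalSpace B] [ChartedSpace HB B] [IsManifold IB ∞ B]
  {F : Type*} [NormedAddCommGroup F] [NormedSpace ℝ F]
  {V : B → Type*} [TopologicalSpace (TotalSpace F V)]
  [∀ x, AddCommGroup (V x)] [∀ x, Module ℝ (V x)] [∀ x, TopologicalSpace (V x)]
  [FiberBundle F V] [VectorBundle ℝ F V]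

/-- The Leibniz rule in the last entry, for fixed other entries. -/
def Leib {k : ℕ} (c : Cochain IB F V (k + 1)) (w : Fin k → Sec IB F V) (Y : VF IB B) : Prop :=
  ∀ (f : C^∞⟮IB, B; ℝ⟯) (s : Sec IB F V),
    c (Fin.snoc w (fsmul f s)) = fsmul (vfApp Y f) s + fsmul f (c (Fin.snoc w s))

/-- `X` is a symbol of `c`, as an alternating map from sections to vector fields which is linear
over functions. -/
def AlgSym {k : ℕ} (c : Cochain IB F V (k + 1)) (X : Sec IB F V [⋀^Fin k]→ₗ[ℝ] VF IB B) : Prop :=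
  (∀ w, Leib c w (X w)) ∧ ∀ (w : Fin k → Sec IB F V) (i : Fin k) (f : C^∞⟮IB, B; ℝ⟯)
    (s : Sec IB F V), X (update w i (fsmul f s)) = fsmul f (X (update w i s))

/-- Symbols are handled as maps on sections from here on, since in this form they can be pulled
back, bracketed and expanded. `AlgSym.hasSymbol` is the way back to the fibres. -/
theorem IsSymbol.exists_algSym {k : ℕ} {c : Cochain IB F V (k + 1)}
    {σ : ∀ x : B, (V x) [⋀^Fin k]→ₗ[ℝ] TangentSpace IB x} (h : IsSymbol c σ) :
    ∃ X, AlgSym c X := by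
  have hup : ∀ (w : Fin k → Sec IB F V) (i : Fin k) (s : Sec IB F V) (x : B),
      (fun j => update w i s j x) = update (fun j => w j x) i (s x) := by
    intro w i s x
    funext j
    by_cases hj : j = i
    · subst hj; simp
    · simp [hj]
  let X : Sec IB F V [⋀^Fin k]→ₗ[ℝ] VF IB B :=
    { toFun := fun w => ⟨fun x => σ x (fun i => w i x), h.1 w⟩
      map_update_add' := by
        intro inst w i s s'
        obtain rfl : inst = instDecidableEqFin k := Subsingleton.elim _ _
        ext x
        change σ x _ = σ x _ + σ x _
        rw [hup, hup, hup]
        exact (σ x).map_update_add (fun j => w j x) i (s x) (s' x)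
      map_update_smul' := by
        intro inst w i r s
        obtain rfl : inst = instDecidableEqFin k := Subsingleton.elim _ _
        ext x
        change σ x _ = r • σ x _
        rw [hup, hup]
        exact (σ x).map_update_smul (fun j => w j x) i r (s x)
      map_eq_zero_of_eq' := by
        intro w i j hw hij
        ext x
        exact (σ x).map_eq_zero_of_eq _ (i := i) (j := j)
          (congrArg (fun s : Sec IB F V => s x) hw) hij }
  refine ⟨X, fun w f s => ?_, fun w i f s => ?_⟩
  · ext x
    exact h.2 w f s x
  · ext x
    change σ x _ = f x • σ x _
    rw [hup, hup]
    exact (σ x).map_update_smul _ i (f x) (s x)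

/-- A linear map on sections which is linear over functions at `x` depends only on the value
at `x`. -/
theorem eq_zero_of_tensorial [FiniteDimensional ℝ EB] [T2Space B] [FiniteDimensional ℝ F]
    [ContMDiffVectorBundle ∞ F V IB] {Z : Type*} [AddCommGroup Z] [Module ℝ Z] {x : B}
    (T : Sec IB F V →ₗ[ℝ] Z) (hT : ∀ (f : C^∞⟮IB, B; ℝ⟯) s, T (fsmul f s) = f x • T s)
    {s : Sec IB F V} (hs : s x = 0) : T s = 0 := by
  obtain ⟨n, b, hb⟩ := exists_frame (IB := IB) (F := F) (V := V) x
  obtain ⟨ψ, h1, h2⟩ := exists_bump (IB := IB) x hb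
  obtain ⟨f, hf⟩ := exists_coeff b ψ h2 (fun y hy => hy) s
  have h3 : comb b x (fun i => f i x) = 0 := by
    have := congrArg (fun s : Sec IB F V => s x) hf
    simp only [fsmul_apply, sec_sum_apply, hs, smul_zero] at this
    rw [comb_apply, ← this]
  have h4 : (fun i => f i x) = 0 := hb.self_of_nhds.1 (h3.trans (map_zero _).symm)
  have h5 := congrArg T hf
  rw [hT, h1.self_of_nhds, one_smul, map_sum] at h5
  rw [h5]
  refine Finset.sum_eq_zero fun i _ => ?_
  rw [hT, show f i x = 0 from congrFun h4 i, zero_smul]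

/-- The entries are exchanged one at a time, with `eq_zero_of_tensorial` applied to each difference.
-/
theorem apply_eq_of_tensorial [FiniteDimensional ℝ EB] [T2Space B] [FiniteDimensional ℝ F]
    [ContMDiffVectorBundle ∞ F V IB] {k : ℕ} {X : Sec IB F V [⋀^Fin k]→ₗ[ℝ] VF IB B}
    (hX : ∀ (w : Fin k → Sec IB F V) (i : Fin k) (f : C^∞⟮IB, B; ℝ⟯) (s : Sec IB F V),
      X (update w i (fsmul f s)) = fsmul f (X (update w i s)))
    {x : B} {w w' : Fin k → Sec IB F V} (hw : ∀ i, w i x = w' i x) : X w x = X w' x := by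
  classical
  have h1 : ∀ (v : Fin k → Sec IB F V) (i : Fin k) (s s' : Sec IB F V), s x = s' x →
      X (update v i s) x = X (update v i s') x := by
    intro v i s s' hs
    have := eq_zero_of_tensorial (x := x) (s := s - s')
      (evalAt x ∘ₗ X.toMultilinearMap.toLinearMap v i)
      (fun f s => by
        change X (update v i (fsmul f s)) x = f x • X (update v i s) x
        rw [hX]; rfl) (by simp [hs])
    rw [map_sub, sub_eq_zero] at this
    exact this
  have h2 : ∀ S : Finset (Fin k), X (S.piecewise w' w) x = X w x := by
    intro S
    induction S using Finset.induction_on with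
    | empty => simp
    | insert j S hj ih =>
      rw [Finset.piecewise_insert, ← ih]
      conv_rhs => rw [← update_eq_self j (S.piecewise w' w)]
      refine h1 _ _ _ _ ?_
      rw [Finset.piecewise_eq_of_notMem _ _ _ hj]
      exact (hw j).symm
  have := h2 Finset.univ
  rw [Finset.piecewise_univ] at this
  exact this.symm

/-- A linear right inverse `r x` of evaluation extends fibre vectors to sections. By tensoriality
the value at x does not depend on it, so `r` need not be smooth in x. -/
theorem AlgSym.hasSymbol [FiniteDimensional ℝ EB] [T2Space B] [FiniteDimensional ℝ F]
    [ContMDiffVectorBundle ∞ F V IB] {k : ℕ} {c : Cochain IB F V (k + 1)}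
    {X : Sec IB F V [⋀^Fin k]→ₗ[ℝ] VF IB B} (h : AlgSym c X) : HasSymbol c := by
  have hr : ∀ x : B, ∃ r : V x →ₗ[ℝ] Sec IB F V, evalAt x ∘ₗ r = LinearMap.id := fun x =>
    (evalAt x).exists_rightInverse_of_surjective (LinearMap.range_eq_top.2 (evalAt_surjective x))
  choose r hr using hr
  have hσ : ∀ x (w : Fin k → Sec IB F V), X (fun i => r x (w i x)) x = X w x := fun x w =>
    apply_eq_of_tensorial h.2 fun i => LinearMap.congr_fun (hr x) (w i x)
  refine ⟨fun x => ((evalAt x).compAlternatingMap X).compLinearMap (r x), fun w => ?_,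
    fun w f s x => ?_⟩
  · refine (X w).contMDiff.congr fun x => ?_
    exact congrArg (TotalSpace.mk x) (hσ x w)
  · have := congrArg (fun s : Sec IB F V => s x) (h.1 w f s)
    refine this.trans ?_
    have h2 : ((evalAt x).compAlternatingMap X).compLinearMap (r x) (fun i => w i x) = X w x :=
      hσ x w
    rw [h2]
    rfl

/-- Subtracting two Leibniz rules gives (Yf - Y'f) s = 0, and positive rank provides an s that does
not vanish at the given point. -/
theorem Leib.unique [FiniteDimensional ℝ EB] [T2Space B] [Nontrivial F]
    [ContMDiffVectorBundle ∞ F V IB] {k : ℕ} {c : Cochain IB F V (k + 1)}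
    {w : Fin k → Sec IB F V} {Y Y' : VF IB B} (h : Leib c w Y) (h' : Leib c w Y') : Y = Y' := by
  refine VF.ext_fun fun f => ?_
  ext x
  have : Nontrivial (V x) :=
    (VectorBundle.continuousLinearEquivAt ℝ F V x).toLinearEquiv.toEquiv.nontrivial
  obtain ⟨v, hv⟩ := exists_ne (0 : V x)
  obtain ⟨s, rfl⟩ := exists_sec_eq (IB := IB) (F := F) x v
  have h1 := (h f s).symm.trans (h' f s)
  rw [add_left_inj] at h1
  exact smul_left_injective ℝ hv (congrArg (fun s : Sec IB F V => s x) h1)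

theorem snoc_update_eq {k : ℕ} (w : Fin k → Sec IB F V) (i : Fin k) (a t : Sec IB F V) :
    (Fin.snoc (update w i a) t : Fin (k + 1) → Sec IB F V) =
      update (Fin.snoc w t : Fin (k + 1) → Sec IB F V) i.castSucc a :=
  Fin.snoc_update (α := fun _ => Sec IB F V) ..

/-- If the rank is positive, the symbol of an alternating map is automatically alternating, and
linear over functions as soon as this holds in one entry. -/
theorem exists_algSym [FiniteDimensional ℝ EB] [T2Space B] [Nontrivial F]
    [ContMDiffVectorBundle ∞ F V IB] {k : ℕ} (c : Sec IB F V [⋀^Fin (k + 1)]→ₗ[ℝ] Sec IB F V)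
    (hc : ∀ w : Fin k → Sec IB F V, ∃ Y : VF IB B, Leib c w Y)
    (ht : k = 0 ∨ ∃ i₀ : Fin k, ∀ (w : Fin k → Sec IB F V) (f : C^∞⟮IB, B; ℝ⟯) (s : Sec IB F V)
      (Y : VF IB B), Leib c (update w i₀ s) Y → Leib c (update w i₀ (fsmul f s)) (fsmul f Y)) :
    ∃ X, AlgSym c X := by
  choose Y hY using hc
  let X : Sec IB F V [⋀^Fin k]→ₗ[ℝ] VF IB B :=
    { toFun := Y
      map_update_add' := by
        intro inst w i s s'
        obtain rfl : inst = instDecidableEqFin k := Subsingleton.elim _ _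
        refine (hY _).unique (fun f t => ?_)
        have h1 := hY (update w i s) f t
        have h2 := hY (update w i s') f t
        simp only [snoc_update_eq, AlternatingMap.map_update_add] at h1 h2 ⊢
        rw [h1, h2, fsmul_add]
        ext x
        simp only [ContMDiffSection.coe_add, Pi.add_apply, fsmul_apply, vfApp_apply, map_add,
          add_smul]
        abel
      map_update_smul' := by
        intro inst w i r s
        obtain rfl : inst = instDecidableEqFin k := Subsingleton.elim _ _
        refine (hY _).unique (fun f t => ?_)
        have h1 := hY (update w i s) f t
        simp only [snoc_update_eq, AlternatingMap.map_update_smul] at h1 ⊢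
        rw [h1, fsmul_smul, smul_add]
        congr 1
        ext x
        change r • (dirDeriv f x _ • t x) = dirDeriv f x (r • _) • t x
        rw [map_smul, smul_smul, smul_eq_mul]
      map_eq_zero_of_eq' := by
        intro w i j hw hij
        refine (hY _).unique (fun f t => ?_)
        have h1 : ∀ t, c (Fin.snoc w t) = 0 := fun t =>
          c.map_eq_zero_of_eq _ (i := i.castSucc) (j := j.castSucc) (by simpa using hw)
            (fun h => hij (Fin.castSucc_injective _ h))
        rw [h1, h1]
        ext x
        simp }
  refine ⟨X, hY, fun w i f s => ?_⟩
  rcases ht with rfl | ⟨i₀, ht⟩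
  · exact i.elim0
  have h1 : ∀ w f s, X (update w i₀ (fsmul f s)) = fsmul f (X (update w i₀ s)) := fun w f s =>
    (hY _).unique (ht w f s _ (hY _))
  by_cases hi : i = i₀
  · subst hi
    exact h1 w f s
  -- Any other entry is exchanged with entry `i₀`, at the cost of a sign.
  · have h2 : ∀ t, X (update w i t) = -X (update (w ∘ Equiv.swap i i₀) i₀ t) := by
      intro t
      rw [← X.map_swap _ hi]
      congr 1
      funext l
      by_cases h3 : l = i
      · subst h3; simp
      · by_cases h4 : l = i₀
        · subst h4; simp [hi, h3]
        · simp [h3, h4, Equiv.swap_apply_of_ne_of_ne]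
    rw [h2, h2, h1]
    ext x
    simp

/-! The differential of a Lie algebroid preserves multiderivations. -/

namespace LieAlgebroid

variable (L : LieAlgebroid IB F V)

theorem diffFun_eq_ceFun {k : ℕ} (c : Cochain IB F V k) : L.diffFun c = ceFun L.bracket c := by
  cases k <;> rfl

/-- The anchor of a section, as a vector field. -/
def rho (a : Sec IB F V) : VF IB B :=
  ⟨fun x => L.anchor x (a x), L.contMDiff_anchor.comp a.contMDiff⟩

@[simp] theorem rho_apply (a : Sec IB F V) (x : B) : L.rho a x = L.anchor x (a x) := rfl

theorem rho_add (a b : Sec IB F V) : L.rho (a + b) = L.rho a + L.rho b := by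
  ext x; simp

theorem rho_fsmul (f : C^∞⟮IB, B; ℝ⟯) (a : Sec IB F V) :
    L.rho (fsmul f a) = fsmul f (L.rho a) := by
  ext x; simp

theorem bracket_fsmul (a : Sec IB F V) (f : C^∞⟮IB, B; ℝ⟯) (b : Sec IB F V) :
    L.bracket a (fsmul f b) = fsmul (vfApp (L.rho a) f) b + fsmul f (L.bracket a b) := by
  ext x
  exact L.leibniz a f b x

/-- The symbol of the Lie derivative of a multiderivation with symbol `X`. -/
def lieSym [FiniteDimensional ℝ EB] {k : ℕ} (a : Sec IB F V)
    (X : Sec IB F V [⋀^Fin k]→ₗ[ℝ] VF IB B) (w : Fin k → Sec IB F V) : VF IB B :=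
  lieB (L.rho a) (X w) - ∑ i, X (update w i (L.bracket a (w i)))

/-- Expanding by the Leibniz rules of the bracket and of c, the second derivatives of f form the
commutator of ρ(a) and X(w), which `vfApp_lieB` identifies; the terms ρ(a)(f) c(w, s) and X(w)(f)
[a, s] each occur twice with opposite signs. -/
theorem leib_lieD [FiniteDimensional ℝ EB] [T2Space B] {k : ℕ} (a : Sec IB F V)
    (c : Sec IB F V [⋀^Fin (k + 1)]→ₗ[ℝ] Sec IB F V) {X : Sec IB F V [⋀^Fin k]→ₗ[ℝ] VF IB B}
    (hX : AlgSym c X) (w : Fin k → Sec IB F V) :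
    Leib (lieD L.bracket a c) w (L.lieSym a X w) := by
  intro f s
  have hu : ∀ t u : Sec IB F V,
      update (Fin.snoc w t : Fin (k + 1) → Sec IB F V) (Fin.last k) u = Fin.snoc w u :=
    fun t u => Fin.update_snoc_last ..
  have hadd : ∀ t u : Sec IB F V, c (Fin.snoc w (t + u)) = c (Fin.snoc w t) + c (Fin.snoc w u) := by
    intro t u
    rw [← hu 0 (t + u), c.map_update_add, hu, hu]
  have hL := hX.1
  simp only [Leib] at hL
  simp only [lieD_apply, Fin.sum_univ_castSucc, Fin.snoc_castSucc, Fin.snoc_last, hu,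
    ← snoc_update_eq, hL, bracket_fsmul, map_add, hadd]
  ext x
  have e : vfApp (L.lieSym a X w) f x = dirDeriv (vfApp (X w) f) x (L.anchor x (a x)) -
      dirDeriv (vfApp (L.rho a) f) x (X w x) -
      ∑ i, dirDeriv f x (X (update w i (L.bracket a (w i))) x) := by
    have := congrArg (fun g : C^∞⟮IB, B; ℝ⟯ => g x) (vfApp_lieB (L.rho a) (X w) f)
    change dirDeriv f x (lieB (L.rho a) (X w) x) = dirDeriv _ x _ - dirDeriv _ x _ at this
    rw [rho_apply] at this
    rw [← this]
    change dirDeriv f x ((lieB (L.rho a) (X w) - ∑ i, X (update w i (L.bracket a (w i)))) x) = _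
    rw [ContMDiffSection.coe_sub, Pi.sub_apply, sec_sum_apply, map_sub, map_sum]
  simp only [ContMDiffSection.coe_add, ContMDiffSection.coe_sub, Pi.add_apply, Pi.sub_apply,
    fsmul_apply, sec_sum_apply, e, Finset.sum_add_distrib, sub_smul, smul_sub, smul_add,
    Finset.sum_smul, Finset.smul_sum, vfApp_apply, rho_apply]
  abel

/-- The vector field bracket and the summand bracketing entry i both produce ρ(a)(f) X(..., s, ...),
with opposite signs. -/
theorem lieSym_fsmul [FiniteDimensional ℝ EB] {k : ℕ} (a : Sec IB F V)
    {c : Cochain IB F V (k + 1)} {X : Sec IB F V [⋀^Fin k]→ₗ[ℝ] VF IB B}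
    (hX : AlgSym c X) (w : Fin k → Sec IB F V) (i : Fin k) (f : C^∞⟮IB, B; ℝ⟯) (s : Sec IB F V) :
    L.lieSym a X (update w i (fsmul f s)) = fsmul f (L.lieSym a X (update w i s)) := by
  have h := hX.2
  have hcomm : ∀ (t : Sec IB F V) (j : Fin k), j ≠ i → ∀ u,
      update (update w i t) j u = update (update w j u) i t := fun t j hj u => update_comm hj.symm _ _ _
  unfold lieSym
  rw [h, lieB_fsmul, Fintype.sum_eq_add_sum_compl i, Fintype.sum_eq_add_sum_compl i]
  have e : ∑ j ∈ {i}ᶜ, X (update (update w i (fsmul f s)) j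
      (L.bracket a (update w i (fsmul f s) j))) =
      fsmul f (∑ j ∈ {i}ᶜ, X (update (update w i s) j (L.bracket a (update w i s j)))) := by
    have hs : ∀ g : Fin k → VF IB B, fsmul f (∑ j ∈ {i}ᶜ, g j) = ∑ j ∈ {i}ᶜ, fsmul f (g j) := by
      intro g
      ext x
      simp [sec_sum_apply, Finset.smul_sum]
    rw [hs]
    refine Finset.sum_congr rfl fun j hj => ?_
    have hj : j ≠ i := by simpa using hj
    rw [hcomm _ _ hj, hcomm _ _ hj, h]
    simp [update_of_ne hj]
  rw [e]
  simp only [update_self, update_idem, bracket_fsmul, AlternatingMap.map_update_add, h]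
  ext x
  simp only [ContMDiffSection.coe_add, ContMDiffSection.coe_sub, Pi.add_apply, Pi.sub_apply,
    fsmul_apply, smul_sub, smul_add]
  abel

theorem lieB_fsmul_left [FiniteDimensional ℝ EB] [T2Space B] (X Y : VF IB B)
    (f : C^∞⟮IB, B; ℝ⟯) : lieB (fsmul f X) Y = -fsmul (vfApp Y f) X + fsmul f (lieB X Y) := by
  have hsw : ∀ X Y : VF IB B, lieB X Y = -lieB Y X := fun X Y => by
    ext x
    exact VectorField.mlieBracket_swap_apply
  rw [hsw, lieB_fsmul, hsw X Y]
  ext x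
  simp
  abel

/-- The differential of an alternating map with symbol has a symbol. -/
theorem exists_algSym_ceFun [FiniteDimensional ℝ EB] [T2Space B] [Nontrivial F]
    [ContMDiffVectorBundle ∞ F V IB] : ∀ {k : ℕ} (c : Sec IB F V [⋀^Fin k]→ₗ[ℝ] Sec IB F V),
    HasSymbol (⇑c : Cochain IB F V k) → ∃ X, AlgSym (ceFun L.bracket c : Cochain IB F V (k + 1)) X
  | 0, c, _ => by
    -- δc(s) = [s, c] = -[c, s] is a derivation along -ρ(c).
    refine ⟨AlternatingMap.constOfIsEmpty ℝ (Sec IB F V) (Fin 0) (-L.rho (c Fin.elim0)),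
      fun w f s => ?_, fun w i => i.elim0⟩
    have h1 : ∀ t : Sec IB F V, ceFun L.bracket c (Fin.snoc w t) =
        -L.bracket (c Fin.elim0) t := by
      intro t
      rw [← br_skew L.bracket_self]
      change L.bracket _ (c _) = _
      congr 2
      exact Subsingleton.elim _ _
    rw [h1, h1, bracket_fsmul]
    ext x
    simp
    abel
  | k + 1, c, ⟨σ, hσ⟩ => by
    obtain ⟨X, hX⟩ := hσ.exists_algSym
    have hcur : ∀ a, HasSymbol (⇑(c.curryLeft a) : Cochain IB F V k) := by
      intro a
      cases k with
      | zero => trivial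
      | succ k =>
        refine ⟨fun x => (σ x).curryLeft (a x), fun w => ?_, fun w f s x => ?_⟩
        · refine (hσ.1 (Fin.cons a w)).congr fun x => ?_
          refine congrArg (TotalSpace.mk x) ?_
          change σ x (Fin.cons (a x) _) = _
          congr 1
          funext i
          refine Fin.cases rfl (fun i => rfl) i
        · have := hσ.2 (Fin.cons a w) f s x
          rw [← Fin.cons_snoc_eq_snoc_cons, ← Fin.cons_snoc_eq_snoc_cons] at this
          refine this.trans ?_
          congr 3
          change _ = σ x (Fin.cons (a x) _)
          congr 1
          funext i
          refine Fin.cases rfl (fun i => rfl) i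
    choose Z hZ using fun a => exists_algSym_ceFun (c.curryLeft a) (hcur a)
    obtain ⟨d, hd⟩ := exists_ceFun_alternating L.bracket_self c
    -- By Cartan's formula: the Lie derivative has a symbol by `leib_lieD`, the differential of the
    -- contraction by induction. The chosen `Z` are not known to depend linearly on `w 0`.
    have hL : ∀ w : Fin (k + 1) → Sec IB F V, Leib (⇑d : Cochain IB F V (k + 2)) w
        (L.lieSym (w 0) X (Fin.tail w) - Z (w 0) (Fin.tail w)) := by
      intro w f s
      have hsn : ∀ t : Sec IB F V, (Fin.snoc w t : Fin (k + 2) → Sec IB F V) =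
          Fin.cons (w 0) (Fin.snoc (Fin.tail w) t) := by
        intro t
        rw [Fin.cons_snoc_eq_snoc_cons, Fin.cons_self_tail]
      rw [hsn, hsn, hd, ceFun_cons, ceFun_cons, L.leib_lieD (w 0) c hX, (hZ (w 0)).1]
      ext x
      simp only [ContMDiffSection.coe_add, ContMDiffSection.coe_sub, Pi.add_apply, Pi.sub_apply,
        fsmul_apply, vfApp_apply, map_sub, sub_smul, smul_sub]
      abel
    rw [← hd]
    -- Uniqueness of symbols takes care of multilinearity and alternation, so one entry remains to
    -- be tested for linearity over functions.
    refine exists_algSym d (fun w => ⟨_, hL w⟩) (Or.inr ?_)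
    cases k with
    | zero =>
      -- The symbol has a single entry a and equals [ρ(a), X] + ρ(c(a)). For a = f s the two
      -- contributions X(f) ρ(s) cancel.
      refine ⟨0, fun w f s Y hY => ?_⟩
      rw [hY.unique (hL _)]
      have hu : ∀ a, Leib (⇑d : Cochain IB F V 2) (update w 0 a)
          (lieB (L.rho a) (X Fin.elim0) + L.rho (c (fun _ => a))) := by
        intro a
        have h1 := hL (update w 0 a)
        have h2 : Leib (ceFun L.bracket (c.curryLeft a) : Cochain IB F V 1) Fin.elim0
            (-L.rho (c (fun _ => a))) := by
          intro f t
          have h3 : ∀ t : Sec IB F V, ceFun L.bracket (c.curryLeft a) (Fin.snoc Fin.elim0 t) =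
              -L.bracket (c fun _ => a) t := by
            intro t
            rw [← br_skew L.bracket_self]
            change L.bracket _ (c _) = _
            congr 2
            funext i
            fin_cases i
            rfl
          rw [h3, h3, bracket_fsmul]
          ext x
          simp
          abel
        rw [update_self] at h1
        have h4 : Fin.tail (update w 0 a) = Fin.elim0 := Subsingleton.elim _ _
        rw [h4, ((hZ a).1 Fin.elim0).unique h2, sub_neg_eq_add] at h1
        have h5 : L.lieSym a X Fin.elim0 = lieB (L.rho a) (X Fin.elim0) := by
          simp [lieSym]
        rwa [h5] at h1
      rw [(hL _).unique (hu s)]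
      have h6 := hu (fsmul f s)
      have h7 : c (fun _ => fsmul f s) =
          fsmul (vfApp (X Fin.elim0) f) s + fsmul f (c (fun _ => s)) := by
        have := hX.1 Fin.elim0 f s
        have e : ∀ t : Sec IB F V, (Fin.snoc Fin.elim0 t : Fin 1 → Sec IB F V) = fun _ => t := by
          intro t
          funext i
          fin_cases i
          rfl
        rwa [e, e] at this
      rw [rho_fsmul, lieB_fsmul_left, h7, rho_add, rho_fsmul, rho_fsmul] at h6
      convert h6 using 1
      rw [fsmul_add]
      abel
    | succ k =>
      -- Entry 1 is not the contracted one: it enters only through the tail, in which both symbols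
      -- are already linear over functions.
      refine ⟨1, fun w f s Y hY => ?_⟩
      rw [hY.unique (hL _)]
      have h1 := hL (update w 1 (fsmul f s))
      have ht : ∀ t : Sec IB F V, Fin.tail (update w 1 t) = update (Fin.tail w) 0 t := by
        intro t
        exact Fin.tail_update_succ w 0 t
      rw [ht, L.lieSym_fsmul _ hX, (hZ _).2] at h1
      rw [ht]
      convert h1 using 1
      have h2 : ∀ t : Sec IB F V, update w 1 t 0 = w 0 := fun t => by
        rw [update_of_ne]
        exact Fin.zero_ne_one
      rw [h2, h2]
      ext x
      simp [smul_sub]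

/-- The differential preserves multiderivations. -/
theorem diff_mem_multiDer [FiniteDimensional ℝ EB] [T2Space B] [FiniteDimensional ℝ F]
    [ContMDiffVectorBundle ∞ F V IB] {k : ℕ} {c : Cochain IB F V k} (hc : c ∈ multiDer IB F V k) :
    L.diff k c ∈ multiDer IB F V (k + 1) := by
  -- In rank zero symbols need not be unique, but every cochain vanishes.
  rcases subsingleton_or_nontrivial F with hF | hF
  · have : Subsingleton (Sec IB F V) := ⟨fun s s' => by
      ext x
      exact (VectorBundle.continuousLinearEquivAt ℝ F V x).injective (Subsingleton.elim _ _)⟩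
    rw [show L.diff k c = 0 from Subsingleton.elim _ _]
    exact zero_mem _
  · obtain ⟨⟨a, rfl⟩, hs⟩ := hc
    obtain ⟨X, hX⟩ := L.exists_algSym_ceFun a hs
    obtain ⟨d, hd⟩ := exists_ceFun_alternating L.bracket_self a
    have e : L.diff k a = ceFun L.bracket a := L.diffFun_eq_ceFun a
    rw [e]
    exact ⟨⟨d, hd⟩, hX.hasSymbol⟩

theorem diff_diff {k : ℕ} {c : Cochain IB F V k} (hc : c ∈ multiDer IB F V k) :
    L.diff (k + 1) (L.diff k c) = 0 := by
  obtain ⟨⟨a, rfl⟩, -⟩ := hc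
  change L.diffFun (L.diffFun a) = 0
  rw [diffFun_eq_ceFun, diffFun_eq_ceFun]
  exact ceFun_ceFun L.bracket_self L.jacobi a

end LieAlgebroid

end Symbols

/-! ### Expansions `a(t) = t⁻¹ A + B + o(1)` as `t → 0` -/

/-- The filter of non-zero reals that tend to zero. -/
def nzero : Filter ℝˣ := comap ((↑) : ℝˣ → ℝ) (𝓝 0)

theorem tendsto_nzero : Tendsto ((↑) : ℝˣ → ℝ) nzero (𝓝 0) := tendsto_comap

/-- Linear multiderivations are constrained only for t > 0, so limits must also be determined along
positive units. -/
theorem nzero_neBot_pos : (nzero ⊓ 𝓟 {t : ℝˣ | 0 < (t : ℝ)}).NeBot := by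
  rw [nzero, inf_principal_neBot_iff]
  rintro U ⟨N, hN, hU⟩
  obtain ⟨ε, hε, hb⟩ := Metric.mem_nhds_iff.1 hN
  refine ⟨Units.mk0 (ε / 2) (by positivity), hU (hb ?_), ?_⟩
  · simp [abs_of_pos hε, hε]
  · simp [hε]

instance nzero_neBot : nzero.NeBot := nzero_neBot_pos.mono inf_le_left

theorem tendsto_mul_nzero (s : ℝˣ) : Tendsto (fun t => s * t) nzero nzero := by
  refine tendsto_comap_iff.2 ?_
  have := tendsto_nzero.const_mul (s : ℝ)
  rw [mul_zero] at this
  exact this.congr fun t => (Units.val_mul s t).symm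

/-- `r(t) = t⁻¹ a + b + o(1)` for real-valued functions. -/
def Exp0 (r : ℝˣ → ℝ) (a b : ℝ) : Prop := Tendsto (fun t => r t - (t : ℝ)⁻¹ * a) nzero (𝓝 b)

namespace Exp0

variable {r r' : ℝˣ → ℝ} {a b a' b' : ℝ}

theorem add (h : Exp0 r a b) (h' : Exp0 r' a' b') :
    Exp0 (fun t => r t + r' t) (a + a') (b + b') :=
  (Tendsto.add h h').congr fun t => by ring

theorem const_mul (c : ℝ) (h : Exp0 r a b) : Exp0 (fun t => c * r t) (c * a) (c * b) :=
  (Tendsto.const_mul c h).congr fun t => by ring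

theorem zero : Exp0 (fun _ => 0) 0 0 := by simp [Exp0]

theorem sum {ι : Type*} (S : Finset ι) {r : ι → ℝˣ → ℝ} {a b : ι → ℝ}
    (h : ∀ i ∈ S, Exp0 (r i) (a i) (b i)) :
    Exp0 (fun t => ∑ i ∈ S, r i t) (∑ i ∈ S, a i) (∑ i ∈ S, b i) :=
  (tendsto_finsetSum S h).congr fun t => by rw [Finset.sum_sub_distrib, Finset.mul_sum]

theorem tendsto_mul (h : Exp0 r a b) : Tendsto (fun t : ℝˣ => (t : ℝ) * r t) nzero (𝓝 a) := by
  have h1 := (tendsto_nzero.mul h).add_const a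
  rw [zero_mul, zero_add] at h1
  refine h1.congr fun t => ?_
  field_simp
  ring

theorem unit_mul (h : Exp0 r a b) : Exp0 (fun t => (t : ℝ) * r t) 0 a := by
  simpa [Exp0] using h.tendsto_mul

theorem unique (h : Exp0 r a b) (h' : Exp0 r a' b') : a = a' ∧ b = b' := by
  obtain rfl := tendsto_nhds_unique h.tendsto_mul h'.tendsto_mul
  exact ⟨rfl, tendsto_nhds_unique h h'⟩

/-- The source of the weights -1 and 0: the factor h_s^* replaces t by s t, which affects only the
coefficient of t⁻¹. -/
theorem comp_mul (s : ℝˣ) (h : Exp0 r a b) : Exp0 (fun t => r (s * t)) ((s : ℝ)⁻¹ * a) b :=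
  (h.comp (tendsto_mul_nzero s)).congr fun t => by
    simp only [comp_apply, Units.val_mul]
    field_simp

end Exp0

/-! ### Expansions of sections and functions, tested by operators of order one -/

section Expansions

variable {EB : Type*} [NormedAddCommGroup EB] [NormedSpace ℝ EB]
  {HB : Type*} [TopologicalSpace HB] {IB : ModelWithCorners ℝ EB HB}
  {B : Type*} [TopologicalSpace B] [ChartedSpace HB B] [IsManifold IB ∞ B]
  {F : Type*} [NormedAddCommGroup F] [NormedSpace ℝ F]
  {V : B → Type*} [TopologicalSpace (TotalSpace F V)]
  [∀ x, AddCommGroup (V x)] [∀ x, Module ℝ (V x)] [∀ x, TopologicalSpace (V x)]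
  [FiberBundle F V] [VectorBundle ℝ F V]

/-- Functionals on sections given by a differential operator of order one at `x` with scalar
symbol. -/
def IsFirstOrder (x : B) (ℓ : Sec IB F V →ₗ[ℝ] ℝ) : Prop :=
  ∃ β : Sec IB F V → TangentSpace IB x, ∀ (f : C^∞⟮IB, B; ℝ⟯) (s : Sec IB F V),
    ℓ (fsmul f s) = dirDeriv f x (β s) + f x * ℓ s

theorem isFirstOrder_of_tensorial {x : B} {ℓ : Sec IB F V →ₗ[ℝ] ℝ}
    (h : ∀ (f : C^∞⟮IB, B; ℝ⟯) s, ℓ (fsmul f s) = f x * ℓ s) : IsFirstOrder x ℓ :=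
  ⟨fun _ => 0, fun f s => by rw [h, map_zero, zero_add]⟩

theorem isFirstOrder_eval (x : B) (l : V x →ₗ[ℝ] ℝ) :
    IsFirstOrder x (l ∘ₗ evalAt x : Sec IB F V →ₗ[ℝ] ℝ) :=
  isFirstOrder_of_tensorial fun f s => by simp

/-- For a cut-off ψ equal to 1 near x the differential vanishes at x, so the rule applied to ψ (s -
s') = 0 leaves ℓ(s - s') = 0. -/
theorem IsFirstOrder.eq_of_eventuallyEq [FiniteDimensional ℝ EB] [T2Space B] {x : B}
    {ℓ : Sec IB F V →ₗ[ℝ] ℝ} (h : IsFirstOrder x ℓ) {s s' : Sec IB F V}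
    (hs : ∀ᶠ y in 𝓝 x, s y = s' y) : ℓ s = ℓ s' := by
  obtain ⟨β, hβ⟩ := h
  obtain ⟨ψ, h1, h2⟩ := exists_bump (IB := IB) x hs
  have h3 : fsmul ψ (s - s') = 0 := by
    ext y
    by_cases hy : y ∈ tsupport ψ
    · have : s y = s' y := h2 hy
      simp [this]
    · simp [image_eq_zero_of_notMem_tsupport hy]
  have h4 := hβ ψ (s - s')
  rw [h3, map_zero, dirDeriv_of_eventually_eq_const h1, h1.self_of_nhds, zero_add, one_mul,
    map_sub] at h4
  exact (sub_eq_zero.1 h4.symm)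

/-- The bracket with a section is a functional of order one. -/
theorem LieAlgebroid.isFirstOrder_bracket (L : LieAlgebroid IB F V) (a : Sec IB F V) (x : B)
    (l : V x →ₗ[ℝ] ℝ) : IsFirstOrder x (l ∘ₗ evalAt x ∘ₗ L.bracket a) := by
  refine ⟨fun s => l (s x) • L.rho a x, fun f s => ?_⟩
  change l (L.bracket a (VBDef.fsmul f s) x) = _ + f x * l (L.bracket a s x)
  rw [L.bracket_fsmul, map_smul, ContMDiffSection.coe_add, Pi.add_apply, map_add, fsmul_apply,
    fsmul_apply, map_smul, map_smul, vfApp_apply, smul_eq_mul, smul_eq_mul, smul_eq_mul,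
    mul_comm (l (s x))]

/-- `a(t) = t⁻¹ A + B + o(1)`, where convergence is tested by all functionals of order one. -/
def HasExp (a : ℝˣ → Sec IB F V) (A B' : Sec IB F V) : Prop :=
  ∀ (x : B) (ℓ : Sec IB F V →ₗ[ℝ] ℝ), IsFirstOrder x ℓ → Exp0 (fun t => ℓ (a t)) (ℓ A) (ℓ B')

/-- `g(t) = t⁻¹ g₁ + g₀ + o(1)` for functions and their first derivatives, pointwise. -/
def FunExp (g : ℝˣ → C^∞⟮IB, B; ℝ⟯) (g₁ g₀ : C^∞⟮IB, B; ℝ⟯) : Prop :=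
  ∀ x : B, Exp0 (fun t => g t x) (g₁ x) (g₀ x) ∧ ∀ v : TangentSpace IB x,
    Exp0 (fun t => dirDeriv (g t) x v) (dirDeriv g₁ x v) (dirDeriv g₀ x v)

namespace HasExp

variable {a a' : ℝˣ → Sec IB F V} {A B' A' B'' : Sec IB F V}

theorem apply (h : HasExp a A B') (x : B) (l : V x →ₗ[ℝ] ℝ) :
    Exp0 (fun t => l (a t x)) (l (A x)) (l (B' x)) :=
  h x _ (isFirstOrder_eval x l)

theorem zero : HasExp (fun _ => (0 : Sec IB F V)) 0 0 := fun x ℓ _ => by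
  simpa using Exp0.zero

theorem add (h : HasExp a A B') (h' : HasExp a' A' B'') :
    HasExp (fun t => a t + a' t) (A + A') (B' + B'') := fun x ℓ hℓ => by
  simpa only [map_add] using (h x ℓ hℓ).add (h' x ℓ hℓ)

theorem const_smul (c : ℝ) (h : HasExp a A B') :
    HasExp (fun t => c • a t) (c • A) (c • B') := fun x ℓ hℓ => by
  simpa only [map_smul, smul_eq_mul] using (h x ℓ hℓ).const_mul c

theorem unit_smul (h : HasExp a A B') : HasExp (fun t => (t : ℝ) • a t) 0 A := fun x ℓ hℓ => by
  simpa only [map_smul, smul_eq_mul, map_zero] using (h x ℓ hℓ).unit_mul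

theorem pow_smul (h : HasExp a A B') : ∀ n : ℕ, ∃ A' B'', HasExp (fun t => (t : ℝ) ^ n • a t) A' B''
  | 0 => ⟨A, B', by simpa using h⟩
  | n + 1 => by
    obtain ⟨A', B'', h'⟩ := pow_smul h n
    refine ⟨0, A', ?_⟩
    simpa only [pow_succ', mul_smul] using h'.unit_smul

/-- Precomposing a functional of order one with multiplication by f gives such a functional again.
This stability makes the notion compatible with Leibniz rules. -/
theorem fsmul (f : C^∞⟮IB, B; ℝ⟯) (h : HasExp a A B') :
    HasExp (fun t => VBDef.fsmul f (a t)) (VBDef.fsmul f A) (VBDef.fsmul f B') := by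
  rintro x ℓ ⟨β, hβ⟩
  let ℓ' : Sec IB F V →ₗ[ℝ] ℝ :=
    { toFun := fun s => ℓ (VBDef.fsmul f s)
      map_add' := fun s s' => by rw [fsmul_add, map_add]
      map_smul' := fun r s => by rw [fsmul_smul, map_smul, RingHom.id_apply] }
  refine h x ℓ' ⟨fun s => β (VBDef.fsmul f s), fun g s => ?_⟩
  change ℓ (VBDef.fsmul f (VBDef.fsmul g s)) = _
  rw [fsmul_fsmul, mul_comm, ← fsmul_fsmul, hβ]
  rfl

theorem unique [FiniteDimensional ℝ F] (h : HasExp a A B') (h' : HasExp a A' B'') :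
    A = A' ∧ B' = B'' := by
  constructor <;> ext x <;> refine eq_of_forall_dual (F := F) fun l => ?_
  · exact ((h.apply x l).unique (h'.apply x l)).1
  · exact ((h.apply x l).unique (h'.apply x l)).2

/-- Expansions can be glued. -/
theorem exists_of_local [FiniteDimensional ℝ EB] [T2Space B] [FiniteDimensional ℝ F]
    (h : ∀ x, ∃ (a' : ℝˣ → Sec IB F V) (A B' : Sec IB F V), HasExp a' A B' ∧
      ∀ᶠ y in 𝓝 x, ∀ t, a t y = a' t y) : ∃ A B', HasExp a A B' := by
  choose a' A B' h1 h2 using h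
  -- Uniqueness at each point makes the local coefficients agree near x, so their diagonal values
  -- form smooth sections.
  have key : ∀ x, ∀ᶠ y in 𝓝 x, A y y = A x y ∧ B' y y = B' x y := by
    intro x
    filter_upwards [h2 x] with y hy
    have hy' := (h2 y).self_of_nhds
    have e : ∀ l : V y →ₗ[ℝ] ℝ, l (A y y) = l (A x y) ∧ l (B' y y) = l (B' x y) := by
      intro l
      have h3 := (h1 y).apply y l
      have h4 := (h1 x).apply y l
      have e : ∀ t, a' x t y = a' y t y := fun t => (hy t).symm.trans (hy' t)
      simp only [e] at h4
      exact h3.unique h4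
    exact ⟨eq_of_forall_dual (F := F) fun l => (e l).1, eq_of_forall_dual (F := F) fun l => (e l).2⟩
  have hs : ∀ (C : B → Sec IB F V), (∀ x, ∀ᶠ y in 𝓝 x, C y y = C x y) →
      ContMDiff IB (IB.prod 𝓘(ℝ, F)) ∞ (fun x => TotalSpace.mk' F x (C x x)) := by
    intro C hC x
    refine ((C x).contMDiff x).congr_of_eventuallyEq ?_
    filter_upwards [hC x] with y hy
    rw [hy]
  refine ⟨⟨fun x => A x x, hs A fun x => (key x).mono fun y hy => hy.1⟩,
    ⟨fun x => B' x x, hs B' fun x => (key x).mono fun y hy => hy.2⟩, fun x ℓ hℓ => ?_⟩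
  have eA := hℓ.eq_of_eventuallyEq (s := ⟨fun x => A x x, hs A fun x => (key x).mono
    fun y hy => hy.1⟩) (s' := A x) ((key x).mono fun y hy => hy.1)
  have eB := hℓ.eq_of_eventuallyEq (s := ⟨fun x => B' x x, hs B' fun x => (key x).mono
    fun y hy => hy.2⟩) (s' := B' x) ((key x).mono fun y hy => hy.2)
  rw [eA, eB]
  have e : ∀ t, ℓ (a t) = ℓ (a' x t) := fun t =>
    hℓ.eq_of_eventuallyEq ((h2 x).mono fun y hy => hy t)
  simp only [e]
  exact h1 x x ℓ hℓ

end HasExp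

/-- On g s, a functional of order one sees g only through its value and its derivative along `β s`
at x, which is what `FunExp` controls. -/
theorem FunExp.fsmul {g : ℝˣ → C^∞⟮IB, B; ℝ⟯} {g₁ g₀ : C^∞⟮IB, B; ℝ⟯} (h : FunExp g g₁ g₀)
    (s : Sec IB F V) : HasExp (fun t => VBDef.fsmul (g t) s) (VBDef.fsmul g₁ s)
      (VBDef.fsmul g₀ s) := by
  rintro x ℓ ⟨β, hβ⟩
  simp only [hβ]
  refine ((h x).2 (β s)).add ?_
  simpa only [mul_comm] using (h x).1.const_mul (ℓ s)

theorem FunExp.pow_smul {g : ℝˣ → C^∞⟮IB, B; ℝ⟯} {g₁ g₀ : C^∞⟮IB, B; ℝ⟯} (h : FunExp g g₁ g₀) :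
    ∀ n : ℕ, ∃ g₁' g₀', FunExp (fun t => (t : ℝ) ^ n • g t) g₁' g₀'
  | 0 => ⟨g₁, g₀, by simpa using h⟩
  | n + 1 => by
    obtain ⟨A', B'', h'⟩ := pow_smul h n
    refine ⟨0, A', fun x => ⟨?_, fun v => ?_⟩⟩
    · have := (h' x).1.unit_mul
      refine Eq.mpr ?_ this
      congr 1
      funext t
      change (t : ℝ) ^ (n + 1) * g t x = t * (t ^ n * g t x)
      ring
    · have := ((h' x).2 v).unit_mul
      simp only [dirDeriv_const_smul] at this ⊢
      have e : dirDeriv (0 : C^∞⟮IB, B; ℝ⟯) x v = 0 :=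
        dirDeriv_of_eventually_eq_const (r := 0) (Eventually.of_forall fun _ => rfl) v
      rw [e]
      refine Eq.mpr ?_ this
      congr 1
      funext t
      ring

/-- The derivative of a function along a family of vector fields with an expansion. -/
theorem HasExp.vfApp {X : ℝˣ → VF IB B} {Y Z : VF IB B} (h : HasExp X Y Z)
    (f : C^∞⟮IB, B; ℝ⟯) :
    FunExp (fun t => VBDef.vfApp (X t) f) (VBDef.vfApp Y f) (VBDef.vfApp Z f) := by
  refine fun x => ⟨h.apply x (dirDeriv f x).toLinearMap, fun v => ?_⟩
  let ℓ : VF IB B →ₗ[ℝ] ℝ :=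
    { toFun := fun X => dirDeriv (VBDef.vfApp X f) x v
      map_add' := fun X X' => by
        rw [← dirDeriv_add]
        refine congrArg (fun g => dirDeriv g x v) (ContMDiffMap.ext fun y => ?_)
        exact map_add (dirDeriv f y) _ _
      map_smul' := fun r X => by
        rw [RingHom.id_apply, smul_eq_mul, ← dirDeriv_const_smul]
        refine congrArg (fun g => dirDeriv g x v) (ContMDiffMap.ext fun y => ?_)
        exact map_smul (dirDeriv f y) r _ }
  -- X ↦ v(Xf) is itself of order one in X: by the product rule v(gXf) = (Xf)(x) v(g) + g(x) v(Xf).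
  refine h x ℓ ⟨fun X => dirDeriv f x (X x) • v, fun g X => ?_⟩
  change dirDeriv (VBDef.vfApp (VBDef.fsmul g X) f) x v = _
  have e : VBDef.vfApp (VBDef.fsmul g X) f = g * VBDef.vfApp X f := by
    ext y
    simp
  rw [e, dirDeriv_mul, map_smul, vfApp_apply, smul_eq_mul, add_comm]
  rfl

end Expansions

/-! ### Smooth families of functions -/

/-- Differentiation with respect to a parameter, for mixed second derivatives. -/
theorem hasDerivAt_deriv_comm {H : ℝ × ℝ → ℝ} (hH : ContDiffAt ℝ 2 H (0, 0)) :
    HasDerivAt (fun t => deriv (fun s => H (t, s)) 0)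
      (deriv (fun s => deriv (fun t => H (t, s)) 0) 0) 0 := by
  have h1 : ∀ᶠ p in 𝓝 (0 : ℝ × ℝ), DifferentiableAt ℝ H p := by
    have := hH.eventually (by simp)
    filter_upwards [this] with p hp using hp.differentiableAt (by simp)
  have hc1 : Tendsto (fun t : ℝ => ((t, 0) : ℝ × ℝ)) (𝓝 0) (𝓝 0) := by
    have : Continuous (fun t : ℝ => ((t, 0) : ℝ × ℝ)) := by fun_prop
    exact this.tendsto' _ _ rfl
  have hc2 : Tendsto (fun t : ℝ => ((0, t) : ℝ × ℝ)) (𝓝 0) (𝓝 0) := by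
    have : Continuous (fun t : ℝ => ((0, t) : ℝ × ℝ)) := by fun_prop
    exact this.tendsto' _ _ rfl
  have hd1 : ∀ t : ℝ, HasDerivAt (fun t : ℝ => ((t, 0) : ℝ × ℝ)) (1, 0) t := fun t =>
    (hasDerivAt_id t).prodMk (hasDerivAt_const t 0)
  have hd2 : ∀ t : ℝ, HasDerivAt (fun t : ℝ => ((0, t) : ℝ × ℝ)) (0, 1) t := fun t =>
    (hasDerivAt_const t 0).prodMk (hasDerivAt_id t)
  have e1 : (fun t => deriv (fun s => H (t, s)) 0) =ᶠ[𝓝 0] fun t => fderiv ℝ H (t, 0) (0, 1) := by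
    filter_upwards [hc1.eventually h1] with t ht
    have : HasDerivAt (fun s : ℝ => ((t, s) : ℝ × ℝ)) (0, 1) 0 :=
      (hasDerivAt_const _ t).prodMk (hasDerivAt_id _)
    exact (ht.hasFDerivAt.comp_hasDerivAt (0 : ℝ) this).deriv
  have e2 : (fun s => deriv (fun t => H (t, s)) 0) =ᶠ[𝓝 0] fun s => fderiv ℝ H (0, s) (1, 0) := by
    filter_upwards [hc2.eventually h1] with s hs
    have : HasDerivAt (fun t : ℝ => ((t, s) : ℝ × ℝ)) (1, 0) 0 :=
      (hasDerivAt_id _).prodMk (hasDerivAt_const _ s)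
    exact (hs.hasFDerivAt.comp_hasDerivAt (0 : ℝ) this).deriv
  have hD : HasFDerivAt (fderiv ℝ H) (fderiv ℝ (fderiv ℝ H) (0, 0)) (0, 0) :=
    ((hH.fderiv_right (m := 1) (by norm_num)).differentiableAt (by simp)).hasFDerivAt
  -- Both iterated derivatives are values of the second derivative on the two basis vectors, in
  -- opposite orders.
  have hs : IsSymmSndFDerivAt ℝ H (0, 0) :=
    hH.isSymmSndFDerivAt (by rw [minSmoothness_of_isRCLikeNormedField])
  have h3 : HasDerivAt (fun t : ℝ => fderiv ℝ H (t, 0) (0, 1))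
      (fderiv ℝ (fderiv ℝ H) (0, 0) (1, 0) (0, 1)) 0 := by
    have := (hD.comp_hasDerivAt_of_eq (0 : ℝ) (hd1 0) rfl).clm_apply (hasDerivAt_const (0 : ℝ) ((0, 1) : ℝ × ℝ))
    simpa using this
  have h4 : HasDerivAt (fun s : ℝ => fderiv ℝ H (0, s) (1, 0))
      (fderiv ℝ (fderiv ℝ H) (0, 0) (0, 1) (1, 0)) 0 := by
    have := (hD.comp_hasDerivAt_of_eq (0 : ℝ) (hd2 0) rfl).clm_apply (hasDerivAt_const (0 : ℝ) ((1, 0) : ℝ × ℝ))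
    simpa using this
  rw [(h4.congr_of_eventuallyEq e2).deriv, hs]
  exact h3.congr_of_eventuallyEq e1

section SmoothFamilies

variable {EB : Type*} [NormedAddCommGroup EB] [NormedSpace ℝ EB]
  {HB : Type*} [TopologicalSpace HB] {IB : ModelWithCorners ℝ EB HB}
  {B : Type*} [TopologicalSpace B] [ChartedSpace HB B] [IsManifold IB ∞ B]

/-- Every tangent vector is the velocity of a curve. -/
theorem exists_curve [IB.Boundaryless] (x : B) (v : TangentSpace IB x) :
    ∃ γ : ℝ → B, γ 0 = x ∧ ContMDiffAt 𝓘(ℝ, ℝ) IB ∞ γ 0 ∧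
      ∀ f : C^∞⟮IB, B; ℝ⟯, dirDeriv f x v = deriv (f ∘ γ) 0 := by
  let φ := extChartAt IB x
  have hx : φ.symm (φ x) = x := extChartAt_to_inv x
  have hsm : ContMDiffAt 𝓘(ℝ, EB) IB ∞ φ.symm (φ x) :=
    (contMDiffOn_extChartAt_symm x).contMDiffAt (extChartAt_target_mem_nhds x)
  have hinv := isInvertible_mfderivWithin_extChartAt_symm (I := IB)
    (mem_extChartAt_target (I := IB) x)
  -- Without boundary the inverse chart is smooth on a full neighbourhood, so each tangent vector
  -- comes from a straight line in the model space.
  rw [IB.range_eq_univ, mfderivWithin_univ] at hinv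
  obtain ⟨v', hv'⟩ : ∃ v' : TangentSpace IB (φ.symm (φ x)), ∀ f : C^∞⟮IB, B; ℝ⟯,
      dirDeriv f x v = dirDeriv f (φ.symm (φ x)) v' := by
    rw [hx]
    exact ⟨v, fun f => rfl⟩
  obtain ⟨u, hu⟩ : ∃ u : EB, mfderiv 𝓘(ℝ, EB) IB φ.symm (φ x) u = v' := hinv.surjective v'
  let γ : ℝ → B := fun s => φ.symm (φ x + s • u)
  have hl : ContMDiff 𝓘(ℝ, ℝ) 𝓘(ℝ, EB) ∞ (fun s : ℝ => φ x + s • u) := by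
    rw [contMDiff_iff_contDiff]
    fun_prop
  have h0 : (fun s : ℝ => φ x + s • u) 0 = φ x := by simp
  have hγ : ContMDiffAt 𝓘(ℝ, ℝ) IB ∞ γ 0 := by
    refine ContMDiffAt.comp (I' := 𝓘(ℝ, EB)) (0 : ℝ) ?_ hl.contMDiffAt
    rwa [zero_smul, add_zero]
  have hγ0 : γ 0 = x := by simp only [γ]; rw [zero_smul, add_zero, hx]
  refine ⟨γ, hγ0, hγ, fun f => ?_⟩
  have hf : MDifferentiableAt IB 𝓘(ℝ, ℝ) f (φ.symm (φ x)) := f.mdifferentiableAt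
  have e1 : mfderiv 𝓘(ℝ, EB) 𝓘(ℝ, ℝ) (f ∘ φ.symm) (φ x) = (mfderiv IB 𝓘(ℝ, ℝ) f (φ.symm (φ x))).comp
      (mfderiv 𝓘(ℝ, EB) IB φ.symm (φ x)) :=
    mfderiv_comp _ hf (hsm.mdifferentiableAt (by simp))
  have hd : DifferentiableAt ℝ (f ∘ φ.symm) (φ x) := by
    have := hf.comp _ (hsm.mdifferentiableAt (by simp))
    exact mdifferentiableAt_iff_differentiableAt.1 this
  have hl' : HasDerivAt (fun s : ℝ => φ x + s • u) u 0 := by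
    simpa using ((hasDerivAt_id (0 : ℝ)).smul_const u).const_add (φ x)
  have e2 : HasDerivAt (f ∘ γ) (fderiv ℝ (f ∘ φ.symm) (φ x) u) 0 := by
    have := HasFDerivAt.comp_hasDerivAt_of_eq (0 : ℝ) hd.hasFDerivAt hl' h0.symm
    exact this
  rw [e2.deriv, ← mfderiv_eq_fderiv, e1]
  change _ = mfderiv IB 𝓘(ℝ, ℝ) f (φ.symm (φ x)) (mfderiv 𝓘(ℝ, EB) IB φ.symm (φ x) u)
  rw [hu, hv' f]
  rfl

/-- The derivative with respect to a parameter is smooth. -/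
theorem contMDiffAt_deriv_param {F' : Type*} [NormedAddCommGroup F'] [NormedSpace ℝ F']
    {G : ℝ × B → F'} {x : B} (hG : ContMDiffAt (𝓘(ℝ, ℝ).prod IB) 𝓘(ℝ, F') ∞ G (0, x)) :
    ContMDiffAt IB 𝓘(ℝ, F') ∞ (fun y => deriv (fun t => G (t, y)) 0) x := by
  have h1 : ContMDiffAt (IB.prod 𝓘(ℝ, ℝ)) 𝓘(ℝ, F') ∞ (uncurry fun (y : B) (t : ℝ) => G (t, y))
      (x, (0 : ℝ)) := by
    have : ContMDiffAt (IB.prod 𝓘(ℝ, ℝ)) (𝓘(ℝ, ℝ).prod IB) ∞ (Prod.swap : B × ℝ → ℝ × B)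
        (x, (0 : ℝ)) := contMDiffAt_snd.prodMk contMDiffAt_fst
    exact hG.comp (x, (0 : ℝ)) this
  have h2 := ContMDiffAt.mfderiv (fun (y : B) (t : ℝ) => G (t, y)) (fun _ => (0 : ℝ)) h1
    contMDiffAt_const (m := ∞) (by simp)
  have h3 : ContMDiffAt IB 𝓘(ℝ, ℝ →L[ℝ] F') ∞
      (fun y => fderiv ℝ (fun t => G (t, y)) 0) x := by
    refine h2.congr_of_eventuallyEq (Eventually.of_forall fun y => ?_)
    have := inTangentCoordinates_model_space (I := 𝓘(ℝ, ℝ)) (I' := 𝓘(ℝ, F')) (fun _ : B => (0 : ℝ))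
      (fun y => G (0, y)) (fun y => fderiv ℝ (fun t => G (t, y)) 0) x
    refine (congrFun this y).symm.trans ?_
    have e : (fun y => fderiv ℝ (fun t => G (t, y)) 0 : B → ℝ →L[ℝ] F') =
        fun y => mfderiv 𝓘(ℝ, ℝ) 𝓘(ℝ, F') (fun t => G (t, y)) 0 :=
      funext fun y => mfderiv_eq_fderiv.symm
    rw [e]
  exact h3.clm_apply (contMDiffAt_const (c := (1 : ℝ)))

/-- The expansion of `t⁻¹ G(t, ·)` for a smooth function `G`. -/
theorem exists_funExp [IB.Boundaryless] {G : ℝ × B → ℝ}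
    (hG : ContMDiff (𝓘(ℝ, ℝ).prod IB) 𝓘(ℝ, ℝ) ∞ G) (g : ℝˣ → C^∞⟮IB, B; ℝ⟯)
    (hg : ∀ t x, g t x = G (t, x)) : ∃ g₀ g₁, FunExp (fun t => (t : ℝ)⁻¹ • g t) g₀ g₁ := by
  have hsl : ∀ t : ℝ, ContMDiff IB 𝓘(ℝ, ℝ) ∞ (fun x => G (t, x)) := fun t =>
    hG.comp (contMDiff_const.prodMk contMDiff_id)
  -- Difference quotients: t⁻¹ p(t) - t⁻¹ p(0) tends to p'(0).
  have key : ∀ {p : ℝ → ℝ} {p' : ℝ}, HasDerivAt p p' 0 →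
      Exp0 (fun t => (t : ℝ)⁻¹ * p t) (p 0) p' := by
    intro p p' hp
    have h1 := hasDerivAt_iff_tendsto_slope.1 hp
    have h2 : Tendsto ((↑) : ℝˣ → ℝ) nzero (𝓝[≠] 0) :=
      tendsto_nhdsWithin_iff.2 ⟨tendsto_nzero, Eventually.of_forall fun t => t.ne_zero⟩
    refine (h1.comp h2).congr fun t => ?_
    simp only [comp_apply, slope_def_field, sub_zero]
    ring
  let g₀ : C^∞⟮IB, B; ℝ⟯ := ⟨fun x => G (0, x), hsl 0⟩
  let g₁ : C^∞⟮IB, B; ℝ⟯ := ⟨fun x => deriv (fun t => G (t, x)) 0,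
    fun x => contMDiffAt_deriv_param (hG _)⟩
  refine ⟨g₀, g₁, fun x => ⟨?_, fun v => ?_⟩⟩
  · have h1 : ContMDiff 𝓘(ℝ, ℝ) 𝓘(ℝ, ℝ) ∞ (fun t : ℝ => G (t, x)) :=
      hG.comp (contMDiff_id.prodMk contMDiff_const)
    rw [contMDiff_iff_contDiff] at h1
    have := key ((h1.differentiable (by simp)).differentiableAt (x := (0 : ℝ))).hasDerivAt
    refine Eq.mpr ?_ this
    congr 1
    funext t
    change (t : ℝ)⁻¹ * g t x = _
    rw [hg]
  -- Computing the derivative along v on a curve reduces its expansion to the exchange of two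
  -- derivatives on ℝ × ℝ.
  · obtain ⟨γ, h0, hγ, hd⟩ := exists_curve x v
    have hH : ContDiffAt ℝ 2 (fun p : ℝ × ℝ => G (p.1, γ p.2)) (0, 0) := by
      rw [← contMDiffAt_iff_contDiffAt, modelWithCornersSelf_prod, ← chartedSpaceSelf_prod]
      have h1 : ContMDiffAt (𝓘(ℝ, ℝ).prod 𝓘(ℝ, ℝ)) (𝓘(ℝ, ℝ).prod IB) ∞
          (fun p : ℝ × ℝ => (p.1, γ p.2)) ((0, 0) : ℝ × ℝ) :=
        contMDiffAt_fst.prodMk (ContMDiffAt.comp (I' := 𝓘(ℝ, ℝ)) ((0, 0) : ℝ × ℝ) hγ contMDiffAt_snd)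
      exact ((hG.contMDiffAt).comp ((0, 0) : ℝ × ℝ) h1).of_le
        (WithTop.coe_le_coe.2 (le_top (a := (2 : ℕ∞))))
    have := key (hasDerivAt_deriv_comm hH)
    have e : ∀ t : ℝˣ, (⇑(g t) ∘ γ) = fun s => G (t, γ s) := fun t => funext fun s => hg t _
    simp only [dirDeriv_const_smul]
    simp only [hd, e]
    exact this

end SmoothFamilies

/-! ### Scaling and addition in total spaces -/

section TotalSpaces

variable {EB : Type*} [NormedAddCommGroup EB] [NormedSpace ℝ EB]
  {HB : Type*} [TopologicalSpace HB] {IB : ModelWithCorners ℝ EB HB}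
  {B : Type*} [TopologicalSpace B] [ChartedSpace HB B]
  {F : Type*} [NormedAddCommGroup F] [NormedSpace ℝ F]
  {V : B → Type*} [TopologicalSpace (TotalSpace F V)]
  [∀ x, AddCommGroup (V x)] [∀ x, Module ℝ (V x)] [∀ x, TopologicalSpace (V x)]
  [FiberBundle F V] [VectorBundle ℝ F V]
  {EN : Type*} [NormedAddCommGroup EN] [NormedSpace ℝ EN]
  {HN : Type*} [TopologicalSpace HN] {IN : ModelWithCorners ℝ EN HN}
  {N : Type*} [TopologicalSpace N] [ChartedSpace HN N]

@[simp] theorem proj_scale (t : ℝ) (x : TotalSpace F V) : (scale t x).proj = x.proj := rfl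

theorem scale_scale (s t : ℝ) (x : TotalSpace F V) : scale s (scale t x) = scale (s * t) x :=
  congrArg (TotalSpace.mk x.proj) (smul_smul s t x.snd)

@[simp] theorem scale_one (x : TotalSpace F V) : scale 1 x = x :=
  congrArg (TotalSpace.mk x.proj) (one_smul ℝ x.snd)

theorem scale_zero (x : TotalSpace F V) : scale 0 x = ⟨x.proj, 0⟩ :=
  congrArg (TotalSpace.mk x.proj) (zero_smul ℝ x.snd)

@[simp] theorem scale_mk_zero (t : ℝ) (b : B) :
    scale t (⟨b, 0⟩ : TotalSpace F V) = ⟨b, 0⟩ :=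
  congrArg (TotalSpace.mk b) (smul_zero t)

theorem IsSum.proj_left {x y z : TotalSpace F V} (h : IsSum x y z) : z.proj = x.proj := by
  obtain ⟨b, u, v, rfl, rfl, rfl⟩ := h
  rfl

theorem IsSum.proj_right {x y z : TotalSpace F V} (h : IsSum x y z) : z.proj = y.proj := by
  obtain ⟨b, u, v, rfl, rfl, rfl⟩ := h
  rfl

theorem IsSum.unique {x y z z' : TotalSpace F V} (h : IsSum x y z) (h' : IsSum x y z') :
    z = z' := by
  obtain ⟨b, u, v, rfl, rfl, rfl⟩ := h
  obtain ⟨b', u', v', h1, h2, rfl⟩ := h'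
  cases h1
  cases h2
  rfl

theorem exists_isSum {x y : TotalSpace F V} (h : x.proj = y.proj) : ∃ z, IsSum x y z := by
  obtain ⟨b, u⟩ := x
  obtain ⟨b', v⟩ := y
  obtain rfl : b = b' := h
  exact ⟨⟨b, u + v⟩, b, u, v, rfl, rfl, rfl⟩

theorem IsSum.scale (t : ℝ) {x y z : TotalSpace F V} (h : IsSum x y z) :
    IsSum (VBDef.scale t x) (VBDef.scale t y) (VBDef.scale t z) := by
  obtain ⟨b, u, v, rfl, rfl, rfl⟩ := h
  exact ⟨b, t • u, t • v, rfl, rfl, congrArg (TotalSpace.mk b) (smul_add t u v)⟩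

theorem isSum_zero_left (x : TotalSpace F V) : IsSum ⟨x.proj, 0⟩ x x :=
  ⟨x.proj, 0, x.snd, rfl, rfl, congrArg (TotalSpace.mk x.proj) (zero_add x.snd).symm⟩

theorem isSum_zero_right (x : TotalSpace F V) : IsSum x ⟨x.proj, 0⟩ x :=
  ⟨x.proj, x.snd, 0, rfl, rfl, congrArg (TotalSpace.mk x.proj) (add_zero x.snd).symm⟩

section Coordinates

variable (e : Trivialization F (TotalSpace.proj : TotalSpace F V → B)) [e.IsLinear ℝ]

theorem snd_scale (t : ℝ) {x : TotalSpace F V} (hx : x.proj ∈ e.baseSet) :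
    (e (scale t x)).2 = t • (e x).2 :=
  (e.linear ℝ hx).2 t x.snd

theorem snd_isSum {x y z : TotalSpace F V} (h : IsSum x y z) (hx : x.proj ∈ e.baseSet) :
    (e z).2 = (e x).2 + (e y).2 := by
  obtain ⟨b, u, v, rfl, rfl, rfl⟩ := h
  exact (e.linear ℝ hx).1 u v

end Coordinates

/-- If the neighbourhood filters of two points meet, the base points agree because B is Hausdorff;
then both points lie in one trivialization and have equal fibre coordinates. -/
theorem t2Space_totalSpace (F : Type*) [NormedAddCommGroup F] [NormedSpace ℝ F]
    (V : B → Type*) [TopologicalSpace (TotalSpace F V)]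
    [∀ x, AddCommGroup (V x)] [∀ x, Module ℝ (V x)] [∀ x, TopologicalSpace (V x)]
    [FiberBundle F V] [VectorBundle ℝ F V] [T2Space B] : T2Space (TotalSpace F V) := by
  rw [t2_iff_nhds]
  intro x y hxy
  have hx : Tendsto id (𝓝 x ⊓ 𝓝 y) (𝓝 x) := inf_le_left
  have hy : Tendsto id (𝓝 x ⊓ 𝓝 y) (𝓝 y) := inf_le_right
  let e := trivializationAt F V x.proj
  have hxe : x ∈ e.source := e.mem_source.2 (mem_baseSet_trivializationAt F V x.proj)
  have hp : x.proj = y.proj := tendsto_nhds_unique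
    (((FiberBundle.continuous_proj F V).tendsto x).comp hx)
    (((FiberBundle.continuous_proj F V).tendsto y).comp hy)
  have hye : y ∈ e.source := by
    rw [e.mem_source, ← hp]
    exact mem_baseSet_trivializationAt F V x.proj
  have h2 := tendsto_nhds_unique ((e.tendsto_nhds_iff hxe).1 hx).2 ((e.tendsto_nhds_iff hye).1 hy).2
  refine e.injOn hxe hye ?_
  refine Prod.ext ?_ h2
  rw [e.coe_coe, e.coe_fst hxe, e.coe_fst hye, hp]

theorem eventually_proj_mem {f : N → TotalSpace F V} {n : N} (hf : ContinuousAt f n) :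
    ∀ᶠ n' in 𝓝 n, (f n').proj ∈ (trivializationAt F V (f n).proj).baseSet :=
  ((FiberBundle.continuous_proj F V).continuousAt.comp hf)
    ((trivializationAt F V (f n).proj).open_baseSet.mem_nhds
      (mem_baseSet_trivializationAt F V (f n).proj))

theorem contMDiffAt_scale {t : N → ℝ} {f : N → TotalSpace F V} {n : N}
    (ht : ContMDiffAt IN 𝓘(ℝ, ℝ) ∞ t n) (hf : ContMDiffAt IN (IB.prod 𝓘(ℝ, F)) ∞ f n) :
    ContMDiffAt IN (IB.prod 𝓘(ℝ, F)) ∞ (fun n => scale (t n) (f n)) n := by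
  rw [contMDiffAt_totalSpace]
  have h := contMDiffAt_totalSpace.1 hf
  refine ⟨h.1, (ht.smul h.2).congr_of_eventuallyEq ?_⟩
  filter_upwards [eventually_proj_mem hf.continuousAt] with n' hn'
  exact snd_scale _ _ hn'

theorem contMDiff_isSum {f g k : N → TotalSpace F V} (hf : ContMDiff IN (IB.prod 𝓘(ℝ, F)) ∞ f)
    (hg : ContMDiff IN (IB.prod 𝓘(ℝ, F)) ∞ g) (h : ∀ n, IsSum (f n) (g n) (k n)) :
    ContMDiff IN (IB.prod 𝓘(ℝ, F)) ∞ k := by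
  intro n
  rw [contMDiffAt_totalSpace]
  have hf' := contMDiffAt_totalSpace.1 (hf n)
  have hg' := contMDiffAt_totalSpace.1 (hg n)
  rw [← (h n).proj_right, (h n).proj_left] at hg'
  rw [(h n).proj_left]
  refine ⟨hf'.1.congr_of_eventuallyEq (Eventually.of_forall fun n' => (h n').proj_left),
    (hf'.2.add hg'.2).congr_of_eventuallyEq ?_⟩
  filter_upwards [eventually_proj_mem (hf n).continuousAt] with n' hn'
  exact snd_isSum _ (h n') hn'

theorem continuous_scale : Continuous (fun p : ℝ × TotalSpace F V => scale p.1 p.2) := by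
  rw [continuous_iff_continuousAt]
  rintro ⟨t, x⟩
  let e := trivializationAt F V x.proj
  have hx : x.proj ∈ e.baseSet := mem_baseSet_trivializationAt F V x.proj
  have hs : scale t x ∈ e.source := e.mem_source.2 hx
  refine (e.tendsto_nhds_iff hs).2 ⟨?_, ?_⟩
  · exact ((FiberBundle.continuous_proj F V).comp continuous_snd).tendsto (t, x)
  · rw [snd_scale e t hx]
    have h1 : Tendsto (fun p : ℝ × TotalSpace F V => (e p.2).2) (𝓝 (t, x)) (𝓝 (e x).2) :=
      ((e.tendsto_nhds_iff (f := id) (e.mem_source.2 hx)).1 tendsto_id).2.comp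
        (continuous_snd.tendsto (t, x))
    have h2 := (continuous_fst.tendsto ((t, x) : ℝ × TotalSpace F V)).smul h1
    refine h2.congr' ?_
    have h3 : ∀ᶠ y in 𝓝 x, y.proj ∈ e.baseSet :=
      eventually_proj_mem (V := V) (f := id) continuousAt_id
    filter_upwards [(continuous_snd.tendsto (t, x)).eventually h3] with p hp
    exact (snd_scale e p.1 hp).symm

/-- If a smooth family `y(t)` consists of zero vectors at `t = 0`, then `t⁻¹ y(t)` converges and
the limit depends smoothly on the parameters. -/
theorem exists_tendsto_inv_scale [IsManifold IB ∞ B] [T2Space B] [ContMDiffVectorBundle ∞ F V IB]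
    [IsManifold IN ∞ N] {y : ℝ × N → TotalSpace F V}
    (hy : ContMDiff (𝓘(ℝ, ℝ).prod IN) (IB.prod 𝓘(ℝ, F)) ∞ y)
    (h0 : ∀ n, y (0, n) = ⟨(y (0, n)).proj, 0⟩) :
    ∃ z : N → TotalSpace F V, ContMDiff IN (IB.prod 𝓘(ℝ, F)) ∞ z ∧
      ∀ n, Tendsto (fun t : ℝˣ => scale (t : ℝ)⁻¹ (y (t, n))) nzero (𝓝 (z n)) := by
  have : T2Space (TotalSpace F V) := t2Space_totalSpace F V
  have hsec : ∀ n, ContMDiff 𝓘(ℝ, ℝ) (IB.prod 𝓘(ℝ, F)) ∞ (fun t : ℝ => y (t, n)) := fun n =>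
    hy.comp (contMDiff_id.prodMk contMDiff_const)
  have hbase : ContMDiff IN IB ∞ (fun n => (y (0, n)).proj) :=
    (contMDiff_proj V).comp (hy.comp (contMDiff_const.prodMk contMDiff_id))
  -- In a trivialization the limit is the t-derivative of the fibre coordinate at 0. Fixing the
  -- trivialization at `n₀` gives smoothness near `n₀`; uniqueness of limits shows independence of
  -- this choice.
  let ζ : N → N → TotalSpace F V := fun n₀ n =>
    (trivializationAt F V (y (0, n₀)).proj).toOpenPartialHomeomorph.symm
      ((y (0, n)).proj, deriv (fun t => (trivializationAt F V (y (0, n₀)).proj (y (t, n))).2) 0)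
  have hζ : ∀ n₀ n, (y (0, n)).proj ∈ (trivializationAt F V (y (0, n₀)).proj).baseSet →
      Tendsto (fun t : ℝˣ => scale (t : ℝ)⁻¹ (y (t, n))) nzero (𝓝 (ζ n₀ n)) := by
    intro n₀ n hb
    let e := trivializationAt F V (y (0, n₀)).proj
    have hmem : ((y (0, n)).proj, deriv (fun t => (e (y (t, n))).2) 0) ∈ e.target :=
      e.mem_target.2 hb
    refine (e.tendsto_nhds_iff (e.map_target hmem)).2 ⟨?_, ?_⟩
    · rw [e.proj_symm_apply hmem]
      exact (((FiberBundle.continuous_proj F V).comp (hsec n).continuous).tendsto 0).comp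
        tendsto_nzero
    · rw [e.apply_symm_apply hmem]
      have h1 : ContMDiffAt 𝓘(ℝ, ℝ) 𝓘(ℝ, F) ∞ (fun t : ℝ => (e (y (t, n))).2) 0 :=
        ((e.contMDiffAt_iff (f := fun t : ℝ => y (t, n)) (e.mem_source.2 hb)).1 (hsec n 0)).2
      have h2 := ((contMDiffAt_iff_contDiffAt.1 h1).differentiableAt (by simp)).hasDerivAt
      have h3 := hasDerivAt_iff_tendsto_slope.1 h2
      have h4 : Tendsto ((↑) : ℝˣ → ℝ) nzero (𝓝[≠] 0) :=
        tendsto_nhdsWithin_iff.2 ⟨tendsto_nzero, Eventually.of_forall fun t => t.ne_zero⟩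
      refine (h3.comp h4).congr' ?_
      have h5 : ∀ᶠ t in 𝓝 (0 : ℝ), (y (t, n)).proj ∈ e.baseSet :=
        (((FiberBundle.continuous_proj F V).comp (hsec n).continuous).tendsto 0)
          (e.open_baseSet.mem_nhds hb)
      have h6 : (e (y (0, n))).2 = 0 := by
        have := snd_scale e 0 hb
        rw [scale_zero, ← h0 n, zero_smul] at this
        exact this
      filter_upwards [tendsto_nzero.eventually h5] with t ht
      simp only [comp_apply, slope_def_module, h6, sub_zero]
      exact (snd_scale e _ ht).symm
  refine ⟨fun n => ζ n n, fun n₀ => ?_, fun n => hζ n n (mem_baseSet_trivializationAt F V _)⟩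
  let e := trivializationAt F V (y (0, n₀)).proj
  have hb₀ : (y (0, n₀)).proj ∈ e.baseSet := mem_baseSet_trivializationAt F V _
  have hev : ∀ᶠ n in 𝓝 n₀, (y (0, n)).proj ∈ e.baseSet :=
    hbase.continuous.continuousAt (e.open_baseSet.mem_nhds hb₀)
  have heq : (fun n => ζ n n) =ᶠ[𝓝 n₀] ζ n₀ := by
    filter_upwards [hev] with n hn
    exact tendsto_nhds_unique (hζ n n (mem_baseSet_trivializationAt F V _)) (hζ n₀ n hn)
  refine ContMDiffAt.congr_of_eventuallyEq ?_ heq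
  have hd : ContMDiffAt IN 𝓘(ℝ, F) ∞ (fun n => deriv (fun t => (e (y (t, n))).2) 0) n₀ :=
    contMDiffAt_deriv_param (G := fun p => (e (y p)).2)
      ((e.contMDiffAt_iff (e.mem_source.2 hb₀)).1 (hy (0, n₀))).2
  have hmem : ((y (0, n₀)).proj, deriv (fun t => (e (y (t, n₀))).2) 0) ∈ e.target :=
    e.mem_target.2 hb₀
  have hsym : ContMDiffAt (IB.prod 𝓘(ℝ, F)) (IB.prod 𝓘(ℝ, F)) ∞ e.toOpenPartialHomeomorph.symm
      ((y (0, n₀)).proj, deriv (fun t => (e (y (t, n₀))).2) 0) :=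
    e.contMDiffOn_symm.contMDiffAt (e.open_target.mem_nhds hmem)
  exact hsym.comp n₀ ((hbase n₀).prodMk hd)

end TotalSpaces

/-! ### Linear and core sections of a double vector bundle -/

theorem sec_ext_mk {EB : Type*} [NormedAddCommGroup EB] [NormedSpace ℝ EB]
    {HB : Type*} [TopologicalSpace HB] {IB : ModelWithCorners ℝ EB HB}
    {B : Type*} [TopologicalSpace B] [ChartedSpace HB B]
    {F : Type*} [NormedAddCommGroup F] [NormedSpace ℝ F]
    {V : B → Type*} [TopologicalSpace (TotalSpace F V)]
    [∀ x, AddCommGroup (V x)] [∀ x, Module ℝ (V x)] [∀ x, TopologicalSpace (V x)]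
    [FiberBundle F V] [VectorBundle ℝ F V] {s s' : Sec IB F V}
    (h : ∀ x, (⟨x, s x⟩ : TotalSpace F V) = ⟨x, s' x⟩) : s = s' := by
  ext x
  exact TotalSpace.mk_inj.1 (h x)

/-- A positively homogeneous map that is differentiable at the origin is linear. -/
theorem eq_fderiv_of_homogeneous {E E' : Type*} [NormedAddCommGroup E] [NormedSpace ℝ E]
    [NormedAddCommGroup E'] [NormedSpace ℝ E'] {g : E → E'} (hg : DifferentiableAt ℝ g 0)
    (h : ∀ (t : ℝ) x, g (t • x) = t • g x) (x : E) : g x = fderiv ℝ g 0 x := by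
  have h1 : HasDerivAt (fun t : ℝ => t • x) x 0 := by
    simpa using (hasDerivAt_id (0 : ℝ)).smul_const x
  have h2 := hg.hasFDerivAt.comp_hasDerivAt_of_eq (0 : ℝ) h1 (by simp)
  have h3 : HasDerivAt (fun t : ℝ => t • g x) (g x) 0 := by
    simpa using (hasDerivAt_id (0 : ℝ)).smul_const (g x)
  have e : (g ∘ fun t : ℝ => t • x) = fun t => t • g x := funext fun t => h t x
  rw [e] at h2
  exact h3.unique h2

section Double

variable {EM : Type*} [NormedAddCommGroup EM] [NormedSpace ℝ EM]
  {HM : Type*} [TopologicalSpace HM] {IM : ModelWithCorners ℝ EM HM}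
  {M : Type*} [TopologicalSpace M] [ChartedSpace HM M] [IsManifold IM ∞ M]
  {FE : Type*} [NormedAddCommGroup FE] [NormedSpace ℝ FE]
  {VE : M → Type*} [TopologicalSpace (TotalSpace FE VE)]
  [∀ x, AddCommGroup (VE x)] [∀ x, Module ℝ (VE x)] [∀ x, TopologicalSpace (VE x)]
  [FiberBundle FE VE] [VectorBundle ℝ FE VE] [ContMDiffVectorBundle ∞ FE VE IM]
  {FA : Type*} [NormedAddCommGroup FA] [NormedSpace ℝ FA]
  {VA : M → Type*} [TopologicalSpace (TotalSpace FA VA)]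
  [∀ x, AddCommGroup (VA x)] [∀ x, Module ℝ (VA x)] [∀ x, TopologicalSpace (VA x)]
  [FiberBundle FA VA] [VectorBundle ℝ FA VA] [ContMDiffVectorBundle ∞ FA VA IM]
  {FW : Type*} [NormedAddCommGroup FW] [NormedSpace ℝ FW]
  {VW : TotalSpace FE VE → Type*} [TopologicalSpace (TotalSpace FW VW)]
  [∀ x, AddCommGroup (VW x)] [∀ x, Module ℝ (VW x)] [∀ x, TopologicalSpace (VW x)]
  [FiberBundle FW VW] [VectorBundle ℝ FW VW]
  [ContMDiffVectorBundle ∞ FW VW (IM.prod 𝓘(ℝ, FE))]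
  {FU : Type*} [NormedAddCommGroup FU] [NormedSpace ℝ FU]
  {VU : TotalSpace FA VA → Type*} [TopologicalSpace (TotalSpace FU VU)]
  [∀ x, AddCommGroup (VU x)] [∀ x, Module ℝ (VU x)] [∀ x, TopologicalSpace (VU x)]
  [FiberBundle FU VU] [VectorBundle ℝ FU VU]
  [ContMDiffVectorBundle ∞ FU VU (IM.prod 𝓘(ℝ, FA))]

/-- The pull-back of a function on `E` by scalar multiplication. -/
def pullFun (t : ℝ) (f : C^∞⟮IM.prod 𝓘(ℝ, FE), TotalSpace FE VE; ℝ⟯) :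
    C^∞⟮IM.prod 𝓘(ℝ, FE), TotalSpace FE VE; ℝ⟯ :=
  ⟨fun e => f (scale t e), f.contMDiff.comp (contMDiff_scale IM t)⟩

@[simp] theorem pullFun_apply (t : ℝ) (f : C^∞⟮IM.prod 𝓘(ℝ, FE), TotalSpace FE VE; ℝ⟯)
    (e : TotalSpace FE VE) : pullFun t f e = f (scale t e) := rfl

theorem pullFun_pullFun_inv (t : ℝˣ) (f : C^∞⟮IM.prod 𝓘(ℝ, FE), TotalSpace FE VE; ℝ⟯) :
    pullFun (t : ℝ) (pullFun ((t⁻¹ : ℝˣ) : ℝ) f) = f := by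
  ext e
  simp [scale_scale]

namespace DoubleVectorBundle

variable (D : DoubleVectorBundle IM FE VE FA VA FW VW FU VU)

theorem proj_h (t : ℝ) (w : TotalSpace FW VW) : (D.h t w).proj = scale t w.proj :=
  D.smul_cover t w

theorem Φ_h (t : ℝ) (w : TotalSpace FW VW) : D.Φ (D.h t w) = scale t (D.Φ w) :=
  D.Φ.apply_symm_apply _

theorem Φ_injective : Injective D.Φ := D.Φ.injective

theorem h_h (s t : ℝ) (w : TotalSpace FW VW) : D.h s (D.h t w) = D.h (s * t) w := by
  apply D.Φ_injective
  rw [Φ_h, Φ_h, Φ_h, scale_scale]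

theorem h_one (w : TotalSpace FW VW) : D.h 1 w = w := by
  apply D.Φ_injective
  rw [Φ_h, scale_one]

theorem h_scale (t r : ℝ) (w : TotalSpace FW VW) : D.h t (scale r w) = scale r (D.h t w) :=
  D.smul_smul t r w

/-- A map that commutes with fibrewise scaling by 0 sends zero vectors to zero vectors. -/
theorem h_mk_zero (t : ℝ) (e : TotalSpace FE VE) :
    D.h t (⟨e, 0⟩ : TotalSpace FW VW) = ⟨scale t e, 0⟩ := by
  have h1 := D.h_scale t 0 ⟨e, 0⟩
  rw [scale_mk_zero, scale_zero] at h1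
  rw [h1]
  exact congrArg (fun b => (⟨b, 0⟩ : TotalSpace FW VW)) (D.proj_h t ⟨e, 0⟩)

theorem Φ_mk_zero_proj (e : TotalSpace FE VE) :
    (D.Φ (⟨e, 0⟩ : TotalSpace FW VW)).proj = ⟨e.proj, 0⟩ := by
  have h1 := D.proj_smul 0 (⟨e, 0⟩ : TotalSpace FW VW)
  rw [scale_mk_zero, scale_zero] at h1
  rw [h1]
  exact congrArg (fun b => (⟨b, 0⟩ : TotalSpace FA VA)) (D.proj_comm ⟨e, 0⟩)

/-- The zero vectors over the zero vectors of `E` and of `A` agree. -/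
theorem Φ_zero_zero (m : M) : D.Φ (⟨⟨m, 0⟩, 0⟩ : TotalSpace FW VW) = ⟨⟨m, 0⟩, 0⟩ := by
  have h1 := D.zero_smul 0 (⟨m, 0⟩ : TotalSpace FA VA)
  rw [scale_mk_zero, scale_zero] at h1
  rw [← D.Φ.apply_symm_apply (⟨⟨m, 0⟩, 0⟩ : TotalSpace FU VU)]
  refine congrArg D.Φ ?_
  change _ = D.Φ.symm _
  rw [h1]
  exact congrArg (fun b => (⟨b, 0⟩ : TotalSpace FW VW)) (D.zero_cover (⟨m, 0⟩ : TotalSpace FA VA)).symm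

theorem pullSec_pullSec (s t : ℝˣ) (w : Sec (IM.prod 𝓘(ℝ, FE)) FW VW) :
    D.pullSec s (D.pullSec t w) = D.pullSec (s * t) w := by
  refine sec_ext_mk fun e => ?_
  rw [mk_pullSec, mk_pullSec, mk_pullSec, h_h, scale_scale, mul_comm (t : ℝ), mul_inv,
    Units.val_mul, Units.val_mul]

theorem pullSec_one (w : Sec (IM.prod 𝓘(ℝ, FE)) FW VW) : D.pullSec 1 w = w := by
  refine sec_ext_mk fun e => ?_
  rw [mk_pullSec, inv_one, Units.val_one, h_one, scale_one]

theorem pullSec_pullSec_inv (t : ℝˣ) (w : Sec (IM.prod 𝓘(ℝ, FE)) FW VW) :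
    D.pullSec t (D.pullSec t⁻¹ w) = w := by
  rw [pullSec_pullSec, mul_inv_cancel, pullSec_one]

theorem pullSec_fsmul (t : ℝˣ) (f : C^∞⟮IM.prod 𝓘(ℝ, FE), TotalSpace FE VE; ℝ⟯)
    (w : Sec (IM.prod 𝓘(ℝ, FE)) FW VW) :
    D.pullSec t (fsmul f w) = fsmul (pullFun t f) (D.pullSec t w) := by
  refine sec_ext_mk fun e => ?_
  have h1 := congrArg (scale (f (scale (t : ℝ) e))) (D.mk_pullSec t w e)
  rw [mk_pullSec]
  exact (D.h_scale _ (f (scale (t : ℝ) e)) _).trans h1.symm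

/-- The pull-back of sections as a linear map. -/
def pullSecₗ (t : ℝˣ) : Sec (IM.prod 𝓘(ℝ, FE)) FW VW →ₗ[ℝ] Sec (IM.prod 𝓘(ℝ, FE)) FW VW where
  toFun := D.pullSec t
  map_add' := D.pullSec_add t
  map_smul' := D.pullSec_smul t

theorem pullSec_apply_eq_zero {t : ℝˣ} {w : Sec (IM.prod 𝓘(ℝ, FE)) FW VW} {e : TotalSpace FE VE} :
    D.pullSec t w e = 0 ↔ w (scale (t : ℝ) e) = 0 := by
  have h1 := D.mk_pullSec t w e
  constructor
  · intro h
    rw [h] at h1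
    have h2 := congrArg (D.h t) h1
    rw [h_h, Units.mul_inv, h_one, h_mk_zero] at h2
    exact TotalSpace.mk_inj.1 h2.symm
  · intro h
    rw [h, h_mk_zero, scale_inv_scale] at h1
    exact TotalSpace.mk_inj.1 h1

/-- On the core the two scalar multiplications agree. -/
theorem h_core (t : ℝ) {χ : TotalSpace FW VW} {m : M} (h1 : χ.proj = ⟨m, 0⟩)
    (h2 : (D.Φ χ).proj = ⟨m, 0⟩) : D.h t χ = scale t χ := by
  let e := trivializationAt FU VU (⟨m, 0⟩ : TotalSpace FA VA)
  have hm : (⟨m, 0⟩ : TotalSpace FA VA) ∈ e.baseSet := mem_baseSet_trivializationAt FU VU _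
  have hp : ∀ r : ℝ, (D.Φ (scale r χ)).proj = ⟨m, 0⟩ := fun r => by
    rw [D.proj_smul, h2, scale_mk_zero]
  -- Interchange law: adding, over E, the identities rχ +_A 0 = rχ and 0 +_A sχ = sχ shows that rχ
  -- +_A sχ is their sum over E, namely (r + s)χ.
  have hsum : ∀ r s : ℝ, IsSum (D.Φ (scale r χ)) (D.Φ (scale s χ)) (D.Φ (scale (r + s) χ)) := by
    intro r s
    have hz : ∀ r : ℝ, (⟨(D.Φ (scale r χ)).proj, 0⟩ : TotalSpace FU VU) =
        D.Φ (⟨⟨m, 0⟩, 0⟩ : TotalSpace FW VW) := fun r => by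
      rw [Φ_zero_zero]
      exact congrArg (fun b => (⟨b, 0⟩ : TotalSpace FU VU)) (hp r)
    have hz' : ∀ r : ℝ, (⟨(scale r χ).proj, 0⟩ : TotalSpace FW VW) = ⟨⟨m, 0⟩, 0⟩ := fun r =>
      congrArg (fun b => (⟨b, 0⟩ : TotalSpace FW VW)) h1
    have a1 := isSum_zero_right (D.Φ (scale r χ))
    have a2 := isSum_zero_left (D.Φ (scale s χ))
    have a3 := isSum_zero_right (scale r χ)
    have a4 := isSum_zero_left (scale s χ)
    rw [hz] at a1 a2
    rw [hz'] at a3 a4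
    refine D.add_add _ _ _ _ _ _ _ _ _ a1 a2 a3 a4 ?_
    exact ⟨χ.proj, r • χ.snd, s • χ.snd, rfl, rfl,
      congrArg (TotalSpace.mk χ.proj) (_root_.add_smul r s χ.snd)⟩
  let f : ℝ →+ FU :=
    AddMonoidHom.mk' (fun r => (e (D.Φ (scale r χ))).2) fun r s =>
      snd_isSum e (hsum r s) (by rw [hp]; exact hm)
  have hf : Continuous f := by
    have hc : Continuous fun r : ℝ => D.Φ (scale r χ) :=
      D.Φ.continuous.comp (continuous_scale.comp (by fun_prop : Continuous fun r : ℝ => (r, χ)))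
    refine continuous_iff_continuousAt.2 fun r => ?_
    exact ((e.tendsto_nhds_iff (e.mem_source.2 (by rw [hp]; exact hm))).1 (hc.tendsto r)).2
  -- A continuous additive map is linear over the reals.
  have h3 : f (t • 1) = t • f 1 := map_real_smul f hf t 1
  have h4 : (e (D.Φ (scale t χ))).2 = (e (scale t (D.Φ χ))).2 := by
    rw [snd_scale e t (by rw [h2]; exact hm)]
    have h5 : f 1 = (e (D.Φ χ)).2 := by
      change (e (D.Φ (scale 1 χ))).2 = _
      rw [scale_one]
    rw [← h5, ← h3, smul_eq_mul, mul_one]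
    rfl
  have hs1 : D.Φ (scale t χ) ∈ e.source := e.mem_source.2 (by rw [hp]; exact hm)
  have hs2 : scale t (D.Φ χ) ∈ e.source := e.mem_source.2 (by rw [proj_scale, h2]; exact hm)
  apply D.Φ_injective
  rw [Φ_h]
  refine e.injOn hs2 hs1 (Prod.ext ?_ h4.symm)
  rw [e.coe_coe, e.coe_fst hs1, e.coe_fst hs2, hp, proj_scale, h2]

variable {D} in
-- Over A, scaling 0_{te} +_A χ by t⁻¹ gives 0_e +_A t⁻¹χ; over E, scaling 0_e +_A χ by t⁻¹ gives
-- the same point. That t⁻¹χ is unambiguous is `h_core`.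
theorem IsCoreSec.pullSec_eq {w : Sec (IM.prod 𝓘(ℝ, FE)) FW VW} (hw : D.IsCoreSec w) (t : ℝˣ) :
    D.pullSec t w = (t : ℝ)⁻¹ • w := by
  obtain ⟨χ, -, h1, h2⟩ := hw
  refine sec_ext_mk fun e => ?_
  apply D.Φ_injective
  have h3 := (h2 (scale (t : ℝ) e)).scale (t : ℝ)⁻¹
  rw [← Φ_h, ← Φ_h, h_mk_zero, proj_scale, D.h_core _ (h1 _).1 (h1 _).2, ← Φ_h, scale_scale,
    inv_mul_cancel₀ t.ne_zero, scale_one] at h3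
  have h4 := D.add_smul (t : ℝ)⁻¹ _ _ _ (h2 e)
  rw [scale_mk_zero] at h4
  have h5 := h3.unique h4
  rw [mk_pullSec, Units.val_inv_eq_inv_val]
  exact h5

variable {D} in
theorem IsLinearSec.pullSec_eq {w : Sec (IM.prod 𝓘(ℝ, FE)) FW VW} (hw : D.IsLinearSec w)
    (t : ℝˣ) : D.pullSec t w = w := by
  obtain ⟨α, hα⟩ := hw
  refine sec_ext_mk fun e => ?_
  apply D.Φ_injective
  obtain ⟨m, v⟩ := e
  obtain ⟨l, hl⟩ := hα m
  rw [mk_pullSec, Φ_h]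
  have h1 := hl ((t : ℝ) • v)
  have h2 : (scale (t : ℝ) (⟨m, v⟩ : TotalSpace FE VE)) = ⟨m, (t : ℝ) • v⟩ := rfl
  rw [h2, h1, hl]
  refine congrArg (TotalSpace.mk _) ?_
  rw [map_smul]
  exact inv_smul_smul t (l v)

/-- Sections of weight zero are linear. -/
theorem isLinearSec_of_pullSec_eq [T2Space M] {w : Sec (IM.prod 𝓘(ℝ, FE)) FW VW}
    (hw : ∀ t : ℝˣ, D.pullSec t w = w) : D.IsLinearSec w := by
  have : T2Space (TotalSpace FA VA) := t2Space_totalSpace FA VA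
  have : T2Space (TotalSpace FU VU) := t2Space_totalSpace FU VU
  let y : TotalSpace FE VE → TotalSpace FU VU := fun e => D.Φ ⟨e, w e⟩
  have hy : ContMDiff (IM.prod 𝓘(ℝ, FE)) ((IM.prod 𝓘(ℝ, FA)).prod 𝓘(ℝ, FU)) ∞ y :=
    D.Φ.contMDiff.comp w.contMDiff
  have h1 : ∀ (t : ℝˣ) e, y (scale (t : ℝ) e) = scale (t : ℝ) (y e) := by
    intro t e
    have h := congrArg (scale (t : ℝ)) (congrArg D.Φ (D.mk_pullSec t w e))
    rw [Φ_h, scale_scale, Units.mul_inv, scale_one, hw] at h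
    exact h.symm
  -- Homogeneity extends to t = 0 by continuity, which forces the A-component to be constant along
  -- the fibres of E.
  have h0 : ∀ e, y (scale 0 e) = scale 0 (y e) := by
    intro e
    have a1 : Tendsto (fun t : ℝˣ => y (scale (t : ℝ) e)) nzero (𝓝 (y (scale 0 e))) := by
      have : Continuous fun t : ℝ => y (scale t e) :=
        hy.continuous.comp (continuous_scale.comp (by fun_prop : Continuous fun r : ℝ => (r, e)))
      exact (this.tendsto 0).comp tendsto_nzero
    have a2 : Tendsto (fun t : ℝˣ => scale (t : ℝ) (y e)) nzero (𝓝 (scale 0 (y e))) := by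
      have : Continuous fun t : ℝ => scale t (y e) :=
        continuous_scale.comp (by fun_prop : Continuous fun r : ℝ => (r, y e))
      exact (this.tendsto 0).comp tendsto_nzero
    simp only [h1] at a1
    exact tendsto_nhds_unique a1 a2
  have hs : ∀ (t : ℝ) e, y (scale t e) = scale t (y e) := by
    intro t e
    by_cases ht : t = 0
    · rw [ht, h0]
    · exact h1 (Units.mk0 t ht) e
  let a : M → TotalSpace FA VA := fun m => (y ⟨m, 0⟩).proj
  have ha : ContMDiff IM (IM.prod 𝓘(ℝ, FA)) ∞ a :=
    (contMDiff_proj VU).comp (hy.comp (contMDiff_zeroSection ℝ VE))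
  have hap : ∀ m, (a m).proj = m := fun m => D.proj_comm _
  let α := secOfMap IM a ha hap
  have hα : ∀ m, (⟨m, α m⟩ : TotalSpace FA VA) = a m := mk_secOfMap IM a ha hap
  have hproj : ∀ e, (y e).proj = ⟨e.proj, α e.proj⟩ := by
    intro e
    rw [hα, ← proj_scale 0 (y e), ← h0, scale_zero]
  refine ⟨α, fun m => ?_⟩
  have hex : ∀ v : VE m, ∃ u : VU ⟨m, α m⟩, y ⟨m, v⟩ = ⟨⟨m, α m⟩, u⟩ := by
    intro v
    have h := hproj ⟨m, v⟩
    generalize y ⟨m, v⟩ = p at h ⊢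
    obtain ⟨b, u⟩ := p
    obtain rfl : b = ⟨m, α m⟩ := h
    exact ⟨u, rfl⟩
  choose l hl using hex
  have hlsmul : ∀ (t : ℝ) v, l (t • v) = t • l v := by
    intro t v
    have := hs t ⟨m, v⟩
    rw [hl v] at this
    exact TotalSpace.mk_inj.1 ((hl (t • v)).symm.trans this)
  let eE := trivializationAt FE VE m
  have hm : m ∈ eE.baseSet := mem_baseSet_trivializationAt FE VE m
  let e := trivializationAt FU VU (⟨m, α m⟩ : TotalSpace FA VA)
  have hme : (⟨m, α m⟩ : TotalSpace FA VA) ∈ e.baseSet := mem_baseSet_trivializationAt FU VU _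
  let κ := eE.linearEquivAt ℝ m hm
  let ε := e.linearEquivAt ℝ (⟨m, α m⟩ : TotalSpace FA VA) hme
  let g : FE → FU := fun x => ε (l (κ.symm x))
  have hg : DifferentiableAt ℝ g 0 := by
    have hsm : ContMDiffAt 𝓘(ℝ, FE) (IM.prod 𝓘(ℝ, FE)) ∞
        (fun x : FE => (⟨m, κ.symm x⟩ : TotalSpace FE VE)) 0 := by
      rw [eE.contMDiffAt_iff (eE.mem_source.2 hm)]
      refine ⟨contMDiffAt_const, ?_⟩
      refine contMDiffAt_id.congr_of_eventuallyEq (Eventually.of_forall fun x => ?_)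
      exact κ.apply_symm_apply x
    have hc : ContMDiffAt 𝓘(ℝ, FE) ((IM.prod 𝓘(ℝ, FA)).prod 𝓘(ℝ, FU)) ∞
        (fun x : FE => y (⟨m, κ.symm x⟩ : TotalSpace FE VE)) 0 :=
      hy.contMDiffAt.comp (0 : FE) hsm
    have hc2 := ((e.contMDiffAt_iff (e.mem_source.2 (by rw [hproj]; exact hme))).1 hc).2
    have hc3 : ContMDiffAt 𝓘(ℝ, FE) 𝓘(ℝ, FU) ∞ g 0 := by
      refine hc2.congr_of_eventuallyEq (Eventually.of_forall fun x => ?_)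
      change _ = (e (y ⟨m, κ.symm x⟩)).2
      rw [hl]
      rfl
    exact (contMDiffAt_iff_contDiffAt.1 hc3).differentiableAt (by simp)
  have hgl := eq_fderiv_of_homogeneous hg (fun t x => by
    change ε (l (κ.symm (t • x))) = t • ε (l (κ.symm x))
    rw [map_smul, hlsmul, map_smul])
  have hladd : ∀ v v', l (v + v') = l v + l v' := by
    intro v v'
    apply ε.injective
    have h2 := hgl (κ v + κ v')
    rw [map_add, ← hgl, ← hgl] at h2
    simpa only [g, map_add, LinearEquiv.symm_apply_apply] using h2
  exact ⟨{ toFun := l, map_add' := hladd, map_smul' := hlsmul }, hl⟩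

/-- The core part of a section: the difference is a zero vector of `W → A` along the zero section
of `E`. -/
theorem exists_core_part (w : Sec (IM.prod 𝓘(ℝ, FE)) FW VW) :
    ∃ a, D.IsCoreSec a ∧ ∀ m : M, ∃ b, D.Φ ⟨⟨m, 0⟩, (w - a) ⟨m, 0⟩⟩ = ⟨b, 0⟩ := by
  let w₀ : M → TotalSpace FW VW := fun m => ⟨⟨m, 0⟩, w ⟨m, 0⟩⟩
  have hw₀ : ContMDiff IM ((IM.prod 𝓘(ℝ, FE)).prod 𝓘(ℝ, FW)) ∞ w₀ :=
    w.contMDiff.comp (contMDiff_zeroSection ℝ VE)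
  have hz : ∀ m, ∃ ζ : VW ⟨m, 0⟩, D.h 0 (w₀ m) = ⟨⟨m, 0⟩, ζ⟩ := by
    intro m
    have h1 : (D.h 0 (w₀ m)).proj = ⟨m, 0⟩ := by
      rw [proj_h]
      exact scale_mk_zero 0 m
    generalize D.h 0 (w₀ m) = p at h1 ⊢
    obtain ⟨b, u⟩ := p
    obtain rfl : b = ⟨m, 0⟩ := h1
    exact ⟨u, rfl⟩
  choose ζ hζ using hz
  -- `D.h 0 (w₀ m)` is the zero vector of W → A over the A-component of `w₀ m`. Subtracting it over
  -- E removes this component and leaves a core point.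
  let χ : M → TotalSpace FW VW := fun m => ⟨⟨m, 0⟩, w ⟨m, 0⟩ - ζ m⟩
  have hχs : ∀ m, IsSum (w₀ m) (scale (-1) (D.h 0 (w₀ m))) (χ m) := by
    intro m
    rw [hζ]
    refine isSum_mk_iff.2 ?_
    rw [neg_smul, one_smul, sub_eq_add_neg]
  have hχ : ContMDiff IM ((IM.prod 𝓘(ℝ, FE)).prod 𝓘(ℝ, FW)) ∞ χ :=
    contMDiff_isSum hw₀ ((contMDiff_scale _ _).comp ((D.contMDiff_h 0).comp hw₀)) hχs
  have hχA : ∀ m, (D.Φ (χ m)).proj = ⟨m, 0⟩ := by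
    intro m
    have h1 := D.proj_add _ _ _ (hχs m)
    rw [D.proj_smul, Φ_h, proj_scale] at h1
    have h2 : (D.Φ (w₀ m)).proj.proj = m := D.proj_comm _
    generalize (D.Φ (w₀ m)).proj = p at h1 h2
    obtain ⟨b, u⟩ := p
    obtain rfl : b = m := h2
    have h3 : IsSum (⟨b, u⟩ : TotalSpace FA VA) (scale (-1) ⟨b, u⟩) ⟨b, 0⟩ :=
      isSum_mk_iff.2 (by rw [neg_smul, one_smul, add_neg_cancel])
    exact h1.unique h3
  choose k hk using fun e : TotalSpace FE VE => exists_isSum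
    (x := D.Φ (⟨e, 0⟩ : TotalSpace FW VW)) (y := D.Φ (χ e.proj))
    ((D.Φ_mk_zero_proj e).trans (hχA e.proj).symm)
  have hks : ContMDiff (IM.prod 𝓘(ℝ, FE)) ((IM.prod 𝓘(ℝ, FA)).prod 𝓘(ℝ, FU)) ∞ k :=
    contMDiff_isSum (D.Φ.contMDiff.comp (contMDiff_zeroSection ℝ VW))
      (D.Φ.contMDiff.comp (hχ.comp (contMDiff_proj VE))) hk
  have hkp : ∀ e, (D.Φ.symm (k e)).proj = e := by
    intro e
    have h1 := hk e
    rw [← D.Φ.apply_symm_apply (k e)] at h1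
    have h2 := D.add_cover _ _ _ h1
    exact h2.unique (isSum_zero_right e)
  have hka : ∀ e, (⟨e, secOfMap (IM.prod 𝓘(ℝ, FE)) (fun e => D.Φ.symm (k e))
      (D.Φ.symm.contMDiff.comp hks) hkp e⟩ : TotalSpace FW VW) = D.Φ.symm (k e) :=
    mk_secOfMap _ _ _ _
  refine ⟨secOfMap (IM.prod 𝓘(ℝ, FE)) (fun e => D.Φ.symm (k e)) (D.Φ.symm.contMDiff.comp hks) hkp,
    ⟨χ, hχ, fun m => ⟨rfl, hχA m⟩, fun e => ?_⟩, fun m => ?_⟩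
  · rw [hka, D.Φ.apply_symm_apply]
    exact hk e
  · generalize secOfMap (IM.prod 𝓘(ℝ, FE)) (fun e => D.Φ.symm (k e))
      (D.Φ.symm.contMDiff.comp hks) hkp = a at hka
    have h1 : (⟨⟨m, 0⟩, a ⟨m, 0⟩⟩ : TotalSpace FW VW) = χ m := by
      rw [hka]
      apply D.Φ_injective
      rw [D.Φ.apply_symm_apply]
      have h2 := hk ⟨m, 0⟩
      rw [Φ_zero_zero] at h2
      have h3 := isSum_zero_left (D.Φ (χ m))
      rw [hχA] at h3
      exact h2.unique h3
    have h2 : a ⟨m, 0⟩ = w ⟨m, 0⟩ - ζ m := TotalSpace.mk_inj.1 h1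
    refine ⟨(D.Φ (w₀ m)).proj, ?_⟩
    have h3 : (w - a) ⟨m, 0⟩ = ζ m := by
      rw [ContMDiffSection.coe_sub, Pi.sub_apply, h2, sub_sub_cancel]
    rw [h3, ← hζ, Φ_h, scale_zero]

/-- The linear part of a section that consists of zero vectors of `W → A` along the zero section
of `E`. -/
theorem exists_linear_part [T2Space M] {w : Sec (IM.prod 𝓘(ℝ, FE)) FW VW}
    (hw : ∀ m : M, ∃ b, D.Φ ⟨⟨m, 0⟩, w ⟨m, 0⟩⟩ = ⟨b, 0⟩) :
    ∃ a, D.IsLinearSec a ∧ ∀ m : M, a ⟨m, 0⟩ = w ⟨m, 0⟩ := by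
  have : T2Space (TotalSpace FA VA) := t2Space_totalSpace FA VA
  have : T2Space (TotalSpace FE VE) := t2Space_totalSpace FE VE
  have : T2Space (TotalSpace FW VW) := t2Space_totalSpace FW VW
  -- Scaled by t⁻¹ over A, this family is h_t^* w. By hypothesis it consists of zero vectors at t =
  -- 0, so the limit exists and is smooth.
  let y : ℝ × TotalSpace FE VE → TotalSpace FU VU := fun p =>
    D.Φ ⟨scale p.1 p.2, w (scale p.1 p.2)⟩
  have hy : ContMDiff (𝓘(ℝ, ℝ).prod (IM.prod 𝓘(ℝ, FE))) ((IM.prod 𝓘(ℝ, FA)).prod 𝓘(ℝ, FU)) ∞ y :=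
    D.Φ.contMDiff.comp (w.contMDiff.comp fun p => contMDiffAt_scale contMDiffAt_fst contMDiffAt_snd)
  have hy0 : ∀ e, y (0, e) = ⟨(y (0, e)).proj, 0⟩ := by
    intro e
    obtain ⟨b, hb⟩ := hw e.proj
    have : y (0, e) = ⟨b, 0⟩ := by
      rw [← hb]
      change D.Φ ⟨scale 0 e, w (scale 0 e)⟩ = _
      rw [scale_zero]
    rw [this]
  obtain ⟨z, hz, hlim⟩ := exists_tendsto_inv_scale hy hy0
  have hp : ∀ (t : ℝˣ) e, D.Φ.symm (scale (t : ℝ)⁻¹ (y (t, e))) = ⟨e, D.pullSec t w e⟩ := by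
    intro t e
    rw [mk_pullSec, Units.val_inv_eq_inv_val]
    rfl
  have hlim' : ∀ e, Tendsto (fun t : ℝˣ => (⟨e, D.pullSec t w e⟩ : TotalSpace FW VW)) nzero
      (𝓝 (D.Φ.symm (z e))) := by
    intro e
    have := (D.Φ.symm.continuous.tendsto (z e)).comp (hlim e)
    exact this.congr fun t => hp t e
  have hproj : ∀ e, (D.Φ.symm (z e)).proj = e := by
    intro e
    have := ((FiberBundle.continuous_proj FW VW).tendsto _).comp (hlim' e)
    exact tendsto_nhds_unique this tendsto_const_nhds
  let a := secOfMap (IM.prod 𝓘(ℝ, FE)) (fun e => D.Φ.symm (z e)) (D.Φ.symm.contMDiff.comp hz) hproj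
  have ha : ∀ e, (⟨e, a e⟩ : TotalSpace FW VW) = D.Φ.symm (z e) := mk_secOfMap _ _ _ _
  simp only [← ha] at hlim'
  refine ⟨a, D.isLinearSec_of_pullSec_eq fun s => sec_ext_mk fun e => ?_, fun m => ?_⟩
  -- Replacing t by s t does not change the limit, so it is invariant under h_s^* and hence linear.
  · have h1 := (((D.contMDiff_h ((s⁻¹ : ℝˣ) : ℝ)).continuous.tendsto _).comp
      (hlim' (scale (s : ℝ) e)))
    rw [← mk_pullSec] at h1
    have h2 := (hlim' e).comp (tendsto_mul_nzero s)
    refine tendsto_nhds_unique h1 (h2.congr fun t => ?_)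
    simp only [comp_apply]
    rw [← mk_pullSec, pullSec_pullSec]
  · refine TotalSpace.mk_inj.1 (tendsto_nhds_unique (hlim' ⟨m, 0⟩) ?_)
    refine tendsto_const_nhds.congr fun t => ?_
    obtain ⟨b, hb⟩ := hw m
    apply D.Φ_injective
    rw [mk_pullSec, Φ_h, scale_mk_zero, hb, scale_mk_zero]

end DoubleVectorBundle
end Double

/-! ### Expansions of vector fields from expansions of coordinates -/

section DualFrames

variable {EB : Type*} [NormedAddCommGroup EB] [NormedSpace ℝ EB]
  {HB : Type*} [TopologicalSpace HB] {IB : ModelWithCorners ℝ EB HB}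
  {B : Type*} [TopologicalSpace B] [ChartedSpace HB B] [IsManifold IB ∞ B]
  [FiniteDimensional ℝ EB] [T2Space B]

/-- The vector fields dual to a family of local coordinates. -/
theorem exists_dual_frame {κ : Type*} [Fintype κ] (x : B) (f : κ → C^∞⟮IB, B; ℝ⟯)
    (hf : Bijective fun (v : TangentSpace IB x) (j : κ) => dirDeriv (f j) x v) :
    ∃ Z : κ → VF IB B, ∀ᶠ y in 𝓝 x, ∀ X : VF IB B, X y = ∑ j, vfApp X (f j) y • Z j y := by
  classical
  choose v hv using fun i => hf.2 (Pi.single i 1)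
  choose Y hY using fun i => exists_sec_eq (IB := IB) (F := EB) (V := TangentSpace IB) x (v i)
  have hYx : Bijective (comb Y x) := by
    refine (Bijective.of_comp_iff' hf _).1 ?_
    have : ((fun (v : TangentSpace IB x) (j : κ) => dirDeriv (f j) x v) ∘ comb Y x) = id := by
      funext c j
      have h1 : ∀ i, dirDeriv (f j) x (v i) = (Pi.single i 1 : κ → ℝ) j := fun i =>
        congrFun (hv i) j
      simp only [comp_apply, comb_apply, hY, map_sum, map_smul, h1, id_eq, smul_eq_mul,
        Pi.single_apply]
      simp
    rw [this]
    exact bijective_id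
  -- The dual fields are the `Y i` transformed by the inverse of this matrix, written as adjugate
  -- over determinant; a cut-off makes 1/det a global smooth function.
  let P : Matrix κ κ (C^∞⟮IB, B; ℝ⟯) := Matrix.of fun i j => vfApp (Y i) (f j)
  let ev : ∀ y : B, C^∞⟮IB, B; ℝ⟯ →+* ℝ := fun y => ContMDiffMap.evalRingHom y
  have hev : ∀ y (g : C^∞⟮IB, B; ℝ⟯), ev y g = g y := fun y g => rfl
  have hdet : P.det x ≠ 0 := by
    rw [← hev, RingHom.map_det]
    have : (ev x).mapMatrix P = 1 := by
      ext i j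
      have h1 : dirDeriv (f j) x (v i) = (Pi.single i 1 : κ → ℝ) j := congrFun (hv i) j
      change dirDeriv (f j) x (Y i x) = _
      rw [hY, h1, Matrix.one_apply, Pi.single_apply]
      simp only [eq_comm]
    rw [this, Matrix.det_one]
    exact one_ne_zero
  have hdet' : ∀ᶠ y in 𝓝 x, P.det y ≠ 0 :=
    (P.det.contMDiff.continuous.tendsto x).eventually_ne hdet
  obtain ⟨ψ, h1, h2⟩ := exists_bump (IB := IB) x hdet'
  let g : C^∞⟮IB, B; ℝ⟯ := ⟨fun y => ψ y * (P.det y)⁻¹,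
    contMDiff_mul_of_tsupport ψ h2 fun y hy => (P.det.contMDiff y).inv₀ hy⟩
  refine ⟨fun j => ∑ i, fsmul (g * P.adjugate j i) (Y i), ?_⟩
  filter_upwards [eventually_bijective_comb Y hYx, h1, hdet'] with y hy hψ hd X
  obtain ⟨c, hc⟩ := hy.2 (X y)
  have hg : g y = (P.det y)⁻¹ := by
    change ψ y * _ = _
    rw [hψ, one_mul]
  have hadj : ∀ k i, ∑ j, P k j y * P.adjugate j i y = if k = i then P.det y else 0 := by
    intro k i
    have h3 := congrArg (ev y) (congrFun (congrFun (Matrix.mul_adjugate P) k) i)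
    rw [Matrix.mul_apply, map_sum] at h3
    refine Eq.trans ?_ (h3.trans ?_)
    · rfl
    rw [Matrix.smul_apply, Matrix.one_apply]
    split_ifs
    · rw [smul_eq_mul, mul_one, hev]
    · rw [smul_zero, map_zero]
  have hX : ∀ j, vfApp X (f j) y = ∑ k, c k * P k j y := by
    intro j
    rw [vfApp_apply, ← hc, comb_apply, map_sum]
    exact Finset.sum_congr rfl fun k _ => map_smul (dirDeriv (f j) y) (c k) (Y k y)
  have e1 : ∀ j, vfApp X (f j) y • (∑ i, fsmul (g * P.adjugate j i) (Y i)) y =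
      ∑ k, ∑ i, ((P.det y)⁻¹ * c k * (P k j y * P.adjugate j i y)) • Y i y := by
    intro j
    rw [sec_sum_apply, hX, Finset.sum_smul]
    refine Finset.sum_congr rfl fun k _ => ?_
    rw [Finset.smul_sum]
    refine Finset.sum_congr rfl fun i _ => ?_
    rw [fsmul_apply, smul_smul]
    congr 1
    change c k * P k j y * (g y * P.adjugate j i y) = _
    rw [hg]
    ring
  simp only [e1]
  rw [Finset.sum_comm, ← hc, comb_apply]
  refine Finset.sum_congr rfl fun k _ => ?_
  rw [Finset.sum_comm]
  simp only [← Finset.sum_smul, ← Finset.mul_sum, hadj]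
  simp only [mul_ite, mul_zero, ite_smul, zero_smul]
  rw [Finset.sum_ite_eq Finset.univ k, if_pos (Finset.mem_univ _)]
  congr 1
  field_simp

/-- Expansions of vector fields can be tested on coordinates. -/
theorem exists_hasExp_of_funExp {X : ℝˣ → VF IB B}
    (h : ∀ x, ∃ (n : ℕ) (f : Fin n → C^∞⟮IB, B; ℝ⟯),
      (Bijective fun (v : TangentSpace IB x) (j : Fin n) => dirDeriv (f j) x v) ∧
      ∀ j, ∃ g₁ g₀, FunExp (fun t => vfApp (X t) (f j)) g₁ g₀) : ∃ Y Z, HasExp X Y Z := by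
  refine HasExp.exists_of_local fun x => ?_
  obtain ⟨n, f, hf, hX⟩ := h x
  obtain ⟨Z, hZ⟩ := exists_dual_frame x f hf
  choose g₁ g₀ hg using hX
  have key : ∀ S : Finset (Fin n), HasExp (fun t => ∑ j ∈ S, fsmul (vfApp (X t) (f j)) (Z j))
      (∑ j ∈ S, fsmul (g₁ j) (Z j)) (∑ j ∈ S, fsmul (g₀ j) (Z j)) := by
    intro S
    induction S using Finset.induction_on with
    | empty => simpa using HasExp.zero
    | insert j S hj ih =>
      simp only [Finset.sum_insert hj]
      exact ((hg j).fsmul (Z j)).add ih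
  refine ⟨_, _, _, key Finset.univ, ?_⟩
  filter_upwards [hZ] with y hy t
  rw [hy (X t), sec_sum_apply]
  rfl

end DualFrames

/-! ### Homogeneous frames and coordinates -/

section Double

variable {EM : Type*} [NormedAddCommGroup EM] [NormedSpace ℝ EM]
  {HM : Type*} [TopologicalSpace HM] {IM : ModelWithCorners ℝ EM HM}
  {M : Type*} [TopologicalSpace M] [ChartedSpace HM M] [IsManifold IM ∞ M]
  {FE : Type*} [NormedAddCommGroup FE] [NormedSpace ℝ FE]
  {VE : M → Type*} [TopologicalSpace (TotalSpace FE VE)]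
  [∀ x, AddCommGroup (VE x)] [∀ x, Module ℝ (VE x)] [∀ x, TopologicalSpace (VE x)]
  [FiberBundle FE VE] [VectorBundle ℝ FE VE] [ContMDiffVectorBundle ∞ FE VE IM]
  {FA : Type*} [NormedAddCommGroup FA] [NormedSpace ℝ FA]
  {VA : M → Type*} [TopologicalSpace (TotalSpace FA VA)]
  [∀ x, AddCommGroup (VA x)] [∀ x, Module ℝ (VA x)] [∀ x, TopologicalSpace (VA x)]
  [FiberBundle FA VA] [VectorBundle ℝ FA VA] [ContMDiffVectorBundle ∞ FA VA IM]
  {FW : Type*} [NormedAddCommGroup FW] [NormedSpace ℝ FW]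
  {VW : TotalSpace FE VE → Type*} [TopologicalSpace (TotalSpace FW VW)]
  [∀ x, AddCommGroup (VW x)] [∀ x, Module ℝ (VW x)] [∀ x, TopologicalSpace (VW x)]
  [FiberBundle FW VW] [VectorBundle ℝ FW VW]
  [ContMDiffVectorBundle ∞ FW VW (IM.prod 𝓘(ℝ, FE))]
  {FU : Type*} [NormedAddCommGroup FU] [NormedSpace ℝ FU]
  {VU : TotalSpace FA VA → Type*} [TopologicalSpace (TotalSpace FU VU)]
  [∀ x, AddCommGroup (VU x)] [∀ x, Module ℝ (VU x)] [∀ x, TopologicalSpace (VU x)]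
  [FiberBundle FU VU] [VectorBundle ℝ FU VU]
  [ContMDiffVectorBundle ∞ FU VU (IM.prod 𝓘(ℝ, FA))]

/-- The pull-back of a function on the base. -/
def baseFun (ψ : C^∞⟮IM, M; ℝ⟯) : C^∞⟮IM.prod 𝓘(ℝ, FE), TotalSpace FE VE; ℝ⟯ :=
  ⟨fun e => ψ e.proj, ψ.contMDiff.comp (contMDiff_proj VE)⟩

@[simp] theorem baseFun_apply (ψ : C^∞⟮IM, M; ℝ⟯) (e : TotalSpace FE VE) :
    baseFun ψ e = ψ e.proj := rfl

theorem tsupport_baseFun (ψ : C^∞⟮IM, M; ℝ⟯) :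
    tsupport (baseFun ψ : C^∞⟮IM.prod 𝓘(ℝ, FE), TotalSpace FE VE; ℝ⟯) ⊆
      TotalSpace.proj ⁻¹' tsupport ψ :=
  tsupport_comp_subset_preimage ψ (FiberBundle.continuous_proj FE VE)

/-- The factor t⁻¹ is the worst pole that occurs below; milder cases follow by multiplying with
powers of t (`FunExp.pow_smul`). -/
theorem exists_funExp_pullFun [IM.Boundaryless]
    (f : C^∞⟮IM.prod 𝓘(ℝ, FE), TotalSpace FE VE; ℝ⟯) :
    ∃ f₀ f₁, FunExp (fun t : ℝˣ => (t : ℝ)⁻¹ • pullFun (t : ℝ) f) f₀ f₁ :=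
  exists_funExp (G := fun p : ℝ × TotalSpace FE VE => f (scale p.1 p.2))
    (f.contMDiff.comp fun _ => contMDiffAt_scale contMDiffAt_fst contMDiffAt_snd) _
    fun _ _ => rfl

/-! Vector fields. -/

/-- The pull-back of a vector field by scalar multiplication. -/
def pullVF (t : ℝˣ) (X : VF (IM.prod 𝓘(ℝ, FE)) (TotalSpace FE VE)) :
    VF (IM.prod 𝓘(ℝ, FE)) (TotalSpace FE VE) :=
  secOfMap (IM.prod 𝓘(ℝ, FE))
    (fun e => tangentMap (IM.prod 𝓘(ℝ, FE)) (IM.prod 𝓘(ℝ, FE)) (scale ((t⁻¹ : ℝˣ) : ℝ))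
      ⟨scale (t : ℝ) e, X (scale (t : ℝ) e)⟩)
    (((contMDiff_scale IM ((t⁻¹ : ℝˣ) : ℝ)).contMDiff_tangentMap le_rfl).comp
      (X.contMDiff.comp (contMDiff_scale IM _)))
    (fun e => scale_inv_scale t e)

theorem mk_pullVF (t : ℝˣ) (X : VF (IM.prod 𝓘(ℝ, FE)) (TotalSpace FE VE)) (e : TotalSpace FE VE) :
    (⟨e, pullVF t X e⟩ : TangentBundle (IM.prod 𝓘(ℝ, FE)) (TotalSpace FE VE)) =
      tangentMap (IM.prod 𝓘(ℝ, FE)) (IM.prod 𝓘(ℝ, FE)) (scale ((t⁻¹ : ℝˣ) : ℝ))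
      ⟨scale (t : ℝ) e, X (scale (t : ℝ) e)⟩ :=
  mk_secOfMap _ _ _ _ _

theorem vfApp_pullVF (t : ℝˣ) (X : VF (IM.prod 𝓘(ℝ, FE)) (TotalSpace FE VE))
    (f : C^∞⟮IM.prod 𝓘(ℝ, FE), TotalSpace FE VE; ℝ⟯) :
    vfApp (pullVF t X) f = pullFun (t : ℝ) (vfApp X (pullFun ((t⁻¹ : ℝˣ) : ℝ) f)) := by
  ext e
  have h1 := congrArg (fun p : TangentBundle (IM.prod 𝓘(ℝ, FE)) (TotalSpace FE VE) =>
    dirDeriv f p.proj p.snd) (mk_pullVF t X e)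
  refine h1.trans ?_
  have h2 : mfderiv (IM.prod 𝓘(ℝ, FE)) 𝓘(ℝ, ℝ) (f ∘ scale ((t⁻¹ : ℝˣ) : ℝ)) (scale (t : ℝ) e) =
      (mfderiv (IM.prod 𝓘(ℝ, FE)) 𝓘(ℝ, ℝ) f (scale ((t⁻¹ : ℝˣ) : ℝ) (scale (t : ℝ) e))).comp
      (mfderiv (IM.prod 𝓘(ℝ, FE)) (IM.prod 𝓘(ℝ, FE)) (scale ((t⁻¹ : ℝˣ) : ℝ)) (scale (t : ℝ) e)) :=
    mfderiv_comp _ f.mdifferentiableAt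
      ((contMDiff_scale IM ((t⁻¹ : ℝˣ) : ℝ)).mdifferentiableAt (by simp))
  have h3 := congrArg (fun l : (EM × FE) →L[ℝ] ℝ => l (X (scale (t : ℝ) e))) h2
  exact h3.symm

variable [FiniteDimensional ℝ EM] [FiniteDimensional ℝ FE] [T2Space M]

theorem pullVF_fsmul (t : ℝˣ) (f : C^∞⟮IM.prod 𝓘(ℝ, FE), TotalSpace FE VE; ℝ⟯)
    (X : VF (IM.prod 𝓘(ℝ, FE)) (TotalSpace FE VE)) :
    pullVF t (fsmul f X) = fsmul (pullFun (t : ℝ) f) (pullVF t X) := by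
  have : T2Space (TotalSpace FE VE) := t2Space_totalSpace FE VE
  refine VF.ext_fun fun g => ?_
  have e : ∀ (f g : C^∞⟮IM.prod 𝓘(ℝ, FE), TotalSpace FE VE; ℝ⟯)
      (X : VF (IM.prod 𝓘(ℝ, FE)) (TotalSpace FE VE)), vfApp (fsmul f X) g = f * vfApp X g := by
    intro f g X
    ext y
    exact map_smul (dirDeriv g y) (f y) (X y)
  rw [e, vfApp_pullVF, vfApp_pullVF, e]
  rfl

/-- The pull-back of vector fields as a linear map. -/
def pullVFₗ (t : ℝˣ) : VF (IM.prod 𝓘(ℝ, FE)) (TotalSpace FE VE) →ₗ[ℝ]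
    VF (IM.prod 𝓘(ℝ, FE)) (TotalSpace FE VE) where
  toFun := pullVF t
  map_add' X Y := by
    have : T2Space (TotalSpace FE VE) := t2Space_totalSpace FE VE
    have e : ∀ (X Y : VF (IM.prod 𝓘(ℝ, FE)) (TotalSpace FE VE)) g,
        vfApp (X + Y) g = vfApp X g + vfApp Y g := by
      intro X Y g
      ext y
      exact map_add (dirDeriv g y) (X y) (Y y)
    refine VF.ext_fun fun g => ?_
    rw [e, vfApp_pullVF, vfApp_pullVF, vfApp_pullVF, e]
    rfl
  map_smul' r X := by
    have : T2Space (TotalSpace FE VE) := t2Space_totalSpace FE VE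
    have e : ∀ (X : VF (IM.prod 𝓘(ℝ, FE)) (TotalSpace FE VE)) g,
        vfApp (r • X) g = r • vfApp X g := by
      intro X g
      ext y
      exact map_smul (dirDeriv g y) r (X y)
    refine VF.ext_fun fun g => ?_
    rw [RingHom.id_apply, e, vfApp_pullVF, vfApp_pullVF, e]
    rfl

/-- Around every point of `E` there are coordinates that are constant or linear along the fibres
of `E → M`. -/
theorem exists_homogeneous_coordinates (e : TotalSpace FE VE) :
    ∃ (n : ℕ) (f : Fin n → C^∞⟮IM.prod 𝓘(ℝ, FE), TotalSpace FE VE; ℝ⟯),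
      (Bijective fun (v : TangentSpace (IM.prod 𝓘(ℝ, FE)) e) (j : Fin n) => dirDeriv (f j) e v) ∧
      ∀ j, (∀ t : ℝ, pullFun t (f j) = f j) ∨ (∀ t : ℝ, pullFun t (f j) = t • f j) := by
  let I := IM.prod 𝓘(ℝ, FE)
  let τ := trivializationAt FE VE e.proj
  have hτ : e.proj ∈ τ.baseSet := mem_baseSet_trivializationAt FE VE e.proj
  have hsrc : (extChartAt I e).source =
      TotalSpace.proj ⁻¹' (τ.baseSet ∩ (extChartAt IM e.proj).source) := by
    rw [FiberBundle.extChartAt]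
    ext y
    simp only [PartialEquiv.trans_source, PartialEquiv.prod_source, PartialEquiv.refl_source,
      Set.mem_inter_iff, Set.mem_preimage, Set.mem_prod, Set.mem_univ, and_true]
    constructor
    · rintro ⟨h1, h2⟩
      have h1' : y ∈ τ.source := h1
      refine ⟨τ.mem_source.1 h1', ?_⟩
      have : (τ y).1 = y.proj := τ.coe_fst h1'
      rw [← this]
      exact h2
    · rintro ⟨h1, h2⟩
      have h1' : y ∈ τ.source := τ.mem_source.2 h1
      refine ⟨h1', ?_⟩
      have : (τ y).1 = y.proj := τ.coe_fst h1'
      change (τ y).1 ∈ _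
      rw [this]
      exact h2
  have happ : ∀ y ∈ (extChartAt I e).source, extChartAt I e y =
      (extChartAt IM e.proj y.proj, (τ y).2) := by
    intro y hy
    rw [hsrc] at hy
    rw [FiberBundle.extChartAt]
    change (extChartAt IM e.proj (τ y).1, (τ y).2) = _
    rw [τ.coe_fst' hy.1]
  have hU : τ.baseSet ∩ (extChartAt IM e.proj).source ∈ 𝓝 e.proj :=
    inter_mem (τ.open_baseSet.mem_nhds hτ) (extChartAt_source_mem_nhds e.proj)
  -- The cut-off is pulled back from M, hence constant along the fibres of E, and does not disturb
  -- the weights of the bundle coordinates.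
  obtain ⟨ψ, h1, h2⟩ := exists_bump (IB := IM) e.proj hU
  have hψ1 : ∀ᶠ y in 𝓝 e, baseFun ψ y = 1 :=
    (FiberBundle.continuous_proj FE VE).continuousAt.eventually h1
  have hψ2 : tsupport (baseFun ψ : C^∞⟮I, TotalSpace FE VE; ℝ⟯) ⊆ (extChartAt I e).source := by
    rw [hsrc]
    exact (tsupport_baseFun ψ).trans (Set.preimage_mono h2)
  have hψ0 : ∀ y : TotalSpace FE VE, y ∉ (extChartAt I e).source → ψ y.proj = 0 := by
    intro y hy
    have := image_eq_zero_of_notMem_tsupport (f := ψ) (x := y.proj) fun h => hy (by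
      rw [hsrc]; exact h2 h)
    exact this
  have hφ : ∀ (l : EM × FE →ₗ[ℝ] ℝ), ∀ y ∈ (extChartAt I e).source,
      ContMDiffAt I 𝓘(ℝ, ℝ) ∞ (fun y => l (extChartAt I e y)) y := fun l y hy =>
    ((LinearMap.toContinuousLinearMap l).contMDiff.contMDiffAt).comp y
      (contMDiffAt_extChartAt' (by rwa [extChartAt_source] at hy))
  let f : (EM × FE →ₗ[ℝ] ℝ) → C^∞⟮I, TotalSpace FE VE; ℝ⟯ := fun l =>
    ⟨_, contMDiff_mul_of_tsupport (baseFun ψ) hψ2 (hφ l)⟩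
  have hfd : ∀ l (v : TangentSpace I e), dirDeriv (f l) e v =
      l (mfderiv I 𝓘(ℝ, EM × FE) (extChartAt I e) e v) := by
    intro l u
    have h5 : mfderiv I 𝓘(ℝ, ℝ) (f l) e =
        mfderiv I 𝓘(ℝ, ℝ) (LinearMap.toContinuousLinearMap l ∘ extChartAt I e) e := by
      refine EventuallyEq.mfderiv_eq ?_
      filter_upwards [hψ1] with y hy
      change baseFun ψ y * l (extChartAt I e y) = l (extChartAt I e y)
      rw [hy, one_mul]
    rw [mfderiv_comp e (I' := 𝓘(ℝ, EM × FE)) (LinearMap.toContinuousLinearMap l).mdifferentiableAt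
      (mdifferentiableAt_extChartAt (mem_chart_source _ e)),
      ContinuousLinearMap.mfderiv_eq] at h5
    exact congrArg (fun l : EM × FE →L[ℝ] ℝ => l u) h5
  have hscale : ∀ (t : ℝ) y, y ∈ (extChartAt I e).source → scale t y ∈ (extChartAt I e).source := by
    intro t y hy
    rw [hsrc] at hy ⊢
    exact hy
  have hw1 : ∀ l : EM →ₗ[ℝ] ℝ, ∀ t : ℝ, pullFun t (f (l ∘ₗ LinearMap.fst ℝ EM FE)) =
      f (l ∘ₗ LinearMap.fst ℝ EM FE) := by
    intro l t
    ext y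
    change ψ y.proj * l (extChartAt I e (scale t y)).1 = ψ y.proj * l (extChartAt I e y).1
    by_cases hy : y ∈ (extChartAt I e).source
    · rw [happ y hy, happ _ (hscale t y hy), proj_scale]
    · rw [hψ0 y hy, zero_mul, zero_mul]
  have hw2 : ∀ l : FE →ₗ[ℝ] ℝ, ∀ t : ℝ, pullFun t (f (l ∘ₗ LinearMap.snd ℝ EM FE)) =
      t • f (l ∘ₗ LinearMap.snd ℝ EM FE) := by
    intro l t
    ext y
    change ψ y.proj * l (extChartAt I e (scale t y)).2 = t * (ψ y.proj * l (extChartAt I e y).2)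
    by_cases hy : y ∈ (extChartAt I e).source
    · rw [happ y hy, happ _ (hscale t y hy)]
      have hy' : y.proj ∈ τ.baseSet := by
        rw [hsrc] at hy
        exact hy.1
      change ψ y.proj * l (τ (scale t y)).2 = t * (ψ y.proj * l (τ y).2)
      rw [snd_scale τ t hy', map_smul, smul_eq_mul]
      ring
    · rw [hψ0 y hy, zero_mul, zero_mul, mul_zero]
  let b := (Module.finBasis ℝ EM).prod (Module.finBasis ℝ FE)
  let ε := Fintype.equivFin (Fin (Module.finrank ℝ EM) ⊕ Fin (Module.finrank ℝ FE))
  refine ⟨_, fun j => f (b.coord (ε.symm j)), ?_, fun j => ?_⟩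
  · have hinv := isInvertible_mfderiv_extChartAt (I := I) (mem_extChartAt_source (I := I) e)
    have hbij : Bijective fun (x : EM × FE) j => b.coord (ε.symm j) x := by
      have h3 := (b.reindex ε).equivFun.bijective
      have h4 : ⇑(b.reindex ε).equivFun = fun x j => b.coord (ε.symm j) x := by
        funext x j
        simp [Module.Basis.equivFun_apply]
      rwa [h4] at h3
    simp only [hfd]
    exact hbij.comp hinv.bijective
  · rcases h : ε.symm j with i | i
    · left
      have : b.coord (Sum.inl i) = (Module.finBasis ℝ EM).coord i ∘ₗ LinearMap.fst ℝ EM FE := by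
        refine LinearMap.ext fun x => ?_
        simp [b]
      dsimp only
      rw [h, this]
      exact hw1 _
    · right
      have : b.coord (Sum.inr i) = (Module.finBasis ℝ FE).coord i ∘ₗ LinearMap.snd ℝ EM FE := by
        refine LinearMap.ext fun x => ?_
        simp [b]
      dsimp only
      rw [h, this]
      exact hw2 _

/-- On a coordinate f of weight 0 or 1, (h_t^* X)(f) is h_t^*(Xf) or t⁻¹ h_t^*(Xf), so the pole is
at most simple. -/
theorem exists_hasExp_pullVF [IM.Boundaryless] (X : VF (IM.prod 𝓘(ℝ, FE)) (TotalSpace FE VE)) :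
    ∃ Y Z, HasExp (fun t => pullVF t X) Y Z := by
  have : T2Space (TotalSpace FE VE) := t2Space_totalSpace FE VE
  refine exists_hasExp_of_funExp fun e => ?_
  obtain ⟨n, f, hf, hw⟩ := exists_homogeneous_coordinates (IM := IM) e
  refine ⟨n, f, hf, fun j => ?_⟩
  obtain ⟨g₁, g₀, hg⟩ := exists_funExp_pullFun (vfApp X (f j))
  rcases hw j with h | h
  · obtain ⟨g₁', g₀', hg'⟩ := hg.pow_smul 1
    refine ⟨g₁', g₀', ?_⟩
    convert hg' using 2 with t
    rw [vfApp_pullVF, h, pow_one, smul_smul, mul_inv_cancel₀ t.ne_zero, one_smul]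
  · refine ⟨g₁, g₀, ?_⟩
    convert hg using 2 with t
    rw [vfApp_pullVF, h, Units.val_inv_eq_inv_val]
    ext y
    exact dirDeriv_const_smul _ _ _ _

end Double

/-! ### Sections as combinations of linear and core sections -/

section Double

variable {EM : Type*} [NormedAddCommGroup EM] [NormedSpace ℝ EM]
  {HM : Type*} [TopologicalSpace HM] {IM : ModelWithCorners ℝ EM HM}
  {M : Type*} [TopologicalSpace M] [ChartedSpace HM M] [IsManifold IM ∞ M]
  {FE : Type*} [NormedAddCommGroup FE] [NormedSpace ℝ FE]
  {VE : M → Type*} [TopologicalSpace (TotalSpace FE VE)]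
  [∀ x, AddCommGroup (VE x)] [∀ x, Module ℝ (VE x)] [∀ x, TopologicalSpace (VE x)]
  [FiberBundle FE VE] [VectorBundle ℝ FE VE] [ContMDiffVectorBundle ∞ FE VE IM]
  {FA : Type*} [NormedAddCommGroup FA] [NormedSpace ℝ FA]
  {VA : M → Type*} [TopologicalSpace (TotalSpace FA VA)]
  [∀ x, AddCommGroup (VA x)] [∀ x, Module ℝ (VA x)] [∀ x, TopologicalSpace (VA x)]
  [FiberBundle FA VA] [VectorBundle ℝ FA VA] [ContMDiffVectorBundle ∞ FA VA IM]
  {FW : Type*} [NormedAddCommGroup FW] [NormedSpace ℝ FW]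
  {VW : TotalSpace FE VE → Type*} [TopologicalSpace (TotalSpace FW VW)]
  [∀ x, AddCommGroup (VW x)] [∀ x, Module ℝ (VW x)] [∀ x, TopologicalSpace (VW x)]
  [FiberBundle FW VW] [VectorBundle ℝ FW VW]
  [ContMDiffVectorBundle ∞ FW VW (IM.prod 𝓘(ℝ, FE))]
  {FU : Type*} [NormedAddCommGroup FU] [NormedSpace ℝ FU]
  {VU : TotalSpace FA VA → Type*} [TopologicalSpace (TotalSpace FU VU)]
  [∀ x, AddCommGroup (VU x)] [∀ x, Module ℝ (VU x)] [∀ x, TopologicalSpace (VU x)]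
  [FiberBundle FU VU] [VectorBundle ℝ FU VU]
  [ContMDiffVectorBundle ∞ FU VU (IM.prod 𝓘(ℝ, FA))]
  [FiniteDimensional ℝ EM] [FiniteDimensional ℝ FE] [FiniteDimensional ℝ FW] [T2Space M]

namespace DoubleVectorBundle

variable (D : DoubleVectorBundle IM FE VE FA VA FW VW FU VU)

/-- Linear sections and core sections. -/
def IsHom (s : Sec (IM.prod 𝓘(ℝ, FE)) FW VW) : Prop := D.IsLinearSec s ∨ D.IsCoreSec s

variable {D} in
theorem IsHom.exists_weight {s : Sec (IM.prod 𝓘(ℝ, FE)) FW VW} (hs : D.IsHom s) :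
    ∃ p : ℕ, p ≤ 1 ∧ ∀ t : ℝˣ, D.pullSec t s = ((t : ℝ)⁻¹) ^ p • s := by
  rcases hs with hs | hs
  · exact ⟨0, zero_le_one, fun t => by rw [hs.pullSec_eq, pow_zero, one_smul]⟩
  · exact ⟨1, le_rfl, fun t => by rw [hs.pullSec_eq, pow_one]⟩

/-- Linear and core sections span the fibres over the zero section of `E`. -/
theorem span_isHom (m : M) :
    Submodule.span ℝ (Set.range fun s : {s // D.IsHom s} => s.1 (⟨m, 0⟩ : TotalSpace FE VE)) =
      ⊤ := by
  have : T2Space (TotalSpace FE VE) := t2Space_totalSpace FE VE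
  rw [eq_top_iff]
  rintro v -
  obtain ⟨w, rfl⟩ := exists_sec_eq (IB := IM.prod 𝓘(ℝ, FE)) (F := FW) (⟨m, 0⟩ : TotalSpace FE VE) v
  obtain ⟨a, ha, hz⟩ := D.exists_core_part w
  obtain ⟨b, hb, hb0⟩ := D.exists_linear_part hz
  have : w ⟨m, 0⟩ = a ⟨m, 0⟩ + b ⟨m, 0⟩ := by
    rw [hb0, ContMDiffSection.coe_sub, Pi.sub_apply, add_sub_cancel]
  rw [this]
  exact add_mem (Submodule.subset_span ⟨⟨a, Or.inr ha⟩, rfl⟩)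
    (Submodule.subset_span ⟨⟨b, Or.inl hb⟩, rfl⟩)

/-- Homogeneous frames over the preimages of small open sets of `M`. -/
theorem exists_hom_frame (m : M) : ∃ (n : ℕ) (s : Fin n → Sec (IM.prod 𝓘(ℝ, FE)) FW VW),
    (∀ i, D.IsHom (s i)) ∧
      ∀ᶠ m' in 𝓝 m, ∀ e : TotalSpace FE VE, e.proj = m' → Bijective (comb s e) := by
  have : ∀ e, FiniteDimensional ℝ (VW e) := fun e => VectorBundle.finiteDimensional ℝ FW VW e
  have hrank : ∀ e, Module.finrank ℝ (VW e) = Module.finrank ℝ FW := fun e =>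
    (VectorBundle.continuousLinearEquivAt ℝ FW VW e).toLinearEquiv.finrank_eq
  -- A basis of the fibre over 0_m is selected among the values of linear and core sections.
  obtain ⟨κ, a, -, ha, hli⟩ := exists_linearIndependent' ℝ
    (fun s : {s // D.IsHom s} => s.1 (⟨m, 0⟩ : TotalSpace FE VE))
  rw [span_isHom] at ha
  have : Finite κ := hli.finite
  have : Fintype κ := Fintype.ofFinite κ
  let ε := Fintype.equivFin κ
  let s : Fin (Fintype.card κ) → Sec (IM.prod 𝓘(ℝ, FE)) FW VW := fun i => (a (ε.symm i)).1
  have hs : ∀ i, D.IsHom (s i) := fun i => (a (ε.symm i)).2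
  have hb : Bijective (comb s (⟨m, 0⟩ : TotalSpace FE VE)) := by
    constructor
    · exact linearIndependent_iff_injective_fintypeLinearCombination.1
        (hli.comp _ ε.symm.injective)
    · rw [← LinearMap.range_eq_top, comb, Fintype.range_linearCombination, ← ha]
      congr 1
      exact ε.symm.surjective.range_comp (fun k : κ => (a k).1 (⟨m, 0⟩ : TotalSpace FE VE))
  refine ⟨_, s, hs, ?_⟩
  have h1 := eventually_bijective_comb s hb
  have hc : Continuous fun m' : M => (⟨m', 0⟩ : TotalSpace FE VE) :=
    (contMDiff_zeroSection ℝ (IB := IM) (n := ∞) VE).continuous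
  filter_upwards [(hc.tendsto m).eventually (eventually_eventually_nhds.2 h1)] with m' hm' e he
  subst he
  have h2 : Tendsto (fun t : ℝˣ => scale (t : ℝ) e) nzero (𝓝 ⟨e.proj, 0⟩) := by
    have : Continuous fun t : ℝ => scale t e :=
      continuous_scale.comp (by fun_prop : Continuous fun r : ℝ => (r, e))
    rw [← scale_zero]
    exact (this.tendsto 0).comp tendsto_nzero
  -- Scaling moves e to a point near the zero section where the family is a basis. Homogeneity
  -- carries independence back to e, so the frame is valid along whole fibres of E.
  obtain ⟨t, ht⟩ := (h2.eventually hm').exists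
  have hinj : Injective (comb s e) := by
    rw [injective_iff_map_eq_zero]
    intro c hc
    choose p hp1 hp using fun i => (hs i).exists_weight
    have h3 : D.pullSec t (∑ i, (c i * (t : ℝ) ^ p i) • s i) = ∑ i, c i • s i := by
      change D.pullSecₗ t _ = _
      rw [map_sum]
      refine Finset.sum_congr rfl fun i _ => ?_
      rw [map_smul]
      change _ • D.pullSec t (s i) = _
      rw [hp, _root_.smul_smul, mul_assoc, ← mul_pow, mul_inv_cancel₀ t.ne_zero, one_pow, mul_one]
    have h4 : D.pullSec t (∑ i, (c i * (t : ℝ) ^ p i) • s i) e = 0 := by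
      rw [h3, sec_sum_apply]
      exact hc
    rw [pullSec_apply_eq_zero, sec_sum_apply] at h4
    have h5 : (fun i => c i * (t : ℝ) ^ p i) = 0 := ht.1 (h4.trans (map_zero _).symm)
    funext i
    exact (mul_eq_zero.1 (congrFun h5 i)).resolve_right (pow_ne_zero _ t.ne_zero)
  refine ⟨hinj, (LinearMap.injective_iff_surjective_of_finrank_eq_finrank ?_).1 hinj⟩
  rw [hrank, ← hrank (scale (t : ℝ) e)]
  exact (LinearEquiv.ofBijective _ ht).finrank_eq

/-- An induction principle for sections: it is enough to treat products of functions with linear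
or core sections. -/
theorem hom_induction {G : Sec (IM.prod 𝓘(ℝ, FE)) FW VW → Prop} (h0 : G 0)
    (hadd : ∀ s s', G s → G s' → G (s + s'))
    (hmul : ∀ f s, D.IsHom s → G (fsmul f s))
    (hloc : ∀ w, (∀ m : M, ∃ w', (∀ᶠ m' in 𝓝 m, ∀ e : TotalSpace FE VE, e.proj = m' →
      w e = w' e) ∧ G w') → G w) (w : Sec (IM.prod 𝓘(ℝ, FE)) FW VW) : G w := by
  refine hloc w fun m => ?_
  obtain ⟨n, s, hs, hb⟩ := D.exists_hom_frame m
  -- Localization takes place over M only: h_t preserves the fibres of E → M, so agreement over an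
  -- open set of M passes to pull-backs.
  obtain ⟨ψ, h1, h2⟩ := exists_bump (IB := IM) m hb
  obtain ⟨f, hf⟩ := exists_coeff s (baseFun ψ)
    ((tsupport_baseFun ψ).trans (Set.preimage_mono h2)) (fun e he => he e rfl) w
  refine ⟨fsmul (baseFun ψ) w, ?_, ?_⟩
  · filter_upwards [h1] with m' hm' e he
    subst he
    rw [fsmul_apply, baseFun_apply, hm', one_smul]
  · rw [hf]
    exact Finset.sum_induction _ G hadd h0 fun i _ => hmul _ _ (hs i)

/-- The induction principle for several sections. -/
theorem hom_induction_multi {k : ℕ} {G : (Fin k → Sec (IM.prod 𝓘(ℝ, FE)) FW VW) → Prop}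
    (hbase : ∀ w, (∀ i, D.IsHom (w i)) → G w)
    (h0 : ∀ w i, G (update w i 0))
    (hadd : ∀ w i s s', G (update w i s) → G (update w i s') → G (update w i (s + s')))
    (hmul : ∀ w i f s, G (update w i s) → G (update w i (fsmul f s)))
    (hloc : ∀ w i, (∀ e : TotalSpace FE VE, ∃ s, (∀ᶠ e' in 𝓝 e, w i e' = s e') ∧
      G (update w i s)) → G w) (w : Fin k → Sec (IM.prod 𝓘(ℝ, FE)) FW VW) : G w := by
  classical
  -- S contains the entries not known to be homogeneous; the induction makes them arbitrary one by
  -- one.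
  have key : ∀ (S : Finset (Fin k)) (w : Fin k → Sec (IM.prod 𝓘(ℝ, FE)) FW VW),
      (∀ i, i ∉ S → D.IsHom (w i)) → G w := by
    intro S
    induction S using Finset.induction_on with
    | empty => exact fun w hw => hbase w fun i => hw i (Finset.notMem_empty i)
    | insert j S hj ih =>
      intro w hw
      rw [← update_eq_self j w]
      refine D.hom_induction (G := fun s => G (update w j s)) (h0 w j) (hadd w j)
        (fun f s hs => hmul w j f s (ih _ fun i hi => ?_)) (fun s hs => ?_) (w j)
      · by_cases hij : i = j
        · subst hij
          rwa [update_self]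
        · rw [update_of_ne hij]
          exact hw i (by simp [hij, hi])
      · refine hloc _ j fun e => ?_
        obtain ⟨w', h1, h2⟩ := hs e.proj
        refine ⟨w', ?_, by rwa [update_idem]⟩
        rw [update_self]
        filter_upwards [((FiberBundle.continuous_proj FE VE).tendsto e).eventually h1] with e' he'
        exact he' e' rfl
  exact key Finset.univ w fun i hi => absurd (Finset.mem_univ i) hi

/-- Expansion of the pull-back of sections. -/
theorem exists_hasExp_pullSec [IM.Boundaryless] (w : Sec (IM.prod 𝓘(ℝ, FE)) FW VW) :
    ∃ A B, HasExp (fun t => D.pullSec t w) A B := by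
  have : T2Space (TotalSpace FE VE) := t2Space_totalSpace FE VE
  refine D.hom_induction (G := fun w => ∃ A B, HasExp (fun t => D.pullSec t w) A B) ?_ ?_ ?_ ?_ w
  · have : ∀ t, D.pullSec t 0 = 0 := fun t => map_zero (D.pullSecₗ t)
    simp only [this]
    exact ⟨0, 0, HasExp.zero⟩
  · rintro s s' ⟨A, B, h⟩ ⟨A', B', h'⟩
    simp only [pullSec_add]
    exact ⟨_, _, h.add h'⟩
  · intro f s hs
    obtain ⟨f₀, f₁, hf⟩ := exists_funExp_pullFun f
    have h1 := hf.fsmul s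
    obtain ⟨p, hp, hw⟩ := hs.exists_weight
    -- For s of weight -p, h_t^*(f s) at e is t^(1-p) (t⁻¹ f(te)) s(e); the exponent 1 - p is not
    -- truncated since p ≤ 1.
    obtain ⟨A, B, h2⟩ := h1.pow_smul (1 - p)
    refine ⟨A, B, ?_⟩
    convert h2 using 2 with t
    rw [pullSec_fsmul, hw, fsmul_smul]
    have e : fsmul ((t : ℝ)⁻¹ • pullFun (t : ℝ) f) s = (t : ℝ)⁻¹ • fsmul (pullFun (t : ℝ) f) s := by
      ext e
      exact mul_smul (t : ℝ)⁻¹ _ _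
    rw [e, _root_.smul_smul]
    congr 1
    interval_cases p
    · simp
    · simp
  · intro w hw
    refine HasExp.exists_of_local fun e => ?_
    obtain ⟨w', h1, A, B, h2⟩ := hw e.proj
    refine ⟨_, A, B, h2, ?_⟩
    filter_upwards [((FiberBundle.continuous_proj FE VE).tendsto e).eventually h1] with e' he' t
    have h3 : (⟨e', D.pullSec t w e'⟩ : TotalSpace FW VW) = ⟨e', D.pullSec t w' e'⟩ := by
      rw [mk_pullSec, mk_pullSec, he' (scale (t : ℝ) e') rfl]
    exact TotalSpace.mk_inj.1 h3

end DoubleVectorBundle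

/-! ### Invariance of the bracket -/

namespace VBAlgebroid

variable {D : DoubleVectorBundle IM FE VE FA VA FW VW FU VU} (W : VBAlgebroid D)

theorem rho_pullSec (t : ℝˣ) (a : Sec (IM.prod 𝓘(ℝ, FE)) FW VW) :
    W.rho (D.pullSec t a) = pullVF t (W.rho a) := by
  refine sec_ext_mk fun e => ?_
  rw [mk_pullVF]
  have h1 := congrArg W.anchorMap (D.mk_pullSec t a e)
  rw [W.anchor_smul] at h1
  exact h1

/-- On linear and core sections this is the count of weights in the axioms. The Leibniz rule, with
`rho_pullSec` for the anchor, extends it to arbitrary second arguments, and skew-symmetry to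
arbitrary first ones. -/
theorem bracket_pullSec (t : ℝˣ) (a b : Sec (IM.prod 𝓘(ℝ, FE)) FW VW) :
    D.pullSec t (W.bracket a b) = W.bracket (D.pullSec t a) (D.pullSec t b) := by
  have : T2Space (TotalSpace FE VE) := t2Space_totalSpace FE VE
  have hsk : ∀ a b, W.bracket a b = -W.bracket b a := fun a b => br_skew W.bracket_self a b
  have hlocal : ∀ (a b b' : Sec (IM.prod 𝓘(ℝ, FE)) FW VW) (e : TotalSpace FE VE),
      (∀ᶠ e' in 𝓝 e, b e' = b' e') → W.bracket a b e = W.bracket a b' e := by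
    intro a b b' e h
    exact eq_of_forall_dual (F := FW) fun l =>
      (W.isFirstOrder_bracket a e l).eq_of_eventuallyEq h
  have step : ∀ a : Sec (IM.prod 𝓘(ℝ, FE)) FW VW,
      (∀ b, D.IsHom b → D.pullSec t (W.bracket a b) = W.bracket (D.pullSec t a) (D.pullSec t b)) →
      ∀ b, D.pullSec t (W.bracket a b) = W.bracket (D.pullSec t a) (D.pullSec t b) := by
    intro a ha b
    refine D.hom_induction (G := fun b => D.pullSec t (W.bracket a b) =
      W.bracket (D.pullSec t a) (D.pullSec t b)) ?_ ?_ ?_ ?_ b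
    · have : D.pullSec t 0 = 0 := map_zero (D.pullSecₗ t)
      rw [map_zero, this, map_zero]
    · intro s s' h h'
      rw [map_add, D.pullSec_add, D.pullSec_add, map_add, h, h']
    · intro f s hs
      have hpf : pullFun ((t⁻¹ : ℝˣ) : ℝ) (pullFun (t : ℝ) f) = f := by
        simpa using pullFun_pullFun_inv t⁻¹ f
      rw [W.bracket_fsmul, D.pullSec_add, D.pullSec_fsmul, D.pullSec_fsmul, D.pullSec_fsmul,
        W.bracket_fsmul, ha s hs, rho_pullSec, vfApp_pullVF, hpf]
    · intro b hb
      refine sec_ext_mk fun e => ?_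
      obtain ⟨b', h1, h2⟩ := hb e.proj
      have e1 : W.bracket a b (scale (t : ℝ) e) = W.bracket a b' (scale (t : ℝ) e) := by
        refine hlocal _ _ _ _ ?_
        filter_upwards [((FiberBundle.continuous_proj FE VE).tendsto (scale (t : ℝ) e)).eventually
          h1] with e' he'
        exact he' e' rfl
      have e2 : W.bracket (D.pullSec t a) (D.pullSec t b) e =
          W.bracket (D.pullSec t a) (D.pullSec t b') e := by
        refine hlocal _ _ _ _ ?_
        filter_upwards [((FiberBundle.continuous_proj FE VE).tendsto e).eventually h1] with e' he'
        have h3 : (⟨e', D.pullSec t b e'⟩ : TotalSpace FW VW) = ⟨e', D.pullSec t b' e'⟩ := by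
          rw [D.mk_pullSec, D.mk_pullSec, he' (scale (t : ℝ) e') rfl]
        exact TotalSpace.mk_inj.1 h3
      rw [D.mk_pullSec, e1, ← D.mk_pullSec, h2, e2]
  have hhom : ∀ a b, D.IsHom a → D.IsHom b →
      D.pullSec t (W.bracket a b) = W.bracket (D.pullSec t a) (D.pullSec t b) := by
    rintro a b (ha | ha) (hb | hb)
    · rw [(W.bracket_lin_lin a b ha hb).pullSec_eq, ha.pullSec_eq, hb.pullSec_eq]
    · rw [(W.bracket_lin_core a b ha hb).pullSec_eq, ha.pullSec_eq, hb.pullSec_eq, map_smul]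
    · rw [hsk a b, ← neg_one_smul ℝ, D.pullSec_smul, (W.bracket_lin_core b a hb ha).pullSec_eq,
        ha.pullSec_eq, hb.pullSec_eq, map_smul, LinearMap.smul_apply, hsk a b, neg_one_smul,
        smul_neg]
    · rw [W.bracket_core_core a b ha hb, ha.pullSec_eq, hb.pullSec_eq, map_smul, map_smul,
        LinearMap.smul_apply, W.bracket_core_core a b ha hb, smul_zero, smul_zero]
      exact map_zero (D.pullSecₗ t)
  have hone : ∀ a, D.IsHom a → ∀ b,
      D.pullSec t (W.bracket a b) = W.bracket (D.pullSec t a) (D.pullSec t b) := fun a ha =>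
    step a fun b hb => hhom a b ha hb
  refine step a (fun b hb => ?_) b
  rw [hsk a b, ← neg_one_smul ℝ, D.pullSec_smul, hone b hb a, neg_one_smul, ← hsk]

end VBAlgebroid
end Double

/-! ### Families of multiderivations -/

section Families

variable {EB : Type*} [NormedAddCommGroup EB] [NormedSpace ℝ EB]
  {HB : Type*} [TopologicalSpace HB] {IB : ModelWithCorners ℝ EB HB}
  {B : Type*} [TopologicalSpace B] [ChartedSpace HB B] [IsManifold IB ∞ B]
  {F : Type*} [NormedAddCommGroup F] [NormedSpace ℝ F]
  {V : B → Type*} [TopologicalSpace (TotalSpace F V)]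
  [∀ x, AddCommGroup (V x)] [∀ x, Module ℝ (V x)] [∀ x, TopologicalSpace (V x)]
  [FiberBundle F V] [VectorBundle ℝ F V]

/-- Any entry of an alternating map can be moved to the last place. -/
theorem exists_update_eq_snoc {G : Type*} [AddCommGroup G] [Module ℝ G] {k : ℕ}
    (w : Fin (k + 1) → G) (j : Fin (k + 1)) : ∃ (v : Fin k → G) (ε : ℝ), ∀ (N : Type _)
      [AddCommGroup N] [Module ℝ N] (c : G [⋀^Fin (k + 1)]→ₗ[ℝ] N) (u : G),
      c (update w j u) = ε • c (Fin.snoc v u) := by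
  let σ : Equiv.Perm (Fin (k + 1)) := Equiv.swap j (Fin.last k)
  refine ⟨fun i => w (σ i.castSucc), ((Equiv.Perm.sign σ : ℤ) : ℝ), fun N _ _ c u => ?_⟩
  have h0 : (Fin.snoc (fun i => w (σ i.castSucc)) u : Fin (k + 1) → G) =
      update (w ∘ σ) (Fin.last k) u := by
    funext l
    refine Fin.lastCases ?_ (fun l => ?_) l
    · simp
    · simp [(Fin.castSucc_lt_last l).ne]
  have h1 : (Fin.snoc (fun i => w (σ i.castSucc)) u : Fin (k + 1) → G) ∘ σ = update w j u := by
    rw [h0]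
    funext l
    by_cases hl : l = j
    · subst hl
      simp [σ]
    · have h2 : σ l ≠ Fin.last k := by
        intro h
        apply hl
        exact σ.injective (h.trans (Equiv.swap_apply_left j (Fin.last k)).symm)
      rw [comp_apply, update_of_ne h2, update_of_ne hl]
      simp [σ]
  rw [← h1, c.map_perm]
  rcases Int.units_eq_one_or (Equiv.Perm.sign σ) with h | h <;> simp [h]

/-- The order of quantifiers matters: `v` and `ε` depend only on the arguments, so the same ones
serve all members of the family h_t^* c. -/
theorem AlgSym.exists_leib_update {k : ℕ} (w : Fin (k + 1) → Sec IB F V) (j : Fin (k + 1)) :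
    ∃ (v : Fin k → Sec IB F V) (ε : ℝ), ∀ (c : Sec IB F V [⋀^Fin (k + 1)]→ₗ[ℝ] Sec IB F V)
      (X : Sec IB F V [⋀^Fin k]→ₗ[ℝ] VF IB B), AlgSym (⇑c : Cochain IB F V (k + 1)) X →
      ∀ (f : C^∞⟮IB, B; ℝ⟯) (s : Sec IB F V), c (update w j (fsmul f s)) =
        ε • fsmul (vfApp (X v) f) s + fsmul f (c (update w j s)) := by
  obtain ⟨v, ε, h⟩ := exists_update_eq_snoc w j
  refine ⟨v, ε, fun c X hX f s => ?_⟩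
  rw [h, h, hX.1 v f s, smul_add, fsmul_smul]

/-- Multiderivations are local in each entry. -/
theorem AlgSym.apply_update_eq [FiniteDimensional ℝ EB] [T2Space B] [FiniteDimensional ℝ F]
    {k : ℕ} {c : Sec IB F V [⋀^Fin (k + 1)]→ₗ[ℝ] Sec IB F V}
    {X : Sec IB F V [⋀^Fin k]→ₗ[ℝ] VF IB B} (hX : AlgSym (⇑c : Cochain IB F V (k + 1)) X)
    (w : Fin (k + 1) → Sec IB F V) (j : Fin (k + 1)) {s s' : Sec IB F V} {x : B}
    (hs : ∀ᶠ y in 𝓝 x, s y = s' y) : c (update w j s) x = c (update w j s') x := by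
  obtain ⟨v, ε, h⟩ := AlgSym.exists_leib_update w j
  refine eq_of_forall_dual (F := F) fun l => ?_
  have hℓ : IsFirstOrder x (l ∘ₗ evalAt x ∘ₗ c.toMultilinearMap.toLinearMap w j) := by
    refine ⟨fun s => (ε * l (s x)) • X v x, fun f s => ?_⟩
    change l (c (update w j (fsmul f s)) x) = _ + f x * l (c (update w j s) x)
    rw [h c X hX, ContMDiffSection.coe_add, Pi.add_apply, map_add, fsmul_apply,
      ContMDiffSection.coe_smul, Pi.smul_apply, fsmul_apply, map_smul, map_smul, map_smul,
      map_smul, vfApp_apply, smul_eq_mul, smul_eq_mul, smul_eq_mul, smul_eq_mul]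
    ring
  exact hℓ.eq_of_eventuallyEq hs

/-- The coefficients of the expansion of a family of alternating maps are alternating. -/
theorem exists_alternating_hasExp [FiniteDimensional ℝ F] {G : Type*} [AddCommGroup G]
    [Module ℝ G] {k : ℕ} (a : ℝˣ → G [⋀^Fin k]→ₗ[ℝ] Sec IB F V)
    (h : ∀ w, ∃ A B', HasExp (fun t => a t w) A B') :
    ∃ A B' : G [⋀^Fin k]→ₗ[ℝ] Sec IB F V, ∀ w, HasExp (fun t => a t w) (A w) (B' w) := by
  choose A B' h using h
  have hadd : ∀ (w : Fin k → G) i s s', A (update w i (s + s')) = A (update w i s) +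
      A (update w i s') ∧ B' (update w i (s + s')) = B' (update w i s) + B' (update w i s') := by
    intro w i s s'
    -- Uniqueness of expansions transfers each identity from the family to both coefficients.
    refine (h _).unique ?_
    simp only [AlternatingMap.map_update_add]
    exact (h _).add (h _)
  have hsmul : ∀ (w : Fin k → G) i (r : ℝ) s, A (update w i (r • s)) = r • A (update w i s) ∧
      B' (update w i (r • s)) = r • B' (update w i s) := by
    intro w i r s
    refine (h _).unique ?_
    simp only [AlternatingMap.map_update_smul]
    exact (h _).const_smul r
  have halt : ∀ (w : Fin k → G) i j, w i = w j → i ≠ j → A w = 0 ∧ B' w = 0 := by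
    intro w i j hw hij
    refine (h _).unique ?_
    simp only [AlternatingMap.map_eq_zero_of_eq _ w hw hij]
    exact HasExp.zero
  refine ⟨{ toFun := A, map_update_add' := ?_, map_update_smul' := ?_, map_eq_zero_of_eq' :=
    fun w i j hw hij => (halt w i j hw hij).1 },
    { toFun := B', map_update_add' := ?_, map_update_smul' := ?_, map_eq_zero_of_eq' :=
    fun w i j hw hij => (halt w i j hw hij).2 }, h⟩
  · intro inst w i s s'
    obtain rfl : inst = instDecidableEqFin k := Subsingleton.elim _ _
    exact (hadd w i s s').1
  · intro inst w i r s
    obtain rfl : inst = instDecidableEqFin k := Subsingleton.elim _ _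
    exact (hsmul w i r s).1
  · intro inst w i s s'
    obtain rfl : inst = instDecidableEqFin k := Subsingleton.elim _ _
    exact (hadd w i s s').2
  · intro inst w i r s
    obtain rfl : inst = instDecidableEqFin k := Subsingleton.elim _ _
    exact (hsmul w i r s).2

/-- The coefficients of the expansion of a family of multiderivations are multiderivations. -/
theorem AlgSym.of_hasExp [FiniteDimensional ℝ EB] [FiniteDimensional ℝ F] {k : ℕ}
    {a : ℝˣ → Cochain IB F V (k + 1)} {X : ℝˣ → Sec IB F V [⋀^Fin k]→ₗ[ℝ] VF IB B}
    (hX : ∀ t, AlgSym (a t) (X t)) {A A' : Cochain IB F V (k + 1)}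
    {Y Y' : Sec IB F V [⋀^Fin k]→ₗ[ℝ] VF IB B} (hA : ∀ w, HasExp (fun t => a t w) (A w) (A' w))
    (hY : ∀ w, HasExp (fun t => X t w) (Y w) (Y' w)) : AlgSym A Y ∧ AlgSym A' Y' := by
  have h1 : ∀ w f s, A (Fin.snoc w (fsmul f s)) =
      fsmul (vfApp (Y w) f) s + fsmul f (A (Fin.snoc w s)) ∧ A' (Fin.snoc w (fsmul f s)) =
      fsmul (vfApp (Y' w) f) s + fsmul f (A' (Fin.snoc w s)) := by
    intro w f s
    refine (hA _).unique ?_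
    simp only [fun t => (hX t).1 w f s]
    exact (((hY w).vfApp f).fsmul s).add ((hA _).fsmul f)
  have h2 : ∀ w i f s, Y (update w i (fsmul f s)) = fsmul f (Y (update w i s)) ∧
      Y' (update w i (fsmul f s)) = fsmul f (Y' (update w i s)) := by
    intro w i f s
    refine (hY _).unique ?_
    simp only [(hX _).2]
    exact (hY _).fsmul f
  exact ⟨⟨fun w f s => (h1 w f s).1, fun w i f s => (h2 w i f s).1⟩,
    ⟨fun w f s => (h1 w f s).2, fun w i f s => (h2 w i f s).2⟩⟩

/-- The differential of a family of cochains with an expansion. -/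
theorem LieAlgebroid.exp0_diffFun (L : LieAlgebroid IB F V) {k : ℕ} {a : ℝˣ → Cochain IB F V k}
    {A A' : Cochain IB F V k} (hA : ∀ w, HasExp (fun t => a t w) (A w) (A' w))
    (w : Fin (k + 1) → Sec IB F V) (x : B) (l : V x →ₗ[ℝ] ℝ) :
    Exp0 (fun t => l (L.diffFun (a t) w x)) (l (L.diffFun A w x)) (l (L.diffFun A' w x)) := by
  -- Pointwise convergence would not suffice here, because the bracket differentiates `a t v`; it is
  -- a functional of order one in that argument.
  have hb : ∀ (b : Sec IB F V) v, Exp0 (fun t => l (L.bracket b (a t v) x))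
      (l (L.bracket b (A v) x)) (l (L.bracket b (A' v) x)) := fun b v =>
    hA v x _ (L.isFirstOrder_bracket b x l)
  cases k with
  | zero => exact hb _ _
  | succ k =>
    simp only [LieAlgebroid.diffFun, ContMDiffSection.coe_add, Pi.add_apply, sec_sum_apply,
      map_add, map_sum, ContMDiffSection.coe_smul, Pi.smul_apply, map_smul, smul_eq_mul]
    refine (Exp0.sum _ fun i _ => (hb _ _).const_mul _).add
      (Exp0.sum _ fun j _ => Exp0.sum _ fun i _ => ((hA _).apply x l).const_mul _)

end Families

/-! ### Expansion of the pull-back of multiderivations -/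

section Double

variable {EM : Type*} [NormedAddCommGroup EM] [NormedSpace ℝ EM]
  {HM : Type*} [TopologicalSpace HM] {IM : ModelWithCorners ℝ EM HM}
  {M : Type*} [TopologicalSpace M] [ChartedSpace HM M] [IsManifold IM ∞ M]
  {FE : Type*} [NormedAddCommGroup FE] [NormedSpace ℝ FE]
  {VE : M → Type*} [TopologicalSpace (TotalSpace FE VE)]
  [∀ x, AddCommGroup (VE x)] [∀ x, Module ℝ (VE x)] [∀ x, TopologicalSpace (VE x)]
  [FiberBundle FE VE] [VectorBundle ℝ FE VE] [ContMDiffVectorBundle ∞ FE VE IM]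
  {FA : Type*} [NormedAddCommGroup FA] [NormedSpace ℝ FA]
  {VA : M → Type*} [TopologicalSpace (TotalSpace FA VA)]
  [∀ x, AddCommGroup (VA x)] [∀ x, Module ℝ (VA x)] [∀ x, TopologicalSpace (VA x)]
  [FiberBundle FA VA] [VectorBundle ℝ FA VA] [ContMDiffVectorBundle ∞ FA VA IM]
  {FW : Type*} [NormedAddCommGroup FW] [NormedSpace ℝ FW]
  {VW : TotalSpace FE VE → Type*} [TopologicalSpace (TotalSpace FW VW)]
  [∀ x, AddCommGroup (VW x)] [∀ x, Module ℝ (VW x)] [∀ x, TopologicalSpace (VW x)]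
  [FiberBundle FW VW] [VectorBundle ℝ FW VW]
  [ContMDiffVectorBundle ∞ FW VW (IM.prod 𝓘(ℝ, FE))]
  {FU : Type*} [NormedAddCommGroup FU] [NormedSpace ℝ FU]
  {VU : TotalSpace FA VA → Type*} [TopologicalSpace (TotalSpace FU VU)]
  [∀ x, AddCommGroup (VU x)] [∀ x, Module ℝ (VU x)] [∀ x, TopologicalSpace (VU x)]
  [FiberBundle FU VU] [VectorBundle ℝ FU VU]
  [ContMDiffVectorBundle ∞ FU VU (IM.prod 𝓘(ℝ, FA))]
  [FiniteDimensional ℝ EM] [FiniteDimensional ℝ FE] [FiniteDimensional ℝ FW] [T2Space M]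


namespace DoubleVectorBundle

variable (D : DoubleVectorBundle IM FE VE FA VA FW VW FU VU)

/-- The pull-back of alternating maps. -/
def pullAlt {k : ℕ} (t : ℝˣ)
    (a : Sec (IM.prod 𝓘(ℝ, FE)) FW VW [⋀^Fin k]→ₗ[ℝ] Sec (IM.prod 𝓘(ℝ, FE)) FW VW) :
    Sec (IM.prod 𝓘(ℝ, FE)) FW VW [⋀^Fin k]→ₗ[ℝ] Sec (IM.prod 𝓘(ℝ, FE)) FW VW :=
  (D.pullSecₗ t).compAlternatingMap (a.compLinearMap (D.pullSecₗ t⁻¹))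

theorem coe_pullAlt {k : ℕ} (t : ℝˣ)
    (a : Sec (IM.prod 𝓘(ℝ, FE)) FW VW [⋀^Fin k]→ₗ[ℝ] Sec (IM.prod 𝓘(ℝ, FE)) FW VW) :
    ⇑(D.pullAlt t a) = D.pull t a := rfl

/-- The pull-back of symbols. -/
def pullSym {k : ℕ} (t : ℝˣ) (X : Sec (IM.prod 𝓘(ℝ, FE)) FW VW [⋀^Fin k]→ₗ[ℝ]
      VF (IM.prod 𝓘(ℝ, FE)) (TotalSpace FE VE)) :
    Sec (IM.prod 𝓘(ℝ, FE)) FW VW [⋀^Fin k]→ₗ[ℝ] VF (IM.prod 𝓘(ℝ, FE)) (TotalSpace FE VE) :=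
  (pullVFₗ t).compAlternatingMap (X.compLinearMap (D.pullSecₗ t⁻¹))

theorem pullSym_apply {k : ℕ} (t : ℝˣ) (X : Sec (IM.prod 𝓘(ℝ, FE)) FW VW [⋀^Fin k]→ₗ[ℝ]
      VF (IM.prod 𝓘(ℝ, FE)) (TotalSpace FE VE)) (w : Fin k → Sec (IM.prod 𝓘(ℝ, FE)) FW VW) :
    D.pullSym t X w = pullVF t (X fun i => D.pullSec t⁻¹ (w i)) := rfl

/-- The inner pull-back replaces f(e) by f(t⁻¹e) and the outer one restores it, so the rules survive
with the conjugated symbol. -/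
theorem algSym_pull {k : ℕ} {c : Cochain (IM.prod 𝓘(ℝ, FE)) FW VW (k + 1)}
    {X : Sec (IM.prod 𝓘(ℝ, FE)) FW VW [⋀^Fin k]→ₗ[ℝ] VF (IM.prod 𝓘(ℝ, FE)) (TotalSpace FE VE)}
    (hX : AlgSym c X) (t : ℝˣ) : AlgSym (D.pull t c) (D.pullSym t X) := by
  have hs : ∀ (w : Fin k → Sec (IM.prod 𝓘(ℝ, FE)) FW VW) s,
      (fun i => D.pullSec t⁻¹ ((Fin.snoc w s : Fin (k + 1) → Sec (IM.prod 𝓘(ℝ, FE)) FW VW) i)) =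
      Fin.snoc (fun i => D.pullSec t⁻¹ (w i)) (D.pullSec t⁻¹ s) := by
    intro w s
    funext i
    refine Fin.lastCases ?_ (fun i => ?_) i <;> simp
  have hu : ∀ (w : Fin k → Sec (IM.prod 𝓘(ℝ, FE)) FW VW) i s,
      (fun j => D.pullSec t⁻¹ (update w i s j)) =
      update (fun j => D.pullSec t⁻¹ (w j)) i (D.pullSec t⁻¹ s) := by
    intro w i s
    funext j
    by_cases hj : j = i
    · subst hj; simp
    · simp [hj]
  constructor
  · intro w f s
    simp only [pull]
    rw [hs, hs, D.pullSec_fsmul, hX.1, D.pullSec_add, D.pullSec_fsmul, D.pullSec_fsmul,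
      D.pullSec_pullSec_inv, pullFun_pullFun_inv, pullSym_apply, vfApp_pullVF]
  · intro w i f s
    rw [pullSym_apply, pullSym_apply, hu, hu, D.pullSec_fsmul, hX.2, pullVF_fsmul,
      pullFun_pullFun_inv]

/-- Homogeneous sections only contribute non-negative powers. -/
theorem exists_pow_smul {k : ℕ} {N : Type*} [AddCommGroup N] [Module ℝ N]
    (X : Sec (IM.prod 𝓘(ℝ, FE)) FW VW [⋀^Fin k]→ₗ[ℝ] N)
    {w : Fin k → Sec (IM.prod 𝓘(ℝ, FE)) FW VW} (hw : ∀ i, D.IsHom (w i)) :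
    ∃ n : ℕ, ∀ t : ℝˣ, X (fun i => D.pullSec t⁻¹ (w i)) = (t : ℝ) ^ n • X w := by
  choose p _ hp using fun i => (hw i).exists_weight
  refine ⟨∑ i, p i, fun t => ?_⟩
  simp only [hp, Units.val_inv_eq_inv_val, inv_inv]
  rw [← Finset.prod_pow_eq_pow_sum]
  exact X.toMultilinearMap.map_smul_univ (fun i => (t : ℝ) ^ p i) w

variable [IM.Boundaryless]

/-- For homogeneous arguments the pulled-back symbol is t^n h_t^*(X w). Linearity over functions
does the rest: a fixed function multiplies an expansion harmlessly. -/
theorem exists_hasExp_pullSym {k : ℕ} {c : Cochain (IM.prod 𝓘(ℝ, FE)) FW VW (k + 1)}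
    {X : Sec (IM.prod 𝓘(ℝ, FE)) FW VW [⋀^Fin k]→ₗ[ℝ] VF (IM.prod 𝓘(ℝ, FE)) (TotalSpace FE VE)}
    (hX : AlgSym c X) (w : Fin k → Sec (IM.prod 𝓘(ℝ, FE)) FW VW) :
    ∃ A B, HasExp (fun t => D.pullSym t X w) A B := by
  have : T2Space (TotalSpace FE VE) := t2Space_totalSpace FE VE
  refine D.hom_induction_multi (G := fun w => ∃ A B, HasExp (fun t => D.pullSym t X w) A B)
    (fun w hw => ?_) (fun w i => ?_) (fun w i s s' => ?_) (fun w i f s => ?_) (fun w i h => ?_) w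
  · obtain ⟨n, hn⟩ := D.exists_pow_smul X hw
    obtain ⟨A, B, h⟩ := exists_hasExp_pullVF (X w)
    obtain ⟨A', B', h'⟩ := h.pow_smul n
    refine ⟨A', B', ?_⟩
    convert h' using 2 with t
    rw [pullSym_apply, hn]
    exact map_smul (pullVFₗ t) _ _
  · simp only [AlternatingMap.map_update_zero]
    exact ⟨0, 0, HasExp.zero⟩
  · rintro ⟨A, B, h⟩ ⟨A', B', h'⟩
    simp only [AlternatingMap.map_update_add]
    exact ⟨_, _, h.add h'⟩
  · rintro ⟨A, B, h⟩
    simp only [(D.algSym_pull hX _).2]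
    exact ⟨_, _, h.fsmul f⟩
  · refine HasExp.exists_of_local fun e => ?_
    obtain ⟨s, h1, A, B, h2⟩ := h e
    refine ⟨_, A, B, h2, ?_⟩
    filter_upwards [h1] with e' he' t
    refine apply_eq_of_tensorial (D.algSym_pull hX t).2 fun j => ?_
    by_cases hj : j = i
    · subst hj; rw [update_self, he']
    · rw [update_of_ne hj]

/-- The argument for symbols applies, except that multiplying an entry by f adds the derivative of f
along the pulled-back symbol; that term is expanded by `exists_hasExp_pullSym` and `HasExp.vfApp`.
-/
theorem exists_hasExp_pullAlt {k : ℕ}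
    (a : Sec (IM.prod 𝓘(ℝ, FE)) FW VW [⋀^Fin k]→ₗ[ℝ] Sec (IM.prod 𝓘(ℝ, FE)) FW VW)
    (ha : HasSymbol (⇑a : Cochain (IM.prod 𝓘(ℝ, FE)) FW VW k))
    (w : Fin k → Sec (IM.prod 𝓘(ℝ, FE)) FW VW) :
    ∃ A B, HasExp (fun t => D.pullAlt t a w) A B := by
  have : T2Space (TotalSpace FE VE) := t2Space_totalSpace FE VE
  have hbase : ∀ w, (∀ i, D.IsHom (w i)) → ∃ A B, HasExp (fun t => D.pullAlt t a w) A B := by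
    intro w hw
    obtain ⟨n, hn⟩ := D.exists_pow_smul a hw
    obtain ⟨A, B, h⟩ := D.exists_hasExp_pullSec (a w)
    obtain ⟨A', B', h'⟩ := h.pow_smul n
    refine ⟨A', B', ?_⟩
    convert h' using 2 with t
    rw [coe_pullAlt, pull, hn, pullSec_smul]
  cases k with
  | zero => exact hbase w fun i => i.elim0
  | succ k =>
    obtain ⟨σ, hσ⟩ := ha
    obtain ⟨X, hX⟩ := hσ.exists_algSym
    refine D.hom_induction_multi (G := fun w => ∃ A B, HasExp (fun t => D.pullAlt t a w) A B)
      hbase (fun w i => ?_) (fun w i s s' => ?_) (fun w i f s => ?_) (fun w i h => ?_) w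
    · simp only [AlternatingMap.map_update_zero]
      exact ⟨0, 0, HasExp.zero⟩
    · rintro ⟨A, B, h⟩ ⟨A', B', h'⟩
      simp only [AlternatingMap.map_update_add]
      exact ⟨_, _, h.add h'⟩
    · rintro ⟨A, B, h⟩
      obtain ⟨v, ε, hv⟩ := AlgSym.exists_leib_update w i
      obtain ⟨Y, Z, hY⟩ := D.exists_hasExp_pullSym hX v
      simp only [fun t => hv (D.pullAlt t a) _ (D.algSym_pull hX t)]
      exact ⟨_, _, (((hY.vfApp f).fsmul s).const_smul ε).add (h.fsmul f)⟩
    · refine HasExp.exists_of_local fun e => ?_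
      obtain ⟨s, h1, A, B, h2⟩ := h e
      refine ⟨_, A, B, h2, ?_⟩
      filter_upwards [eventually_eventually_nhds.2 h1] with e' he' t
      have hX' : AlgSym ⇑(D.pullAlt t a) _ := D.algSym_pull hX t
      have h3 := hX'.apply_update_eq w i he'
      rwa [update_eq_self] at h3

/-- The coefficients of the expansion have weights. -/
theorem pull_coeff {k : ℕ} {c A B : Cochain (IM.prod 𝓘(ℝ, FE)) FW VW k}
    (h : ∀ w, HasExp (fun t => D.pull t c w) (A w) (B w)) (s : ℝˣ) :
    D.pull s A = (s : ℝ)⁻¹ • A ∧ D.pull s B = B := by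
  have key : ∀ w (e : TotalSpace FE VE) (l : VW e →ₗ[ℝ] ℝ),
      l (D.pull s A w e) = (s : ℝ)⁻¹ * l (A w e) ∧ l (D.pull s B w e) = l (B w e) := by
    intro w e l
    -- The value of h_s^* σ at e depends only on σ at the point s e, so the functional is tensorial
    -- there.
    have h1 : IsFirstOrder (scale (s : ℝ) e) (l ∘ₗ evalAt e ∘ₗ D.pullSecₗ s) := by
      refine isFirstOrder_of_tensorial fun f σ => ?_
      change l (D.pullSec s (fsmul f σ) e) = f (scale (s : ℝ) e) * l (D.pullSec s σ e)
      rw [D.pullSec_fsmul, fsmul_apply, map_smul, smul_eq_mul, pullFun_apply]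
    have h2 := h (fun i => D.pullSec s⁻¹ (w i)) _ _ h1
    have h3 : ∀ t, D.pullSec s (D.pull t c fun i => D.pullSec s⁻¹ (w i)) = D.pull (s * t) c w := by
      intro t
      simp only [pull]
      rw [D.pullSec_pullSec]
      simp only [D.pullSec_pullSec, mul_inv_rev]
    have h4 : ∀ t, (l ∘ₗ evalAt e ∘ₗ D.pullSecₗ s) (D.pull t c fun i => D.pullSec s⁻¹ (w i)) =
        l (D.pull (s * t) c w e) := fun t => by
      rw [← h3]; rfl
    simp only [h4] at h2
    -- The same function of t is expanded twice: through h_s^* of the coefficients, and by rescaling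
    -- the parameter.
    exact h2.unique (((h w).apply e l).comp_mul s)
  constructor <;> funext w <;> ext e <;> refine eq_of_forall_dual (F := FW) fun l => ?_
  · rw [(key w e l).1]
    exact (map_smul l _ _).symm
  · exact (key w e l).2

/-- Every multiderivation has an expansion with a core and a linear coefficient. -/
theorem exists_expansion {k : ℕ} {c : Cochain (IM.prod 𝓘(ℝ, FE)) FW VW k}
    (hc : c ∈ multiDer (IM.prod 𝓘(ℝ, FE)) FW VW k) :
    ∃ (A : D.multiDerCore k) (B : D.multiDerLin k),
      ∀ w, HasExp (fun t => D.pull t c w) (A.1 w) (B.1 w) := by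
  have : T2Space (TotalSpace FE VE) := t2Space_totalSpace FE VE
  obtain ⟨⟨a, rfl⟩, ha⟩ := hc
  obtain ⟨A, B, h⟩ := exists_alternating_hasExp (fun t => D.pullAlt t a)
    (D.exists_hasExp_pullAlt a ha)
  have hsym : HasSymbol (⇑A : Cochain (IM.prod 𝓘(ℝ, FE)) FW VW k) ∧
      HasSymbol (⇑B : Cochain (IM.prod 𝓘(ℝ, FE)) FW VW k) := by
    cases k with
    | zero => exact ⟨trivial, trivial⟩
    | succ k =>
      obtain ⟨σ, hσ⟩ := ha
      obtain ⟨X, hX⟩ := hσ.exists_algSym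
      obtain ⟨Y, Z, hY⟩ := exists_alternating_hasExp (fun t => D.pullSym t X)
        (D.exists_hasExp_pullSym hX)
      have := AlgSym.of_hasExp (D.algSym_pull hX) h hY
      exact ⟨this.1.hasSymbol, this.2.hasSymbol⟩
  refine ⟨⟨A, ⟨⟨A, rfl⟩, hsym.1⟩, fun t _ => ?_⟩, ⟨B, ⟨⟨B, rfl⟩, hsym.2⟩, fun t _ => ?_⟩, h⟩
  · rw [(D.pull_coeff h t).1, zpow_neg_one]
  · rw [(D.pull_coeff h t).2, zpow_zero, one_smul]

/-- The expansion of a linear multiderivation. -/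
theorem expansion_of_mem_lin {k : ℕ} {c A B : Cochain (IM.prod 𝓘(ℝ, FE)) FW VW k}
    (hc : c ∈ D.multiDerLin k) (h : ∀ w, HasExp (fun t => D.pull t c w) (A w) (B w)) : B = c := by
  funext w
  ext e
  refine eq_of_forall_dual (F := FW) fun l => ?_
  -- Along positive t the pull-back is constantly c, which determines both coefficients.
  have := nzero_neBot_pos
  have h1 := (h w).apply e l
  have h2 : ∀ᶠ t : ℝˣ in nzero ⊓ 𝓟 {t : ℝˣ | 0 < (t : ℝ)}, l (D.pull t c w e) = l (c w e) := by
    refine eventually_inf_principal.2 (Eventually.of_forall fun t ht => ?_)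
    rw [hc.2 t ht, zpow_zero, one_smul]
  have h3 : l (A w e) = 0 := by
    have h4 : Tendsto (fun t : ℝˣ => (t : ℝ) * l (c w e)) nzero (𝓝 0) := by
      simpa using tendsto_nzero.mul_const (l (c w e))
    refine tendsto_nhds_unique (l := nzero ⊓ 𝓟 {t : ℝˣ | 0 < (t : ℝ)})
      (h1.tendsto_mul.mono_left inf_le_left) ((h4.mono_left inf_le_left).congr' ?_)
    filter_upwards [h2] with t ht
    rw [ht]
  refine tendsto_nhds_unique (l := nzero ⊓ 𝓟 {t : ℝˣ | 0 < (t : ℝ)})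
    (Tendsto.mono_left h1 inf_le_left) (tendsto_const_nhds.congr' ?_)
  filter_upwards [h2] with t ht
  rw [h3, ht, mul_zero, sub_zero]

theorem tendstoZero_core {k : ℕ} {c A B : Cochain (IM.prod 𝓘(ℝ, FE)) FW VW k}
    (h : ∀ w, HasExp (fun t => D.pull t c w) (A w) (B w)) :
    TendstoZero (fun t : ℝˣ => (t : ℝ) • D.pull t c) A := fun w e =>
  (tendsto_fibre_iff (F := FW)).2 fun l => ((h w).apply e l).tendsto_mul.congr fun _ =>
    (map_smul l _ _).symm

theorem tendstoZero_lin {k : ℕ} {c A B : Cochain (IM.prod 𝓘(ℝ, FE)) FW VW k}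
    (h : ∀ w, HasExp (fun t => D.pull t c w) (A w) (B w)) :
    TendstoZero (fun t : ℝˣ => D.pull t c - (t : ℝ)⁻¹ • A) B := fun w e =>
  (tendsto_fibre_iff (F := FW)).2 fun l => Tendsto.congr (fun t => by
    refine Eq.trans ?_ (map_sub l _ _).symm
    exact congrArg _ (map_smul l _ _).symm) ((h w).apply e l)

end DoubleVectorBundle

namespace VBAlgebroid

variable {D : DoubleVectorBundle IM FE VE FA VA FW VW FU VU} (W : VBAlgebroid D)

/-- The differential is invariant under the pull-backs. -/
theorem pull_diffFun {k : ℕ} (t : ℝˣ) (c : Cochain (IM.prod 𝓘(ℝ, FE)) FW VW k) :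
    D.pull t (W.diffFun c) = W.diffFun (D.pull t c) := by
  have hb : ∀ (a b : Sec (IM.prod 𝓘(ℝ, FE)) FW VW),
      D.pullSec t (W.bracket (D.pullSec t⁻¹ a) b) = W.bracket a (D.pullSec t b) := by
    intro a b
    rw [W.bracket_pullSec, D.pullSec_pullSec_inv]
  funext w
  cases k with
  | zero => exact hb _ _
  | succ k =>
    change D.pullSecₗ t _ = _
    simp only [LieAlgebroid.diffFun, map_add, map_sum, map_smul]
    congr 1
    · refine Finset.sum_congr rfl fun i _ => ?_
      congr 1
      exact hb _ _
    · refine Finset.sum_congr rfl fun j _ => Finset.sum_congr rfl fun i _ => ?_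
      congr 1
      change D.pullSec t _ = D.pullSec t _
      congr 2
      rw [← W.bracket_pullSec]
      funext m
      refine Fin.cases rfl (fun m => rfl) m

end VBAlgebroid

end Double

/-! ### The linearization map -/

section Double

variable {EM : Type*} [NormedAddCommGroup EM] [NormedSpace ℝ EM]
  {HM : Type*} [TopologicalSpace HM] {IM : ModelWithCorners ℝ EM HM}
  {M : Type*} [TopologicalSpace M] [ChartedSpace HM M] [IsManifold IM ∞ M]
  {FE : Type*} [NormedAddCommGroup FE] [NormedSpace ℝ FE]
  {VE : M → Type*} [TopologicalSpace (TotalSpace FE VE)]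
  [∀ x, AddCommGroup (VE x)] [∀ x, Module ℝ (VE x)] [∀ x, TopologicalSpace (VE x)]
  [FiberBundle FE VE] [VectorBundle ℝ FE VE] [ContMDiffVectorBundle ∞ FE VE IM]
  {FA : Type*} [NormedAddCommGroup FA] [NormedSpace ℝ FA]
  {VA : M → Type*} [TopologicalSpace (TotalSpace FA VA)]
  [∀ x, AddCommGroup (VA x)] [∀ x, Module ℝ (VA x)] [∀ x, TopologicalSpace (VA x)]
  [FiberBundle FA VA] [VectorBundle ℝ FA VA] [ContMDiffVectorBundle ∞ FA VA IM]
  {FW : Type*} [NormedAddCommGroup FW] [NormedSpace ℝ FW]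
  {VW : TotalSpace FE VE → Type*} [TopologicalSpace (TotalSpace FW VW)]
  [∀ x, AddCommGroup (VW x)] [∀ x, Module ℝ (VW x)] [∀ x, TopologicalSpace (VW x)]
  [FiberBundle FW VW] [VectorBundle ℝ FW VW]
  [ContMDiffVectorBundle ∞ FW VW (IM.prod 𝓘(ℝ, FE))]
  {FU : Type*} [NormedAddCommGroup FU] [NormedSpace ℝ FU]
  {VU : TotalSpace FA VA → Type*} [TopologicalSpace (TotalSpace FU VU)]
  [∀ x, AddCommGroup (VU x)] [∀ x, Module ℝ (VU x)] [∀ x, TopologicalSpace (VU x)]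
  [FiberBundle FU VU] [VectorBundle ℝ FU VU]
  [ContMDiffVectorBundle ∞ FU VU (IM.prod 𝓘(ℝ, FA))]
  [FiniteDimensional ℝ EM] [FiniteDimensional ℝ FE] [FiniteDimensional ℝ FW] [T2Space M]

  [IM.Boundaryless]

namespace DoubleVectorBundle

variable (D : DoubleVectorBundle IM FE VE FA VA FW VW FU VU)

/-- The coefficient of `t⁻¹` in the expansion of `h_t^* c`. -/
def coreFun {k : ℕ} (c : multiDer (IM.prod 𝓘(ℝ, FE)) FW VW k) : D.multiDerCore k :=
  (D.exists_expansion c.2).choose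

/-- The constant coefficient in the expansion of `h_t^* c`. -/
def linFun {k : ℕ} (c : multiDer (IM.prod 𝓘(ℝ, FE)) FW VW k) : D.multiDerLin k :=
  (D.exists_expansion c.2).choose_spec.choose

theorem hasExp_pull {k : ℕ} (c : multiDer (IM.prod 𝓘(ℝ, FE)) FW VW k)
    (w : Fin k → Sec (IM.prod 𝓘(ℝ, FE)) FW VW) :
    HasExp (fun t => D.pull t c.1 w) ((D.coreFun c).1 w) ((D.linFun c).1 w) :=
  (D.exists_expansion c.2).choose_spec.choose_spec w

theorem eq_of_hasExp {k : ℕ} (c : multiDer (IM.prod 𝓘(ℝ, FE)) FW VW k)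
    {A B : Cochain (IM.prod 𝓘(ℝ, FE)) FW VW k}
    (h : ∀ w, HasExp (fun t => D.pull t c.1 w) (A w) (B w)) :
    (D.coreFun c).1 = A ∧ (D.linFun c).1 = B :=
  ⟨funext fun w => ((D.hasExp_pull c w).unique (h w)).1,
    funext fun w => ((D.hasExp_pull c w).unique (h w)).2⟩

theorem coreFun_linFun_add {k : ℕ} (c c' : multiDer (IM.prod 𝓘(ℝ, FE)) FW VW k) :
    (D.coreFun (c + c')).1 = (D.coreFun c).1 + (D.coreFun c').1 ∧
      (D.linFun (c + c')).1 = (D.linFun c).1 + (D.linFun c').1 := by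
  refine D.eq_of_hasExp _ fun w => ?_
  have e : ∀ t, D.pull t (c + c').1 w = D.pull t c.1 w + D.pull t c'.1 w := fun t =>
    D.pullSec_add t _ _
  simp only [e]
  exact (D.hasExp_pull c w).add (D.hasExp_pull c' w)

theorem coreFun_linFun_smul {k : ℕ} (r : ℝ) (c : multiDer (IM.prod 𝓘(ℝ, FE)) FW VW k) :
    (D.coreFun (r • c)).1 = r • (D.coreFun c).1 ∧ (D.linFun (r • c)).1 = r • (D.linFun c).1 := by
  refine D.eq_of_hasExp _ fun w => ?_
  have e : ∀ t, D.pull t (r • c).1 w = r • D.pull t c.1 w := fun t => D.pullSec_smul t r _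
  simp only [e]
  exact (D.hasExp_pull c w).const_smul r

/-- The map `core`. -/
def core (k : ℕ) : multiDer (IM.prod 𝓘(ℝ, FE)) FW VW k →ₗ[ℝ] D.multiDerCore k where
  toFun := D.coreFun
  map_add' c c' := Subtype.ext (D.coreFun_linFun_add c c').1
  map_smul' r c := Subtype.ext (D.coreFun_linFun_smul r c).1

/-- The linearization map. -/
def lin (k : ℕ) : multiDer (IM.prod 𝓘(ℝ, FE)) FW VW k →ₗ[ℝ] D.multiDerLin k where
  toFun := D.linFun
  map_add' c c' := Subtype.ext (D.coreFun_linFun_add c c').2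
  map_smul' r c := Subtype.ext (D.coreFun_linFun_smul r c).2

theorem lin_inclusion (k : ℕ) (c : D.multiDerLin k) :
    D.lin k (Submodule.inclusion (D.multiDerLin_le k) c) = c := by
  have h := D.hasExp_pull (Submodule.inclusion (D.multiDerLin_le k) c)
  rw [Submodule.coe_inclusion] at h
  have h2 : (D.linFun (Submodule.inclusion (D.multiDerLin_le k) c)).1 = c.1 :=
    D.expansion_of_mem_lin c.2 h
  exact Subtype.ext h2

theorem isCompl_range_inclusion_ker_lin (k : ℕ) :
    IsCompl (LinearMap.range (Submodule.inclusion (D.multiDerLin_le k)))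
      (LinearMap.ker (D.lin k)) := by
  refine ⟨Submodule.disjoint_def.2 ?_, codisjoint_iff.2 (eq_top_iff.2 fun c _ => ?_)⟩
  · rintro _ ⟨c, rfl⟩ hc
    rw [LinearMap.mem_ker, D.lin_inclusion] at hc
    rw [hc, map_zero]
  · rw [← add_sub_cancel (Submodule.inclusion (D.multiDerLin_le k) (D.lin k c)) c]
    refine Submodule.add_mem_sup ⟨_, rfl⟩ ?_
    rw [LinearMap.mem_ker, map_sub, D.lin_inclusion, sub_self]

end DoubleVectorBundle

namespace VBAlgebroid

variable {D : DoubleVectorBundle IM FE VE FA VA FW VW FU VU} (W : VBAlgebroid D)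

theorem diff_mem (k : ℕ) : ∀ c ∈ multiDer (IM.prod 𝓘(ℝ, FE)) FW VW k,
    W.diff k c ∈ multiDer (IM.prod 𝓘(ℝ, FE)) FW VW (k + 1) := fun _ hc => by
  have : T2Space (TotalSpace FE VE) := t2Space_totalSpace FE VE
  exact W.diff_mem_multiDer hc

theorem diff_mem_multiDerLin (k : ℕ) : ∀ c ∈ D.multiDerLin k, W.diff k c ∈ D.multiDerLin (k + 1) := by
  refine fun c hc => ⟨W.diff_mem k c hc.1, fun t ht => ?_⟩
  refine (W.pull_diffFun t c).trans ?_
  rw [hc.2 t ht, zpow_zero, one_smul, one_smul]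
  rfl

/-- h_t^* δc = δ h_t^* c is expanded on the left by the definition of lin and on the right term by
term; the constant coefficients agree. -/
theorem lin_diff (k : ℕ) (c : multiDer (IM.prod 𝓘(ℝ, FE)) FW VW k) :
    D.lin (k + 1) ((W.diff k).restrict (W.diff_mem k) c) =
      (W.diff k).restrict (W.diff_mem_multiDerLin k) (D.lin k c) := by
  refine Subtype.ext (funext fun w => ?_)
  ext e
  refine eq_of_forall_dual (F := FW) fun l => ?_
  have h1 := (D.hasExp_pull ((W.diff k).restrict (W.diff_mem k) c) w).apply e l
  have h2 := W.exp0_diffFun (D.hasExp_pull c) w e l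
  have h3 : ∀ t, D.pull t ((W.diff k).restrict (W.diff_mem k) c).1 w =
      W.diffFun (D.pull t c.1) w := fun t => congrFun (W.pull_diffFun t c.1) w
  simp only [h3] at h1
  exact (h1.unique h2).2

/-- If a linear cocycle c equals δb, then c = lin c = δ(lin b). In the lowest degree there are no
coboundaries. -/
theorem cohomologyMap_injective (k : ℕ) : Injective (W.cohomologyMap D.multiDerLin_le k) := by
  rw [injective_iff_map_eq_zero]
  intro x hx
  obtain ⟨c, rfl⟩ := Submodule.Quotient.mk_surjective _ x
  rw [Submodule.Quotient.mk_eq_zero]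
  have h1 := (Submodule.Quotient.mk_eq_zero _).1 hx
  cases k with
  | zero => exact h1
  | succ k =>
    obtain ⟨b, hb, hbc⟩ := h1
    refine ⟨(D.lin k ⟨b, hb⟩).1, (D.lin k ⟨b, hb⟩).2, ?_⟩
    have h2 := congrArg Subtype.val (W.lin_diff k ⟨b, hb⟩)
    refine h2.symm.trans ?_
    have h3 : (W.diff k).restrict (W.diff_mem k) ⟨b, hb⟩ =
        Submodule.inclusion (D.multiDerLin_le (k + 1)) ⟨c.1, c.2.1⟩ := Subtype.ext hbc
    rw [h3, D.lin_inclusion]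
    rfl

end VBAlgebroid

end Double

end VBDef

end

/-! ### The linearization theorem -/

theorem mainTheorem4
    {EM : Type*} [NormedAddCommGroup EM] [NormedSpace ℝ EM] [FiniteDimensional ℝ EM]
    {HM : Type*} [TopologicalSpace HM] {IM : ModelWithCorners ℝ EM HM} [IM.Boundaryless]
    {M : Type*} [TopologicalSpace M] [ChartedSpace HM M] [IsManifold IM ∞ M]
    [T2Space M] [SecondCountableTopology M]
    {FE : Type*} [NormedAddCommGroup FE] [NormedSpace ℝ FE] [FiniteDimensional ℝ FE]
    {VE : M → Type*} [TopologicalSpace (TotalSpace FE VE)]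
    [∀ x, AddCommGroup (VE x)] [∀ x, Module ℝ (VE x)] [∀ x, TopologicalSpace (VE x)]
    [FiberBundle FE VE] [VectorBundle ℝ FE VE] [ContMDiffVectorBundle ∞ FE VE IM]
    {FA : Type*} [NormedAddCommGroup FA] [NormedSpace ℝ FA] [FiniteDimensional ℝ FA]
    {VA : M → Type*} [TopologicalSpace (TotalSpace FA VA)]
    [∀ x, AddCommGroup (VA x)] [∀ x, Module ℝ (VA x)] [∀ x, TopologicalSpace (VA x)]
    [FiberBundle FA VA] [VectorBundle ℝ FA VA] [ContMDiffVectorBundle ∞ FA VA IM]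
    {FW : Type*} [NormedAddCommGroup FW] [NormedSpace ℝ FW] [FiniteDimensional ℝ FW]
    {VW : TotalSpace FE VE → Type*} [TopologicalSpace (TotalSpace FW VW)]
    [∀ x, AddCommGroup (VW x)] [∀ x, Module ℝ (VW x)] [∀ x, TopologicalSpace (VW x)]
    [FiberBundle FW VW] [VectorBundle ℝ FW VW]
    [ContMDiffVectorBundle ∞ FW VW (IM.prod 𝓘(ℝ, FE))]
    {FU : Type*} [NormedAddCommGroup FU] [NormedSpace ℝ FU] [FiniteDimensional ℝ FU]
    {VU : TotalSpace FA VA → Type*} [TopologicalSpace (TotalSpace FU VU)]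
    [∀ x, AddCommGroup (VU x)] [∀ x, Module ℝ (VU x)] [∀ x, TopologicalSpace (VU x)]
    [FiberBundle FU VU] [VectorBundle ℝ FU VU]
    [ContMDiffVectorBundle ∞ FU VU (IM.prod 𝓘(ℝ, FA))]
    (D : VBDef.DoubleVectorBundle IM FE VE FA VA FW VW FU VU) (W : VBDef.VBAlgebroid D) :
    -- the multiderivations of `W → E` and the linear ones are stable under `δ`
    ∃ (hδ : ∀ k, ∀ c ∈ VBDef.multiDer (IM.prod 𝓘(ℝ, FE)) FW VW k,
        W.diff k c ∈ VBDef.multiDer (IM.prod 𝓘(ℝ, FE)) FW VW (k + 1))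
      (hδlin : ∀ k, ∀ c ∈ D.multiDerLin k, W.diff k c ∈ D.multiDerLin (k + 1))
      (core : ∀ k, VBDef.multiDer (IM.prod 𝓘(ℝ, FE)) FW VW k →ₗ[ℝ] D.multiDerCore k)
      (lin : ∀ k, VBDef.multiDer (IM.prod 𝓘(ℝ, FE)) FW VW k →ₗ[ℝ] D.multiDerLin k),
      -- `δ` squares to zero
      (∀ k, ∀ c ∈ VBDef.multiDer (IM.prod 𝓘(ℝ, FE)) FW VW k,
        W.diff (k + 1) (W.diff k c) = 0) ∧
      -- `core` and `lin` are given by the limits that define the linearization map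
      (∀ k c, VBDef.TendstoZero (fun t : ℝˣ => (t : ℝ) • D.pull t c.1) (core k c).1) ∧
      (∀ k c, VBDef.TendstoZero (fun t : ℝˣ => D.pull t c.1 - (t : ℝ)⁻¹ • (core k c).1)
        (lin k c).1) ∧
      -- `lin` is a cochain map
      (∀ k c, lin (k + 1) ((W.diff k).restrict (hδ k) c) =
        (W.diff k).restrict (hδlin k) (lin k c)) ∧
      -- `lin` splits the inclusion
      (∀ k c, lin k (Submodule.inclusion (D.multiDerLin_le k) c) = c) ∧
      -- direct sum decomposition of cochain complexes
      (∀ k, IsCompl (LinearMap.range (Submodule.inclusion (D.multiDerLin_le k)))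
        (LinearMap.ker (lin k))) ∧
      (∀ k, ∀ c ∈ LinearMap.ker (lin k),
        (W.diff k).restrict (hδ k) c ∈ LinearMap.ker (lin (k + 1))) ∧
      -- the inclusion induces an injection in cohomology
      (∀ k, Function.Injective (W.cohomologyMap D.multiDerLin_le k)) := by
  refine ⟨W.diff_mem, W.diff_mem_multiDerLin, D.core, D.lin, fun k c hc => W.diff_diff hc,
    fun k c => D.tendstoZero_core (D.hasExp_pull c), fun k c => D.tendstoZero_lin (D.hasExp_pull c),
    W.lin_diff, D.lin_inclusion, D.isCompl_range_inclusion_ker_lin,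
    fun k c hc => ?_, W.cohomologyMap_injective⟩
  rw [LinearMap.mem_ker, W.lin_diff, LinearMap.mem_ker.1 hc, map_zero]
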